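/- Let $\Bbbk$ be an algebraically closed field of characteristic $0$ and let $H$ be a finite-dimensional Hopf algebra over $\Bbbk$ with comultiplication $\Delta$. Let $G(H)$ be the set of group-like elements of $H$. Assume that $H$ is not cosemisimple, i.e. $H$ is not equal to its coradical (the sum of all simple subcoalgebras of $H$). (1) For every prime number $p$: (a) if $\dim H=12p$ and $p>3$, then $|G(H)|\neq p$; (b) if $\dim H=15p$ and $p>5$, then $|G(H)|\neq p$; (c) if $\dim H=16p$ and $p\ge 3$, then $|G(H)|\neq p$; (d) if $\dim H=20p$ and $p>5$, then $|G(H)|\neq p$; (e) if $\dim H=21p$ and $p=5$ or $p>7$, then $|G(H)|\neq p$. (2) Assume moreover that $H$ has no nontrivial skew-primitives, i.e. there is no $x\in H$ such that, for some $g,h\in G(H)$, $\Delta(x)=g\otimes x+x\otimes h$ and $x\notin\Bbbk(g-h)$. Then: (a) if $\dim H=36$ or $\dim H=45$, then $|G(H)|\neq 3$; (b) if $\dim H=75$ or $\dim H=100$, then $|G(H)|\neq 5$. -/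

import Mathlib

namespace Coalgebra

open scoped _root_.TensorProduct

section Definitions

variable (k : Type*) {C : Type*} [Field k] [AddCommGroup C] [Module k C] [Coalgebra k C]

/-- A subspace `D` of a coalgebra `C` is a subcoalgebra if `Δ(D) ⊆ D ⊗ D`, where `D ⊗ D` is
regarded as a subspace of `C ⊗ C`. -/
def IsSubcoalgebra (D : Submodule k C) : Prop :=
  ∀ x ∈ D, comul (R := k) x ∈ LinearMap.range (_root_.TensorProduct.map D.subtype D.subtype)

/-- A simple subcoalgebra: a nonzero subcoalgebra whose only subcoalgebras are `0` and itself. -/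
structure IsSimpleSubcoalgebra (D : Submodule k C) : Prop where
  isSubcoalgebra : IsSubcoalgebra k D
  ne_bot : D ≠ ⊥
  eq_bot_or_eq : ∀ E : Submodule k C, IsSubcoalgebra k E → E ≤ D → E = ⊥ ∨ E = D

variable (C) in
/-- The coradical of a coalgebra: the sum of all its simple subcoalgebras. -/
def coradical : Submodule k C :=
  sSup {D : Submodule k C | IsSimpleSubcoalgebra k D}

variable (C) in
/-- A coalgebra is cosemisimple if it equals its coradical. -/
def IsCosemisimple : Prop :=
  coradical k C = ⊤

/-- `x` is a nontrivial skew-primitive: `Δ(x) = g ⊗ x + x ⊗ h` for some group-like elements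
`g`, `h` such that `x` is not a scalar multiple of `g - h`. -/
def IsNontrivialSkewPrimitive (x : C) : Prop :=
  ∃ g h : C, IsGroupLikeElem k g ∧ IsGroupLikeElem k h ∧
    comul (R := k) x = g ⊗ₜ[k] x + x ⊗ₜ[k] h ∧ x ∉ Submodule.span k {g - h}

end Definitions

end Coalgebra

/-! The argument takes place in the dual algebra A = H*, whose modules are the comodules of H. Let J
be its radical, d_i the degrees of the irreducible characters, e_i primitive idempotents, c_ij = dim
e_i A e_j the Cartan invariants and r_i = ∑_j c_ij d_j, so that dim H = ∑ d_i r_i. Linear characters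
are the group-likes, and G = G(H) permutes the irreducibles by translation, preserving d and c.
Write o for the trivial character and P = A e_o for its projective cover.

Four structural inputs constrain these numbers. (i) A nonzero integral makes A a Frobenius algebra;
its Nakayama automorphism induces a permutation ν with c_ij = c_{j,ν(i)}, and P has a simple socle.
(ii) Without nontrivial skew-primitives there are no extensions between linear characters. As H is
not cosemisimple, P is not simple; hence P has a nonlinear composition factor S, and if S is the
only one and has multiplicity one, P has at most two linear factors. (iii) Left multiplication on H
by a group-like of prime order has trace 0, so a nontrivial stabilizer in G of an irreducible of
degree d forces p ∣ d. (iv) The vector r is an eigenvector for tensor products. If S has degree 2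
and trivial stabilizer and no degree is 3, then S ⊗ S* contains exactly two linear characters,
whence r_S ≤ r_o.

If |G| = p and dim H = Np with N ≤ 21, the rest is counting (`CartanSystem.false_of_dim`). The
orbits of o and S already weigh almost Np, so S has degree 2 and a free orbit. Let α and κ count the
factors of P that are linear and in the orbit of S. Then r_o = α + 2κ, r_S ≥ κ + 4 and r_o + 2r_S ≤
N. The case κ = 1 contradicts (ii) and (iv); κ ≥ 2 needs N ≥ 18, leaves no room for other
irreducibles, and gives r_o = r_S = N/3 = 7, which parity excludes.

It remains to rule out skew-primitives when p ∤ N. A nontrivial one can be normalized to y with Δ(y)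
= t ⊗ y + y ⊗ 1 and t y = ζ y t. Joint eigenvalues of t and y, together with the quantum binomial
formula, give ζ ≠ 1, y^p = 0 and y^(p-1) ≠ 0. Then H is free over k[y]/(y^p), on a generating space
of dimension divisible by p, so p² ∣ dim H = Np (`SkewPrimitive.sq_dvd_finrank`), a contradiction.
Both this freeness and the trace statement (iii) are derived from the tensor identity H ⊗ H ≅ H ⊗ H,
h ⊗ w ↦ Δ(h)(1 ⊗ w). -/

/-! ### Split algebras: radical, irreducible characters, trace forms -/

/-- A presentation of a finite-dimensional algebra as a nilpotent extension of a product of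
matrix algebras. -/
structure SplitPresentation (k A : Type*) [Field k] [Ring A] [Algebra k A] where
  n : ℕ
  d : Fin n → ℕ
  d_ne_zero : ∀ i, NeZero (d i)
  q : A →ₐ[k] ((i : Fin n) → Matrix (Fin (d i)) (Fin (d i)) k)
  q_surjective : Function.Surjective q
  nilpotent : ∃ m : ℕ, (LinearMap.ker q.toLinearMap) ^ m = ⊥

attribute [instance] SplitPresentation.d_ne_zero

/-- Every finite-dimensional algebra over an algebraically closed field has a split
presentation. -/
theorem SplitPresentation.nonempty (k A : Type*) [Field k] [IsAlgClosed k] [Ring A] [Algebra k A]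
    [FiniteDimensional k A] : Nonempty (SplitPresentation k A) := by
  have : IsArtinianRing A := IsArtinianRing.of_finite k A
  have : IsSemiprimaryRing A := inferInstance
  obtain ⟨n, d, hd, ⟨φ⟩⟩ :=
    IsSemisimpleRing.exists_algEquiv_pi_matrix_of_isAlgClosed k (A ⧸ Ring.jacobson A)
  obtain ⟨m, hm⟩ := IsSemiprimaryRing.isNilpotent (R := A)
  refine ⟨⟨n, d, hd, φ.toAlgHom.comp (Ideal.Quotient.mkₐ k (Ring.jacobson A)),
    φ.surjective.comp (Ideal.Quotient.mkₐ_surjective k _), m, ?_⟩⟩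
  have hker : ∀ x ∈ LinearMap.ker (φ.toAlgHom.comp
      (Ideal.Quotient.mkₐ k (Ring.jacobson A))).toLinearMap, x ∈ Ring.jacobson A := by
    intro x hx
    have hx' : φ (Ideal.Quotient.mk (Ring.jacobson A) x) = 0 := hx
    exact Ideal.Quotient.eq_zero_iff_mem.mp ((map_eq_zero_iff φ φ.injective).mp hx')
  have key : ∀ j : ℕ, ∀ x ∈ (LinearMap.ker (φ.toAlgHom.comp
      (Ideal.Quotient.mkₐ k (Ring.jacobson A))).toLinearMap) ^ j, x ∈ (Ring.jacobson A) ^ j := by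
    intro j
    induction j with
    | zero =>
      intro x _
      rw [Submodule.pow_zero, Ideal.one_eq_top]
      trivial
    | succ j ih =>
      intro x hx
      rw [pow_succ] at hx
      rw [Submodule.pow_succ]
      refine Submodule.mul_induction_on hx (fun a ha b hb => ?_) (fun a b ha hb => ?_)
      · exact Ideal.mul_mem_mul (ih a ha) (hker b hb)
      · exact add_mem ha hb
  rw [eq_bot_iff]
  intro x hx
  have := key m x hx
  rw [hm] at this
  simpa using this

namespace SplitPresentation

variable {k A : Type*} [Field k] [Ring A] [Algebra k A] (P : SplitPresentation k A)

/-- The nilpotent kernel of a split presentation. -/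
def J : Submodule k A := LinearMap.ker P.q.toLinearMap

lemma mem_J {a : A} : a ∈ P.J ↔ P.q a = 0 := Iff.rfl

lemma mul_mem_J_left (a : A) {b : A} (hb : b ∈ P.J) : a * b ∈ P.J := by
  rw [mem_J] at *; rw [map_mul, hb, mul_zero]

lemma mul_mem_J_right {a : A} (b : A) (ha : a ∈ P.J) : a * b ∈ P.J := by
  rw [mem_J] at *; rw [map_mul, ha, zero_mul]

lemma isNilpotent_of_mem_J {a : A} (ha : a ∈ P.J) : IsNilpotent a := by
  obtain ⟨m, hm⟩ := P.nilpotent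
  refine ⟨m, ?_⟩
  have : a ^ m ∈ P.J ^ m := Submodule.pow_mem_pow _ ha m
  have h2 : P.J ^ m = ⊥ := hm
  rw [h2] at this
  simpa using this

/-- The irreducible characters. -/
def tr (i : Fin P.n) : A →ₗ[k] k :=
  Matrix.traceLinearMap (Fin (P.d i)) k k ∘ₗ LinearMap.proj i ∘ₗ P.q.toLinearMap

lemma tr_apply (i : Fin P.n) (a : A) : P.tr i a = (P.q a i).trace := rfl

lemma exists_idempotent_lift (x : (i : Fin P.n) → Matrix (Fin (P.d i)) (Fin (P.d i)) k)
    (hx : IsIdempotentElem x) : ∃ e : A, IsIdempotentElem e ∧ P.q e = x := by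
  have := exists_isIdempotentElem_eq_of_ker_isNilpotent P.q.toRingHom
    (fun a ha => P.isNilpotent_of_mem_J (P.mem_J.mpr (RingHom.mem_ker.mp ha))) x (by
      obtain ⟨a, ha⟩ := P.q_surjective x
      exact ⟨a, ha⟩) hx
  exact this

lemma exists_e (i : Fin P.n) : ∃ e : A, IsIdempotentElem e ∧
    P.q e = Pi.single i (Matrix.single 0 0 1) := by
  apply P.exists_idempotent_lift
  rw [IsIdempotentElem, ← Pi.single_mul, Matrix.single_mul_single_same, one_mul]

/-- A primitive idempotent of the `i`-th block. -/
noncomputable def e (i : Fin P.n) : A := (P.exists_e i).choose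

lemma e_idem (i : Fin P.n) : IsIdempotentElem (P.e i) := (P.exists_e i).choose_spec.1

lemma q_e (i : Fin P.n) : P.q (P.e i) = Pi.single i (Matrix.single 0 0 1) :=
  (P.exists_e i).choose_spec.2

lemma tr_e (i j : Fin P.n) : P.tr i (P.e j) = if i = j then 1 else 0 := by
  rw [tr_apply, q_e]
  split_ifs with h
  · subst h; simp
  · rw [Pi.single_eq_of_ne h]; simp

lemma tr_one (i : Fin P.n) : P.tr i 1 = P.d i := by
  rw [tr_apply, map_one]; simp

/-- Linear functionals that are symmetric and vanish on the nilpotent kernel. -/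
structure IsTraceForm (f : A →ₗ[k] k) : Prop where
  comm : ∀ a b, f (a * b) = f (b * a)
  nil : ∀ a ∈ P.J, f a = 0

lemma isTraceForm_tr (i : Fin P.n) : P.IsTraceForm (P.tr i) where
  comm a b := by simp only [tr_apply, map_mul, Pi.mul_apply]; exact Matrix.trace_mul_comm _ _
  nil a ha := by rw [tr_apply, P.mem_J.mp ha]; simp

/-- A trace form is determined by its values on the primitive idempotents. -/
theorem IsTraceForm.eq_sum {f : A →ₗ[k] k} (hf : P.IsTraceForm f) (a : A) :
    f a = ∑ i, f (P.e i) * P.tr i a := by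
  classical
  have hcongr : ∀ a b : A, P.q a = P.q b → f a = f b := by
    intro a b hab
    have := hf.nil (a - b) (by rw [mem_J, map_sub, hab, sub_self])
    rwa [map_sub, sub_eq_zero] at this
  choose E hE using fun (i : Fin P.n) (s t : Fin (P.d i)) =>
    P.q_surjective (Pi.single i (Matrix.single s t 1))
  -- Symmetry gives f the same value on all diagonal matrix units of a block and 0 on the
  -- off-diagonal ones.
  have hEq : ∀ i s t, f (E i s t) = if s = t then f (P.e i) else 0 := by
    intro i s t
    have h1 : f (E i s 0 * E i 0 t) = f (E i s t) := by
      apply hcongr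
      rw [map_mul, hE, hE, hE, ← Pi.single_mul, Matrix.single_mul_single_same, one_mul]
    rw [← h1, hf.comm]
    split_ifs with h
    · subst h
      apply hcongr
      rw [map_mul, hE, hE, q_e, ← Pi.single_mul, Matrix.single_mul_single_same, one_mul]
    · apply hf.nil
      rw [mem_J, map_mul, hE, hE, ← Pi.single_mul, Matrix.single_mul_single_of_ne]
      · simp
      · exact fun h' => h h'.symm
  have hsum : P.q a = P.q (∑ i, ∑ s, ∑ t, P.q a i s t • E i s t) := by
    simp only [map_sum, map_smul, hE]
    have : ∀ i : Fin P.n, ∑ s, ∑ t, P.q a i s t • (Pi.single i (Matrix.single s t (1 : k)) :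
        (i : Fin P.n) → Matrix (Fin (P.d i)) (Fin (P.d i)) k) = Pi.single i (P.q a i) := by
      intro i
      rw [Matrix.matrix_eq_sum_single (P.q a i)]
      simp only [← Pi.single_smul, Matrix.smul_single, smul_eq_mul, mul_one]
      have hs : ∀ x : Matrix (Fin (P.d i)) (Fin (P.d i)) k, (Pi.single i x :
        (i : Fin P.n) → Matrix (Fin (P.d i)) (Fin (P.d i)) k) =
          AddMonoidHom.single (fun i => Matrix (Fin (P.d i)) (Fin (P.d i)) k) i x := fun _ => rfl
      simp only [hs, map_sum]
      rw [← Matrix.matrix_eq_sum_single (P.q a i)]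
    simp only [this]
    rw [Finset.univ_sum_single]
  rw [hcongr _ _ hsum]
  simp only [map_sum, map_smul, hEq, smul_eq_mul, mul_ite, mul_zero]
  refine Finset.sum_congr rfl fun i _ => ?_
  simp [tr_apply, Matrix.trace, Finset.mul_sum, mul_comm]

section Rep

variable {V : Type*} [AddCommGroup V] [Module k V]

lemma isTraceForm_trace [FiniteDimensional k V] (ρ : A →ₐ[k] Module.End k V) :
    P.IsTraceForm (LinearMap.trace k V ∘ₗ ρ.toLinearMap) where
  comm a b := by
    simp only [LinearMap.comp_apply, AlgHom.toLinearMap_apply, map_mul]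
    exact LinearMap.trace_mul_comm k _ _
  nil a ha := by
    have h := (P.isNilpotent_of_mem_J ha).map ρ
    exact (LinearMap.isNilpotent_trace_of_isNilpotent h).eq_zero

end Rep

end SplitPresentation

/-! ### Automorphisms acting on characters, and Cartan invariants -/

lemma LinearMap.trace_eq_finrank_range {k V : Type*} [Field k] [AddCommGroup V] [Module k V]
    [FiniteDimensional k V] {f : Module.End k V} (hf : IsIdempotentElem f) :
    LinearMap.trace k V f = Module.finrank k (LinearMap.range f) :=
  (LinearMap.IsIdempotentElem.isProj_range f hf).trace

/-- Natural numbers do not cancel in a sum, so two mutually inverse matrices over ℕ can only be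
permutation matrices. This is applied to the matrix that expresses twisted irreducible characters in
terms of irreducible ones. -/
lemma exists_perm_of_nat_inverse {n : ℕ} (M M' : Fin n → Fin n → ℕ)
    (h1 : ∀ i l, ∑ j, M i j * M' j l = if i = l then 1 else 0)
    (h2 : ∀ i l, ∑ j, M' i j * M j l = if i = l then 1 else 0) :
    ∃ π : Equiv.Perm (Fin n), ∀ i j, M i j = if j = π i then 1 else 0 := by
  have hz : ∀ i j l, M i j ≠ 0 → l ≠ i → M' j l = 0 := by
    intro i j l hij hl
    have := h1 i l
    rw [if_neg (Ne.symm hl), Finset.sum_eq_zero_iff] at this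
    exact (mul_eq_zero.mp (this j (Finset.mem_univ _))).resolve_left hij
  have hrow : ∀ i j l, M i j ≠ 0 → M' j i * M i l = if j = l then 1 else 0 := by
    intro i j l hij
    rw [← h2 j l, Fintype.sum_eq_single i (fun b hb => ?_)]
    rw [hz i j b hij hb, zero_mul]
  have hex : ∀ i, ∃ j, M i j ≠ 0 := by
    intro i
    by_contra hcon
    push Not at hcon
    have := h1 i i
    simp [hcon] at this
  choose π hπ using hex
  have hM : ∀ i j, M i j = if j = π i then 1 else 0 := by
    intro i j
    have hA := hrow i (π i) (π i) (hπ i)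
    rw [if_pos rfl] at hA
    split_ifs with h
    · subst h; exact Nat.eq_one_of_mul_eq_one_left hA
    · have hB := hrow i (π i) j (hπ i)
      rw [if_neg (Ne.symm h)] at hB
      rcases mul_eq_zero.mp hB with h' | h'
      · rw [h', zero_mul] at hA; exact absurd hA (by decide)
      · exact h'
  have hinj : Function.Injective π := by
    intro i i' hii
    by_contra hne
    have hA := hrow i (π i) (π i) (hπ i)
    rw [if_pos rfl, hz i' (π i) i (by rw [hii]; exact hπ i') hne, zero_mul] at hA
    exact absurd hA (by decide)
  refine ⟨Equiv.ofBijective π (Finite.injective_iff_bijective.mp hinj), hM⟩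

namespace SplitPresentation

variable {k A : Type*} [Field k] [Ring A] [Algebra k A] (P : SplitPresentation k A)

lemma exists_nat_tr (i : Fin P.n) {a : A} (ha : IsIdempotentElem a) : ∃ m : ℕ, P.tr i a = m := by
  have h : IsIdempotentElem (Matrix.toLin' (P.q a i)) := by
    rw [IsIdempotentElem, Module.End.mul_eq_comp, ← Matrix.toLin'_mul,
      ← Pi.mul_apply, ← map_mul, ha.eq]
  refine ⟨Module.finrank k (LinearMap.range (Matrix.toLin' (P.q a i))), ?_⟩
  rw [tr_apply, ← Matrix.trace_toLin'_eq, LinearMap.trace_eq_finrank_range h]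

lemma tr_eq_zero_of_isNilpotent (i : Fin P.n) {a : A} (ha : IsNilpotent a) : P.tr i a = 0 := by
  have h : IsNilpotent (P.q a i) := (ha.map P.q).map (Pi.evalRingHom _ i)
  exact (Matrix.isNilpotent_trace_of_isNilpotent h).eq_zero

lemma tr_injective {i j : Fin P.n} (h : ∀ a, P.tr i a = P.tr j a) : i = j := by
  by_contra hne
  have := h (P.e i)
  rw [tr_e, tr_e, if_pos rfl, if_neg (Ne.symm hne)] at this
  exact one_ne_zero this

/-- An automorphism or anti-automorphism permutes the irreducible characters. -/
theorem exists_perm [CharZero k] (θ : A ≃ₗ[k] A) (h1 : θ 1 = 1)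
    (hm : (∀ a b, θ (a * b) = θ a * θ b) ∨ (∀ a b, θ (a * b) = θ b * θ a)) :
    ∃ π : Equiv.Perm (Fin P.n), (∀ i a, P.tr i (θ a) = P.tr (π i) a) ∧ ∀ i, P.d (π i) = P.d i := by
  have key : ∀ θ : A ≃ₗ[k] A, θ 1 = 1 →
      ((∀ a b, θ (a * b) = θ a * θ b) ∨ (∀ a b, θ (a * b) = θ b * θ a)) →
      ∃ M : Fin P.n → Fin P.n → ℕ, ∀ i a, P.tr i (θ a) = ∑ j, (M i j : k) * P.tr j a := by
    intro θ h1 hm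
    have hpow : ∀ a (m : ℕ), θ (a ^ m) = θ a ^ m := by
      intro a m
      induction m with
      | zero => simpa using h1
      | succ m ih =>
        rcases hm with hm | hm
        · rw [pow_succ, hm, ih, pow_succ]
        · rw [pow_succ, hm, ih, pow_succ']
    -- A twisted character is still a trace form, so it expands in irreducible characters. The
    -- coefficients are traces of the idempotents θ(e_j), hence natural numbers.
    have hT : ∀ i, P.IsTraceForm (P.tr i ∘ₗ θ.toLinearMap) := by
      intro i
      constructor
      · intro a b
        simp only [LinearMap.comp_apply, LinearEquiv.coe_coe]
        rcases hm with hm | hm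
        · rw [hm, hm, (P.isTraceForm_tr i).comm]
        · rw [hm, hm, (P.isTraceForm_tr i).comm]
      · intro a ha
        obtain ⟨m, hm'⟩ := P.isNilpotent_of_mem_J ha
        refine P.tr_eq_zero_of_isNilpotent i ⟨m, ?_⟩
        simp only [LinearEquiv.coe_coe]
        rw [← hpow, hm', map_zero]
    have hN : ∀ i j, ∃ m : ℕ, P.tr i (θ (P.e j)) = m := by
      intro i j
      apply P.exists_nat_tr
      rw [IsIdempotentElem, ← pow_two, ← hpow, pow_two, (P.e_idem j).eq]
    choose M hM using hN
    refine ⟨M, fun i a => ?_⟩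
    have := (hT i).eq_sum P a
    simp only [LinearMap.comp_apply, LinearEquiv.coe_coe, hM] at this
    exact this
  obtain ⟨M, hM⟩ := key θ h1 hm
  have h1' : θ.symm 1 = 1 := by rw [LinearEquiv.symm_apply_eq, h1]
  have hm' : (∀ a b, θ.symm (a * b) = θ.symm a * θ.symm b) ∨
      (∀ a b, θ.symm (a * b) = θ.symm b * θ.symm a) := by
    rcases hm with hm | hm
    · left; intro a b; rw [LinearEquiv.symm_apply_eq, hm]; simp
    · right; intro a b; rw [LinearEquiv.symm_apply_eq, hm]; simp
  obtain ⟨M', hM'⟩ := key θ.symm h1' hm'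
  have hcomp : ∀ (θ θ' : A ≃ₗ[k] A) (M M' : Fin P.n → Fin P.n → ℕ), (∀ a, θ (θ' a) = a) →
      (∀ i a, P.tr i (θ a) = ∑ j, (M i j : k) * P.tr j a) →
      (∀ i a, P.tr i (θ' a) = ∑ j, (M' i j : k) * P.tr j a) →
      ∀ i l, ∑ j, M i j * M' j l = if i = l then 1 else 0 := by
    intro θ θ' M M' hinv h h' i l
    have := h i (θ' (P.e l))
    rw [hinv, tr_e] at this
    simp only [h', tr_e, mul_ite, mul_one, mul_zero, Finset.sum_ite_eq', Finset.mem_univ,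
      if_true] at this
    have h3 : ((∑ j, M i j * M' j l : ℕ) : k) = ((if i = l then 1 else 0 : ℕ) : k) := by
      push_cast
      rw [← this]
    exact_mod_cast h3
  obtain ⟨π, hπ⟩ := exists_perm_of_nat_inverse M M' (hcomp θ θ.symm M M' (by simp) hM hM')
    (hcomp θ.symm θ M' M (by simp) hM' hM)
  have hfin : ∀ i a, P.tr i (θ a) = P.tr (π i) a := by
    intro i a
    rw [hM]
    simp [hπ]
  refine ⟨π, hfin, fun i => ?_⟩
  have := hfin i 1
  rw [h1, tr_one, tr_one] at this
  exact_mod_cast this.symm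

lemma e_ne_zero (i : Fin P.n) : P.e i ≠ 0 := by
  intro h
  have := P.tr_e i i
  rw [h, map_zero, if_pos rfl] at this
  exact zero_ne_one this

section Cartan

/-- The operator `z ↦ a z b`. -/
def sandwich (a b : A) : Module.End k A := LinearMap.mulLeft k a * LinearMap.mulRight k b

@[simp] lemma sandwich_apply (a b z : A) : sandwich (k := k) a b z = a * (z * b) := rfl

lemma sandwich_idem {a b : A} (ha : IsIdempotentElem a) (hb : IsIdempotentElem b) :
    IsIdempotentElem (sandwich (k := k) a b) := by
  ext z
  simp only [Module.End.mul_apply, sandwich_apply]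
  rw [mul_assoc a, mul_assoc z, hb.eq, ← mul_assoc, ha.eq]

/-- The Cartan invariants. -/
noncomputable def c (i j : Fin P.n) : ℕ :=
  Module.finrank k (LinearMap.range (sandwich (k := k) (P.e i) (P.e j)))

variable [FiniteDimensional k A]

lemma trace_sandwich_e (i j : Fin P.n) :
    LinearMap.trace k A (sandwich (P.e i) (P.e j)) = P.c i j :=
  LinearMap.trace_eq_finrank_range (sandwich_idem (P.e_idem i) (P.e_idem j))

/-- Left and right multiplications commute, so with one argument fixed the trace is a trace form in
the other. Expanding in both arguments leaves the Cartan invariants as coefficients; dimensions of a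
A b for idempotents a, b are then read off from characters. -/
lemma trace_sandwich (a b : A) : LinearMap.trace k A (sandwich a b) =
    ∑ i, ∑ j, (P.c i j : k) * P.tr i a * P.tr j b := by
  have hcomm : ∀ x y : A, Commute (LinearMap.mulLeft k x) (LinearMap.mulRight k y) :=
    fun x y => LinearMap.commute_mulLeft_right x y
  have hnilL : ∀ x ∈ P.J, IsNilpotent (LinearMap.mulLeft k x) := by
    intro x hx
    exact (LinearMap.isNilpotent_mulLeft_iff k x).mpr (P.isNilpotent_of_mem_J hx)
  have hnilR : ∀ x ∈ P.J, IsNilpotent (LinearMap.mulRight k x) := by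
    intro x hx
    exact (LinearMap.isNilpotent_mulRight_iff k x).mpr (P.isNilpotent_of_mem_J hx)
  have hA : ∀ y : A, P.IsTraceForm (LinearMap.trace k A ∘ₗ
      LinearMap.mulRight k (LinearMap.mulRight k y) ∘ₗ LinearMap.mul k A) := by
    intro y
    constructor
    · intro x x'
      change LinearMap.trace k A (LinearMap.mulLeft k (x * x') * LinearMap.mulRight k y) =
        LinearMap.trace k A (LinearMap.mulLeft k (x' * x) * LinearMap.mulRight k y)
      rw [LinearMap.mulLeft_mul, LinearMap.mulLeft_mul]
      change LinearMap.trace k A (LinearMap.mulLeft k x * LinearMap.mulLeft k x' *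
        LinearMap.mulRight k y) = LinearMap.trace k A (LinearMap.mulLeft k x' *
        LinearMap.mulLeft k x * LinearMap.mulRight k y)
      rw [mul_assoc, LinearMap.trace_mul_comm, mul_assoc, mul_assoc, (hcomm x y).eq]
    · intro x hx
      exact (LinearMap.isNilpotent_trace_of_isNilpotent
        ((hcomm x y).isNilpotent_mul_right (hnilL x hx))).eq_zero
  have hB : ∀ x : A, P.IsTraceForm (LinearMap.trace k A ∘ₗ
      LinearMap.mulLeft k (LinearMap.mulLeft k x) ∘ₗ (LinearMap.mul k A).flip) := by
    intro x
    constructor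
    · intro y y'
      change LinearMap.trace k A (LinearMap.mulLeft k x * LinearMap.mulRight k (y * y')) =
        LinearMap.trace k A (LinearMap.mulLeft k x * LinearMap.mulRight k (y' * y))
      rw [LinearMap.mulRight_mul, LinearMap.mulRight_mul]
      change LinearMap.trace k A (LinearMap.mulLeft k x * (LinearMap.mulRight k y' *
        LinearMap.mulRight k y)) = LinearMap.trace k A (LinearMap.mulLeft k x *
        (LinearMap.mulRight k y * LinearMap.mulRight k y'))
      rw [← mul_assoc, LinearMap.trace_mul_comm, ← mul_assoc, ← mul_assoc, (hcomm x y).eq]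
    · intro y hy
      exact (LinearMap.isNilpotent_trace_of_isNilpotent
        ((hcomm x y).isNilpotent_mul_left (hnilR y hy))).eq_zero
  have h1 := (hA b).eq_sum P a
  have h2 : ∀ i, LinearMap.trace k A (sandwich (P.e i) b) =
      ∑ j, (P.c i j : k) * P.tr j b := by
    intro i
    have := (hB (P.e i)).eq_sum P b
    refine this.trans (Finset.sum_congr rfl fun j _ => ?_)
    rw [← trace_sandwich_e]
    rfl
  refine h1.trans (Finset.sum_congr rfl fun i _ => ?_)
  have h3 := h2 i
  change LinearMap.trace k A (sandwich (P.e i) b) * _ = _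
  rw [h3, Finset.sum_mul]
  exact Finset.sum_congr rfl fun j _ => by ring

/-- The multiplicity of the `i`-th irreducible in the regular representation. -/
noncomputable def r (i : Fin P.n) : ℕ := ∑ j, P.c i j * P.d j

lemma trace_mulLeft (a : A) :
    LinearMap.trace k A (LinearMap.mulLeft k a) = ∑ i, (P.r i : k) * P.tr i a := by
  have h := P.trace_sandwich a 1
  have h1 : sandwich (k := k) a 1 = LinearMap.mulLeft k a := by ext z; simp
  rw [h1] at h
  rw [h]
  refine Finset.sum_congr rfl fun i _ => ?_
  simp only [tr_one, r, Nat.cast_sum, Nat.cast_mul, Finset.sum_mul]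
  exact Finset.sum_congr rfl fun j _ => by ring

lemma finrank_eq [CharZero k] : Module.finrank k A = ∑ i, P.d i * P.r i := by
  have h := P.trace_mulLeft 1
  rw [LinearMap.mulLeft_one, LinearMap.trace_id] at h
  simp only [tr_one] at h
  have h2 : (Module.finrank k A : k) = ((∑ i, P.d i * P.r i : ℕ) : k) := by
    rw [h]; push_cast
    exact Finset.sum_congr rfl fun j _ => by ring
  exact_mod_cast h2

lemma one_le_c_self (i : Fin P.n) : 1 ≤ P.c i i := by
  rw [c, Nat.one_le_iff_ne_zero, ← Nat.pos_iff_ne_zero, Module.finrank_pos_iff]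
  refine ⟨⟨⟨P.e i, P.e i, ?_⟩, 0, ?_⟩⟩
  · simp [(P.e_idem i).eq]
  · intro h
    exact P.e_ne_zero i (by simpa using congrArg Subtype.val h)

/-- Cartan invariants are preserved by automorphisms. -/
lemma c_perm [CharZero k] (θ : A ≃ₐ[k] A) (π : Equiv.Perm (Fin P.n))
    (hπ : ∀ i a, P.tr i (θ a) = P.tr (π i) a) (i j : Fin P.n) : P.c (π i) (π j) = P.c i j := by
  have h : ∀ a b, LinearMap.trace k A (sandwich (θ a) (θ b)) =
      LinearMap.trace k A (sandwich (k := k) a b) := by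
    intro a b
    rw [← LinearMap.trace_conj' (sandwich a b) θ.toLinearEquiv]
    congr 1
    ext z
    simp [LinearEquiv.conj_apply]
  have h2 := h (P.e (π i)) (P.e (π j))
  rw [trace_sandwich_e, P.trace_sandwich] at h2
  simp only [hπ, tr_e, EmbeddingLike.apply_eq_iff_eq, mul_ite, mul_one, mul_zero,
    Finset.sum_ite_eq', Finset.mem_univ, if_true] at h2
  exact_mod_cast h2.symm

end Cartan

end SplitPresentation

/-! ### Frobenius forms and the Nakayama permutation -/

namespace SplitPresentation

variable {k A : Type*} [Field k] [Ring A] [Algebra k A] (P : SplitPresentation k A)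

/-- Describing the radical by characters alone makes its invariance under automorphisms a
consequence of their permuting the characters. -/
lemma mem_J_iff_tr {a : A} : a ∈ P.J ↔ ∀ i b, P.tr i (a * b) = 0 := by
  constructor
  · intro ha i b
    exact (P.isTraceForm_tr i).nil _ (P.mul_mem_J_right b ha)
  · intro h
    rw [mem_J]
    funext i
    ext s t
    obtain ⟨b, hb⟩ := P.q_surjective (Pi.single i (Matrix.single t s 1))
    have := h i b
    rw [tr_apply, map_mul, hb, Pi.mul_apply, Pi.single_eq_same, Matrix.trace_mul_single] at this
    simpa using this

lemma map_mem_J [CharZero k] (θ : A ≃ₐ[k] A) {a : A} (ha : a ∈ P.J) : θ a ∈ P.J := by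
  obtain ⟨π, hπ, -⟩ := P.exists_perm θ.toLinearEquiv (by simp) (Or.inl (by simp))
  rw [mem_J_iff_tr] at *
  intro i b
  have := hπ i (a * θ.symm b)
  simp only [AlgEquiv.toLinearEquiv_apply, map_mul, AlgEquiv.apply_symm_apply] at this
  rw [this, ha]

section Linear

variable {P} {i : Fin P.n} (hi : P.d i = 1)
include hi

lemma q_of_linear (a : A) : P.q a i = P.tr i a • 1 := by
  have : Subsingleton (Fin (P.d i)) := by rw [hi]; infer_instance
  ext s t
  rw [tr_apply, Matrix.trace, Fintype.sum_subsingleton _ s, Subsingleton.elim t s]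
  simp

lemma tr_mul_of_linear (a b : A) : P.tr i (a * b) = P.tr i a * P.tr i b := by
  have h := q_of_linear hi (a * b)
  rw [map_mul, Pi.mul_apply, q_of_linear hi a, q_of_linear hi b] at h
  have h2 := congrFun (congrFun h 0) 0
  simpa [mul_comm] using h2.symm

lemma single_one_of_linear :
    (Matrix.single 0 0 1 : Matrix (Fin (P.d i)) (Fin (P.d i)) k) = 1 := by
  have : Subsingleton (Fin (P.d i)) := by rw [hi]; infer_instance
  ext s t
  rw [Subsingleton.elim s 0, Subsingleton.elim t 0]
  simp

lemma mul_e_sub_mem_J (a : A) : a * P.e i - P.tr i a • P.e i ∈ P.J := by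
  rw [mem_J, map_sub, map_mul, map_smul, sub_eq_zero, q_e, single_one_of_linear hi]
  funext j
  by_cases h : j = i
  · subst h; simp [q_of_linear hi a]
  · simp [Pi.single_eq_of_ne h]

lemma e_mul_sub_mem_J (a : A) : P.e i * a - P.tr i a • P.e i ∈ P.J := by
  rw [mem_J, map_sub, map_mul, map_smul, sub_eq_zero, q_e, single_one_of_linear hi]
  funext j
  by_cases h : j = i
  · subst h; simp [q_of_linear hi a]
  · simp [Pi.single_eq_of_ne h]

end Linear

section Frobenius

variable [FiniteDimensional k A] {φ : A →ₗ[k] k} (hφ : ∀ a, (∀ b, φ (a * b) = 0) → a = 0)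
include hφ

omit P in
/-- The Nakayama automorphism of a Frobenius form. -/
lemma exists_nakayama : ∃ θ : A ≃ₐ[k] A, ∀ a b, φ (a * b) = φ (b * θ a) := by
  let L : A →ₗ[k] Module.Dual k A := (LinearMap.mul k A).compr₂ φ
  let R : A →ₗ[k] Module.Dual k A := ((LinearMap.mul k A).flip).compr₂ φ
  have hL : ∀ a b, L a b = φ (a * b) := fun _ _ => rfl
  have hR : ∀ a b, R a b = φ (b * a) := fun _ _ => rfl
  have hLi : Function.Injective L := by
    rw [← LinearMap.ker_eq_bot, LinearMap.ker_eq_bot']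
    intro a ha
    exact hφ a fun b => by rw [← hL, ha]; rfl
  have hdim : Module.finrank k A = Module.finrank k (Module.Dual k A) :=
    (Subspace.dual_finrank_eq).symm
  have hLs : Function.Surjective L :=
    (LinearMap.injective_iff_surjective_of_finrank_eq_finrank hdim).mp hLi
  have hRi : Function.Injective R := by
    rw [← LinearMap.ker_eq_bot, LinearMap.ker_eq_bot']
    intro a ha
    by_contra hne
    obtain ⟨f, hf, -⟩ := Submodule.exists_le_ker_of_notMem (p := (⊥ : Submodule k A)) (v := a)
      (by simpa using hne)
    obtain ⟨b, rfl⟩ := hLs f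
    apply hf
    rw [hL, ← hR, ha]; rfl
  let R' : A ≃ₗ[k] Module.Dual k A := LinearEquiv.ofBijective R
    ⟨hRi, (LinearMap.injective_iff_surjective_of_finrank_eq_finrank hdim).mp hRi⟩
  let L' : A ≃ₗ[k] Module.Dual k A := LinearEquiv.ofBijective L ⟨hLi, hLs⟩
  let T : A ≃ₗ[k] A := L'.trans R'.symm
  have hT : ∀ a b, φ (a * b) = φ (b * T a) := by
    intro a b
    have : R' (T a) = L' a := by simp [T]
    have := LinearMap.congr_fun this b
    exact this.symm
  have huniq : ∀ x y : A, (∀ b, φ (b * x) = φ (b * y)) → x = y := by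
    intro x y h
    apply hRi
    ext b
    exact h b
  refine ⟨AlgEquiv.ofLinearEquiv T ?_ ?_, hT⟩
  · apply huniq
    intro b
    rw [← hT, one_mul, mul_one]
  · intro x y
    apply huniq
    intro b
    rw [← hT, ← mul_assoc, ← hT, ← mul_assoc, mul_assoc, hT, mul_assoc]

-- The map w ↦ φ(· w) identifies A with its dual and carries the operator w ↦ b w θ(a) to the
-- transpose of z ↦ a z b.
omit P hφ in
lemma trace_sandwich_nakayama (hφ : ∀ a, (∀ b, φ (a * b) = 0) → a = 0) {θ : A ≃ₐ[k] A}
    (hθ : ∀ a b, φ (a * b) = φ (b * θ a)) (a b : A) :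
    LinearMap.trace k A (sandwich a b) = LinearMap.trace k A (sandwich b (θ a)) := by
  let R : A →ₗ[k] Module.Dual k A := ((LinearMap.mul k A).flip).compr₂ φ
  have hRi : Function.Injective R := by
    rw [← LinearMap.ker_eq_bot, LinearMap.ker_eq_bot']
    intro x hx
    have : θ.symm x = 0 := hφ _ fun b => by
      rw [hθ, AlgEquiv.apply_symm_apply]
      exact LinearMap.congr_fun hx b
    simpa using this
  let R' : A ≃ₗ[k] Module.Dual k A := LinearEquiv.ofBijective R
    ⟨hRi, (LinearMap.injective_iff_surjective_of_finrank_eq_finrank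
      (Subspace.dual_finrank_eq).symm).mp hRi⟩
  rw [← LinearMap.trace_transpose' (sandwich a b), ← LinearMap.trace_conj' (sandwich b (θ a)) R']
  congr 1
  apply LinearMap.ext
  intro f
  obtain ⟨w, rfl⟩ := R'.surjective f
  rw [LinearEquiv.conj_apply]
  ext z
  simp only [LinearMap.comp_apply, LinearEquiv.coe_coe, LinearEquiv.symm_apply_apply,
    sandwich_apply]
  change φ (a * (z * b) * w) = φ (z * (b * (w * θ a)))
  rw [mul_assoc, hθ]
  simp only [mul_assoc]

/-- Numerical consequences of the Frobenius property. -/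
theorem exists_nakayama_perm [CharZero k] : ∃ ν : Equiv.Perm (Fin P.n),
    (∀ i, P.d (ν i) = P.d i) ∧ (∀ i j, P.c i j = P.c j (ν i)) ∧
    ∀ i j, ν i = i → j ≠ i → 1 ≤ P.c j i → 2 ≤ P.c i i := by
  obtain ⟨θ, hθ⟩ := exists_nakayama hφ
  obtain ⟨ν, hν, hd⟩ := P.exists_perm θ.symm.toLinearEquiv (by simp) (Or.inl (by simp))
  have hν' : ∀ i a, P.tr i (θ.symm a) = P.tr (ν i) a := hν
  refine ⟨ν, hd, fun i j => ?_, fun i j hi hj hc => ?_⟩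
  · have h := trace_sandwich_nakayama hφ hθ (P.e i) (P.e j)
    rw [trace_sandwich_e, P.trace_sandwich] at h
    have h2 : ∀ m, P.tr m (θ (P.e i)) = if m = ν i then 1 else 0 := by
      intro m
      obtain ⟨m', rfl⟩ := ν.surjective m
      rw [← hν', AlgEquiv.symm_apply_apply, tr_e]
      simp
    simp only [h2, tr_e, mul_ite, mul_one, mul_zero, Finset.sum_ite_eq', Finset.mem_univ,
      if_true] at h
    simpa using h
  -- Suppose c_ii = 1 and put u = θ⁻¹(e_i). Since ν fixes i, u has the same characters as e_i, so u
  -- A e_i is a line. A nonzero x in e_j A e_i lies in J and yields a nonzero element u a x of this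
  -- line. But the line also contains some u b e_i outside J.
  · by_contra hlt
    have hc1 : P.c i i = 1 := le_antisymm (by omega) (P.one_le_c_self i)
    obtain ⟨⟨x, z, hx⟩, hx0⟩ : ∃ x : LinearMap.range (sandwich (k := k) (P.e j) (P.e i)), x ≠ 0 := by
      have : 0 < Module.finrank k (LinearMap.range (sandwich (k := k) (P.e j) (P.e i))) := hc
      have := Module.finrank_pos_iff.mp this
      exact exists_ne 0
    have hx0' : x ≠ 0 := fun h => hx0 (Subtype.ext h)
    have hxe : x * P.e i = x := by
      rw [← hx, sandwich_apply, mul_assoc, mul_assoc, (P.e_idem i).eq]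
    have hxJ : x ∈ P.J := by
      rw [mem_J, ← hx, sandwich_apply, map_mul, map_mul, q_e, q_e]
      funext m
      by_cases hm : m = j
      · subst hm; simp [Pi.single_eq_of_ne hj]
      · simp [Pi.single_eq_of_ne hm]
    obtain ⟨a, ha⟩ : ∃ a, φ (a * x) ≠ 0 := by
      by_contra hcon
      push Not at hcon
      refine hx0' (hφ x fun b => ?_)
      rw [← θ.apply_symm_apply b, ← hθ, hcon]
    set u := θ.symm (P.e i) with hu
    have hw : u * (a * x) ≠ 0 := by
      intro h0
      apply ha
      rw [← hxe, ← mul_assoc, ← θ.apply_symm_apply (P.e i), ← hθ, ← hu, h0, map_zero]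
    have hui : IsIdempotentElem u := (P.e_idem i).map θ.symm
    have hutr : ∀ m, P.tr m u = if m = i then 1 else 0 := by
      intro m
      rw [hu, hν', tr_e]
      congr 1
      rw [eq_iff_iff, ← ν.injective.eq_iff (a := m), hi]
    have hdim : Module.finrank k (LinearMap.range (sandwich (k := k) u (P.e i))) = 1 := by
      have h := LinearMap.trace_eq_finrank_range (sandwich_idem (k := k) hui (P.e_idem i))
      rw [P.trace_sandwich] at h
      simp only [hutr, tr_e, mul_ite, mul_one, mul_zero, Finset.sum_ite_eq', Finset.mem_univ,
        if_true, hc1] at h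
      simpa [hc1] using h.symm
    have hX : P.q u i ≠ 0 := by
      intro h0
      have := hutr i
      rw [tr_apply, h0, if_pos rfl] at this
      simp at this
    obtain ⟨s, t, hst⟩ : ∃ s t, P.q u i s t ≠ 0 := by
      by_contra hcon
      push Not at hcon
      exact hX (Matrix.ext hcon)
    obtain ⟨b, hb⟩ := P.q_surjective (Pi.single i (Matrix.single t 0 1))
    have hwmem : u * (a * x) ∈ LinearMap.range (sandwich (k := k) u (P.e i)) :=
      ⟨a * x, by rw [sandwich_apply, mul_assoc, hxe]⟩
    obtain ⟨γ, hγ⟩ := exists_smul_eq_of_finrank_eq_one hdim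
      (x := ⟨_, hwmem⟩) (fun h => hw (congrArg Subtype.val h))
      ⟨sandwich u (P.e i) b, ⟨b, rfl⟩⟩
    have hγ' : γ • (u * (a * x)) = u * (b * P.e i) := congrArg Subtype.val hγ
    have hJ : u * (b * P.e i) ∈ P.J := by
      rw [← hγ']
      exact P.J.smul_mem _ (P.mul_mem_J_left _ (P.mul_mem_J_left _ hxJ))
    rw [mem_J, map_mul, map_mul, hb, q_e, ← Pi.single_mul, Matrix.single_mul_single_same] at hJ
    have := congrFun (congrFun (congrFun hJ i) s) 0
    simp at this
    exact hst this

end Frobenius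

end SplitPresentation

/-! ### The projective cover of a linear character -/

namespace SplitPresentation

variable {k A : Type*} [Field k] [Ring A] [Algebra k A] (P : SplitPresentation k A)

/-- An idempotent lifting the identity of the one-dimensional blocks. -/
lemma exists_linear_idempotent : ∃ ε : A, IsIdempotentElem ε ∧
    P.q ε = fun i => if P.d i = 1 then 1 else 0 := by
  apply P.exists_idempotent_lift
  funext i
  simp only [Pi.mul_apply]
  split_ifs <;> simp

lemma mul_mem_JJ {a b : A} (ha : a ∈ P.J) (hb : b ∈ P.J) : a * b ∈ P.J * P.J :=
  Submodule.mul_mem_mul ha hb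

lemma mul_mem_JJ_left (a : A) {y : A} (hy : y ∈ P.J * P.J) : a * y ∈ P.J * P.J := by
  refine Submodule.mul_induction_on hy (fun b hb c hc => ?_) (fun b c hb hc => ?_)
  · rw [← mul_assoc]; exact P.mul_mem_JJ (P.mul_mem_J_left a hb) hc
  · rw [mul_add]; exact add_mem hb hc

lemma exists_pow_J_eq_zero : ∃ m : ℕ, ∀ y ∈ P.J ^ m, y = 0 := by
  obtain ⟨m, hm⟩ := P.nilpotent
  refine ⟨m, fun y hy => ?_⟩
  have h2 : P.J ^ m = ⊥ := hm
  rw [h2] at hy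
  simpa using hy

/-- A subspace killed on the right by `e` as soon as it can be pushed deeper into the radical. -/
lemma mul_eq_zero_of_le {e : A} {N : Submodule k A}
    (h : ∀ x ∈ N, ∃ y ∈ P.J * N, x * e = y * e) : ∀ x ∈ N, x * e = 0 := by
  -- Iterating the hypothesis moves x e into J^m N e for every m, and J is nilpotent.
  have key : ∀ m : ℕ, ∀ x ∈ N, ∃ y ∈ P.J ^ m * N, x * e = y * e := by
    intro m
    induction m with
    | zero => intro x hx; exact ⟨x, by simpa using hx, rfl⟩
    | succ m ih =>
      intro x hx
      obtain ⟨y, hy, hxy⟩ := h x hx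
      have : ∃ y' ∈ P.J ^ (m + 1) * N, y * e = y' * e := by
        refine Submodule.mul_induction_on hy (fun b hb c hc => ?_) (fun b c hb hc => ?_)
        · obtain ⟨z, hz, hcz⟩ := ih c hc
          refine ⟨b * z, ?_, by rw [mul_assoc, hcz, mul_assoc]⟩
          rw [pow_succ', mul_assoc]
          exact Submodule.mul_mem_mul hb hz
        · obtain ⟨b', hb', hbe⟩ := hb
          obtain ⟨c', hc', hce⟩ := hc
          exact ⟨b' + c', add_mem hb' hc', by rw [add_mul, hbe, hce, add_mul]⟩
      obtain ⟨y', hy', hyy⟩ := this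
      exact ⟨y', hy', hxy.trans hyy⟩
  obtain ⟨m, hm⟩ := P.exists_pow_J_eq_zero
  intro x hx
  obtain ⟨y, hy, hxy⟩ := key m x hx
  have h0 : P.J ^ m = ⊥ := by rw [eq_bot_iff]; intro z hz; simpa using hm z hz
  rw [h0] at hy
  simp at hy
  rw [hxy, hy, zero_mul]

section

variable {P} {ε : A} (hqε : P.q ε = fun i => if P.d i = 1 then 1 else 0)
  (hε : IsIdempotentElem ε) (hNE : ∀ z ∈ P.J, ε * z * ε ∈ P.J * P.J)
  {o : Fin P.n} (ho : P.d o = 1)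

include hqε ho in
lemma one_sub_mul_e_mem : (1 - ε) * P.e o ∈ P.J := by
  rw [mem_J, map_mul, map_sub, map_one, hqε, q_e]
  funext i
  by_cases h : i = o
  · subst h; simp [ho]
  · simp [Pi.single_eq_of_ne h]

include hqε in
lemma tr_linear_idempotent (i : Fin P.n) : P.tr i ε = if P.d i = 1 then 1 else 0 := by
  rw [tr_apply, hqε]
  by_cases h : P.d i = 1 <;> simp [h]

include hqε in
lemma tr_one_sub (i : Fin P.n) : P.tr i (1 - ε) = if P.d i = 1 then 0 else (P.d i : k) := by
  rw [map_sub, tr_one, tr_linear_idempotent hqε]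
  split_ifs with h <;> simp [h]

-- Since (1 - ε) e_o lies in J, replacing ε z e_o by ε z ε e_o costs only an element of J² e_o, and
-- ε z ε is in J² by the absence of extensions between linear characters.
include hqε hNE ho in
lemma linear_part_mem {z : A} (hz : z ∈ P.J) : ∃ y ∈ P.J * P.J, ε * z * P.e o = y * P.e o := by
  refine ⟨ε * z * ε + ε * z * ((1 - ε) * P.e o), add_mem (hNE z hz)
    (P.mul_mem_JJ (P.mul_mem_J_left _ hz) (one_sub_mul_e_mem hqε ho)), ?_⟩
  rw [add_mul, mul_assoc (ε * z) ((1 - ε) * P.e o), mul_assoc (1 - ε), (P.e_idem o).eq]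
  noncomm_ring

-- The ε-part of J e_o is automatically in J² e_o. Once the complementary part is too, J e_o = J²
-- e_o, which vanishes by Nakayama's lemma.
include hqε hNE ho in
lemma J_mul_e_eq_zero (h : ∀ z ∈ P.J, ∃ y ∈ P.J * P.J, (1 - ε) * z * P.e o = y * P.e o) :
    ∀ z ∈ P.J, z * P.e o = 0 := by
  apply P.mul_eq_zero_of_le
  intro z hz
  obtain ⟨y, hy, hzy⟩ := h z hz
  obtain ⟨y', hy', hzy'⟩ := linear_part_mem hqε hNE ho hz
  refine ⟨y' + y, add_mem hy' hy, ?_⟩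
  rw [add_mul, ← hzy, ← hzy']
  noncomm_ring

variable [FiniteDimensional k A] [CharZero k] (hNS : ∃ z ∈ P.J, z * P.e o ≠ 0)

include hqε hε in
lemma finrank_nonlinear (o : Fin P.n) :
    Module.finrank k (LinearMap.range (sandwich (k := k) (1 - ε) (P.e o))) =
      ∑ i, if P.d i = 1 then 0 else P.d i * P.c i o := by
  have h := LinearMap.trace_eq_finrank_range (sandwich_idem (k := k) hε.one_sub (P.e_idem o))
  rw [P.trace_sandwich] at h
  simp only [tr_one_sub hqε, tr_e, mul_ite, mul_one, mul_zero, Finset.sum_ite_eq', Finset.mem_univ,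
    if_true] at h
  have h2 : ((Module.finrank k (LinearMap.range (sandwich (k := k) (1 - ε) (P.e o))) : ℕ) : k) =
      ((∑ i, if P.d i = 1 then 0 else P.d i * P.c i o : ℕ) : k) := by
    rw [← h]
    push_cast
    refine Finset.sum_congr rfl fun i _ => ?_
    split_ifs <;> simp [mul_comm]
  exact_mod_cast h2

include hqε hε in
lemma finrank_linear (o : Fin P.n) :
    Module.finrank k (LinearMap.range (sandwich (k := k) ε (P.e o))) =
      ∑ i, if P.d i = 1 then P.c i o else 0 := by
  have h := LinearMap.trace_eq_finrank_range (sandwich_idem (k := k) hε (P.e_idem o))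
  rw [P.trace_sandwich] at h
  simp only [tr_linear_idempotent hqε, tr_e, mul_ite, mul_one, mul_zero, Finset.sum_ite_eq',
    Finset.mem_univ, if_true] at h
  exact_mod_cast h.symm

include hqε hε hNE ho hNS in
/-- The projective cover of a linear character has a nonlinear composition factor. -/
theorem exists_nonlinear : ∃ i, P.d i ≠ 1 ∧ 1 ≤ P.c i o := by
  by_contra hcon
  push Not at hcon
  have h0 : Module.finrank k (LinearMap.range (sandwich (k := k) (1 - ε) (P.e o))) = 0 := by
    rw [finrank_nonlinear hqε hε]
    refine Finset.sum_eq_zero fun i _ => ?_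
    split_ifs with h
    · rfl
    · have := hcon i h; simp only [mul_eq_zero]; right; omega
  rw [Submodule.finrank_eq_zero] at h0
  obtain ⟨z, hz, hze⟩ := hNS
  refine hze (J_mul_e_eq_zero hqε hNE ho (fun z _ => ⟨0, zero_mem _, ?_⟩) z hz)
  have : sandwich (k := k) (1 - ε) (P.e o) z ∈ (⊥ : Submodule k A) := h0 ▸ ⟨z, rfl⟩
  rw [Submodule.mem_bot, sandwich_apply, ← mul_assoc] at this
  rw [this, zero_mul]

/-- The left ideal `J² e`. -/
def sqIdeal (P : SplitPresentation k A) (o : Fin P.n) : Submodule A A where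
  carrier := {x | ∃ y ∈ P.J * P.J, x = y * P.e o}
  add_mem' := by
    rintro _ _ ⟨a, ha, rfl⟩ ⟨b, hb, rfl⟩
    exact ⟨a + b, add_mem ha hb, by rw [add_mul]⟩
  zero_mem' := ⟨0, zero_mem _, by rw [zero_mul]⟩
  smul_mem' := by
    rintro c _ ⟨a, ha, rfl⟩
    exact ⟨c * a, P.mul_mem_JJ_left c ha, by rw [smul_eq_mul, mul_assoc]⟩

omit [FiniteDimensional k A] [CharZero k] in
lemma mul_e_of_mem_sqIdeal {x : A} (hx : x ∈ sqIdeal P o) : x * P.e o = x := by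
  obtain ⟨y, -, rfl⟩ := hx
  rw [mul_assoc, (P.e_idem o).eq]

omit [CharZero k] in
lemma finrank_range_lsmul_le (U : Submodule A A) (hU : ∀ x ∈ U, x * P.e o = x) (a : A) :
    Module.finrank k (LinearMap.range (Algebra.lsmul k k U a)) ≤
      Module.finrank k (LinearMap.range (sandwich (k := k) a (P.e o))) := by
  let f : LinearMap.range (Algebra.lsmul k k U a) →ₗ[k]
      LinearMap.range (sandwich (k := k) a (P.e o)) :=
    LinearMap.codRestrict _ ((U.subtype.restrictScalars k) ∘ₗ Submodule.subtype _) (by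
      rintro ⟨_, ⟨x, rfl⟩⟩
      exact ⟨x, by simp [hU x.1 x.2]⟩)
  refine LinearMap.finrank_le_finrank_of_injective (f := f) ?_
  intro x y hxy
  have := congrArg Subtype.val hxy
  exact Subtype.ext (Subtype.ext this)

-- The unique nonlinear factor T sits in J e_o / J² e_o. If it occurred in J² e_o, dimensions would
-- put all of (1 - ε) A e_o inside J² e_o, and then J e_o = J² e_o = 0.
include hqε hε hNE ho hNS in
lemma one_sub_mul_sq_eq_zero {T : Fin P.n} (hT : P.d T ≠ 1) (hcT : P.c T o = 1)
    (hrest : ∀ i, P.d i ≠ 1 → i ≠ T → P.c i o = 0) {y : A} (hy : y ∈ P.J * P.J) :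
    (1 - ε) * y * P.e o = 0 := by
  by_contra hne
  set U := sqIdeal P o
  have hU : ∀ x ∈ U, x * P.e o = x := fun x hx => mul_e_of_mem_sqIdeal hx
  let ρ : A →ₐ[k] Module.End k U := Algebra.lsmul k k U
  have hidem : ∀ a : A, IsIdempotentElem a → IsIdempotentElem (ρ a) := fun a ha => ha.map ρ
  have hsum := (P.isTraceForm_trace ρ).eq_sum P (1 - ε)
  simp only [LinearMap.comp_apply, AlgHom.toLinearMap_apply] at hsum
  rw [LinearMap.trace_eq_finrank_range (hidem _ hε.one_sub)] at hsum
  simp only [fun i => LinearMap.trace_eq_finrank_range (hidem _ (P.e_idem i)),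
    tr_one_sub hqε] at hsum
  have hnat : Module.finrank k (LinearMap.range (ρ (1 - ε))) =
      ∑ i, if P.d i = 1 then 0 else Module.finrank k (LinearMap.range (ρ (P.e i))) * P.d i := by
    have : ((Module.finrank k (LinearMap.range (ρ (1 - ε))) : ℕ) : k) =
      ((∑ i, if P.d i = 1 then 0 else
        Module.finrank k (LinearMap.range (ρ (P.e i))) * P.d i : ℕ) : k) := by
      rw [hsum]; push_cast
      refine Finset.sum_congr rfl fun i _ => ?_
      split_ifs <;> simp
    exact_mod_cast this
  have hle : ∀ i, Module.finrank k (LinearMap.range (ρ (P.e i))) ≤ P.c i o :=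
    fun i => finrank_range_lsmul_le U hU (P.e i)
  rw [Finset.sum_eq_single T (fun i _ hi => by
      split_ifs with h
      · rfl
      · have := hle i; rw [hrest i h hi] at this; simp [Nat.le_zero.mp this]) (by simp),
    if_neg hT] at hnat
  have hpos : 0 < Module.finrank k (LinearMap.range (ρ (1 - ε))) := by
    rw [Module.finrank_pos_iff]
    refine ⟨⟨⟨ρ (1 - ε) ⟨y * P.e o, y, hy, rfl⟩, _, rfl⟩, 0, fun h => hne ?_⟩⟩
    have := congrArg (fun z => (z.1.1 : A)) h
    rw [mul_assoc]
    exact this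
  have hbig : P.d T ≤ Module.finrank k (LinearMap.range (ρ (1 - ε))) := by
    rw [hnat] at hpos ⊢
    exact Nat.le_mul_of_pos_left _ (Nat.pos_of_mul_pos_right hpos)
  have hfull : Module.finrank k (LinearMap.range (sandwich (k := k) (1 - ε) (P.e o))) = P.d T := by
    rw [finrank_nonlinear hqε hε, Finset.sum_eq_single T (fun i _ hi => by
      split_ifs with h
      · rfl
      · simp [hrest i h hi]) (by simp), if_neg hT, hcT, mul_one]
  let f : LinearMap.range (ρ (1 - ε)) →ₗ[k] A :=
    (U.subtype.restrictScalars k) ∘ₗ Submodule.subtype _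
  have hfi : Function.Injective f := fun x y h => Subtype.ext (Subtype.ext h)
  have hfr : LinearMap.range f ≤ LinearMap.range (sandwich (k := k) (1 - ε) (P.e o)) := by
    rintro _ ⟨⟨_, ⟨x, rfl⟩⟩, rfl⟩
    exact ⟨x, by simp [f, ρ, hU x.1 x.2, sub_mul]⟩
  have heq : LinearMap.range f = LinearMap.range (sandwich (k := k) (1 - ε) (P.e o)) := by
    apply Submodule.eq_of_le_of_finrank_le hfr
    rw [hfull, LinearMap.finrank_range_of_inj hfi]
    exact hbig
  obtain ⟨z, hz, hze⟩ := hNS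
  refine hze (J_mul_e_eq_zero hqε hNE ho (fun z _ => ?_) z hz)
  have : sandwich (k := k) (1 - ε) (P.e o) z ∈ LinearMap.range f := by rw [heq]; exact ⟨z, rfl⟩
  obtain ⟨x, hx⟩ := this
  obtain ⟨y', hy', hxy⟩ : (x.1.1 : A) ∈ U := x.1.2
  refine ⟨y', hy', ?_⟩
  rw [← hxy, mul_assoc]
  exact hx.symm

variable {φ : A →ₗ[k] k} (hφ : ∀ a, (∀ b, φ (a * b) = 0) → a = 0)

-- On a vector x of the socle of A e_o, φ(x b) depends only on tr_o(b): the difference e_o b -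
-- tr_o(b) e_o lies in J, and the Nakayama automorphism moves it to the left of x, where it acts as
-- 0. Hence φ is injective on this socle, which is at most a line.
include ho hφ in
lemma eq_zero_of_mem_socle {x : A} (hxe : x * P.e o = x) (hJ : ∀ j ∈ P.J, j * x = 0)
    (hx : φ x = 0) : x = 0 := by
  obtain ⟨θ, hθ⟩ := exists_nakayama hφ
  refine hφ x fun b => ?_
  have hj := e_mul_sub_mem_J ho b
  have h1 : x * b = P.tr o b • x + x * (P.e o * b - P.tr o b • P.e o) := by
    rw [mul_sub, ← mul_assoc, hxe, mul_smul_comm, hxe]; abel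
  rw [h1, map_add, map_smul, hx, smul_zero, zero_add]
  rw [← θ.apply_symm_apply (P.e o * b - P.tr o b • P.e o), ← hθ,
    hJ _ (P.map_mem_J θ.symm hj), map_zero]

include hqε hε hNE ho hNS hφ in
/-- If the projective cover of a linear character has a single nonlinear composition factor, then
it has at most two linear ones. -/
theorem sum_linear_le_two {T : Fin P.n} (hT : P.d T ≠ 1) (hcT : P.c T o = 1)
    (hrest : ∀ i, P.d i ≠ 1 → i ≠ T → P.c i o = 0) :
    (∑ i, if P.d i = 1 then P.c i o else 0) ≤ 2 := by
  have hS1 : ∀ y ∈ P.J * P.J, (1 - ε) * y * P.e o = 0 := fun y hy =>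
    one_sub_mul_sq_eq_zero hqε hε hNE ho hNS hT hcT hrest hy
  -- As J² e_o is fixed by ε, an element j y e_o equals ε j ε y e_o, with ε j ε in J². So J³ e_o is
  -- contained in J⁴ e_o and vanishes.
  have hS2 : ∀ x ∈ P.J * (P.J * P.J), x * P.e o = 0 := by
    apply P.mul_eq_zero_of_le
    · intro x hx
      refine Submodule.mul_induction_on hx (fun j hj y hy => ?_) (fun b c hb hc => ?_)
      · refine ⟨ε * j * ε * y, ?_, ?_⟩
        · rw [← mul_assoc P.J P.J]
          exact Submodule.mul_mem_mul (hNE j hj) hy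
        · have h1 : y * P.e o = ε * y * P.e o := by
            have := hS1 y hy
            rw [sub_mul, sub_mul, one_mul, sub_eq_zero] at this
            exact this
          have h2 : j * ε * y * P.e o = ε * (j * ε * y) * P.e o := by
            have := hS1 (j * ε * y) (P.mul_mem_JJ_left _ hy)
            rw [sub_mul, sub_mul, one_mul, sub_eq_zero] at this
            exact this
          calc j * y * P.e o = j * (y * P.e o) := mul_assoc _ _ _
            _ = j * ε * y * P.e o := by rw [h1]; simp only [mul_assoc]
            _ = _ := by rw [h2]; simp only [mul_assoc]
      · obtain ⟨b', hb', hbe⟩ := hb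
        obtain ⟨c', hc', hce⟩ := hc
        exact ⟨b' + c', add_mem hb' hc', by rw [add_mul, hbe, hce, add_mul]⟩
  let K : Submodule k A := (sqIdeal P o).restrictScalars k
  -- J² e_o is killed by J, so it lies in the socle.
  have hK : Module.finrank k K ≤ 1 := by
    have hinj : Function.Injective (φ ∘ₗ K.subtype) := by
      rw [← LinearMap.ker_eq_bot, LinearMap.ker_eq_bot']
      rintro ⟨x, hx⟩ h0
      apply Subtype.ext
      refine eq_zero_of_mem_socle ho hφ (mul_e_of_mem_sqIdeal hx) (fun j hj => ?_) h0
      obtain ⟨y, hy, rfl⟩ := hx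
      rw [← mul_assoc]
      exact hS2 _ (Submodule.mul_mem_mul hj hy)
    have := LinearMap.finrank_le_finrank_of_injective hinj
    simpa using this
  rw [← finrank_linear hqε hε]
  -- The linear part of the projective cover is the line of ε e_o plus J² e_o.
  have hle : LinearMap.range (sandwich (k := k) ε (P.e o)) ≤
      Submodule.span k {ε * P.e o} ⊔ K := by
    rintro _ ⟨z, rfl⟩
    have hj := mul_e_sub_mem_J ho z
    have h1 : sandwich (k := k) ε (P.e o) z = P.tr o z • (ε * P.e o) +
        ε * (z * P.e o - P.tr o z • P.e o) * P.e o := by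
      rw [sandwich_apply, mul_assoc ε, sub_mul, mul_assoc z, smul_mul_assoc, (P.e_idem o).eq,
        mul_sub, mul_smul_comm]
      abel
    rw [h1]
    refine add_mem (Submodule.mem_sup_left (Submodule.smul_mem _ _
      (Submodule.mem_span_singleton_self _))) (Submodule.mem_sup_right ?_)
    obtain ⟨y, hy, hyz⟩ := linear_part_mem hqε hNE ho hj
    exact ⟨y, hy, hyz⟩
  calc _ ≤ Module.finrank k ↥(Submodule.span k {ε * P.e o} ⊔ K) := Submodule.finrank_mono hle
    _ ≤ Module.finrank k (Submodule.span k {ε * P.e o}) + Module.finrank k K :=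
      Submodule.finrank_add_le_finrank_add_finrank _ _
    _ ≤ 1 + 1 := add_le_add ((finrank_span_le_card _).trans (by simp)) hK

end

end SplitPresentation

/-! ### Cartan systems: the counting argument -/

/-- The numerical data attached to a Hopf algebra with group of group-like elements `G`: degrees
and Cartan invariants of the irreducible comodules, with the constraints they satisfy. -/
structure CartanSystem (G ι : Type*) [Group G] [Fintype G] [Fintype ι] [MulAction G ι] where
  d : ι → ℕ
  c : ι → ι → ℕ
  o : ι
  ν : Equiv.Perm ι
  d_pos : ∀ i, 0 < d i
  d_smul : ∀ (g : G) i, d (g • i) = d i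
  c_smul : ∀ (g : G) i j, c (g • i) (g • j) = c i j
  d_o : d o = 1
  exists_smul : ∀ i, d i = 1 → ∃ g : G, g • o = i
  d_ν : ∀ i, d (ν i) = d i
  c_ν : ∀ i j, c i j = c j (ν i)
  one_le : ∀ i, 1 ≤ c i i
  two_le : ∀ i j, ν i = i → j ≠ i → 1 ≤ c j i → 2 ≤ c i i
  nonlinear : ∃ i, d i ≠ 1 ∧ 1 ≤ c i o
  le_two : ∀ T, d T ≠ 1 → c T o = 1 → (∀ i, d i ≠ 1 → i ≠ T → c i o = 0) →
    (∑ i, if d i = 1 then c i o else 0) ≤ 2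
  dvd : ∀ (g : G) i, g ≠ 1 → g • i = i → Fintype.card G ∣ d i
  -- Here m i is the multiplicity of the trivial character in i ⊗ S*. Its sum over the orbit of S
  -- counts the linear characters in S ⊗ S*, and the last equation says that r is an eigenvector of
  -- tensoring with S*.
  tensor : ∀ S, d S = 2 → (∀ g : G, g • S = S → g = 1) → (∀ i, d i ≠ 3) →
    ∃ m : ι → ℕ, (∀ i, d i = 1 → m i = 0) ∧ ∑ g : G, m (g • S) = 2 ∧
      2 * ∑ j, c o j * d j = ∑ i, (∑ j, c i j * d j) * m i

namespace CartanSystem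

variable {G ι : Type*} [Group G] [Fintype G] [Fintype ι] [MulAction G ι] (X : CartanSystem G ι)

/-- Multiplicities in the regular representation. -/
def r (i : ι) : ℕ := ∑ j, X.c i j * X.d j

/-- The number of linear composition factors of the projective cover of the trivial one. -/
def α : ℕ := ∑ i, if X.d i = 1 then X.c i X.o else 0

/-- The number of composition factors in the orbit of `S`. -/
def κ (S : ι) : ℕ := ∑ g : G, X.c (g • S) X.o

lemma r_smul (g : G) (i : ι) : X.r (g • i) = X.r i := by
  unfold r
  rw [← Equiv.sum_comp (MulAction.toPerm g)]
  exact Finset.sum_congr rfl fun j _ => by rw [MulAction.toPerm_apply, X.c_smul, X.d_smul]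

lemma r_o : X.r X.o = ∑ j, X.c j X.o * X.d j := by
  unfold r
  rw [← Equiv.sum_comp X.ν]
  exact Finset.sum_congr rfl fun j _ => by rw [X.d_ν, ← X.c_ν]

section Orbits

variable [DecidableEq ι]

/-- The orbit of `i` as a finset. -/
def orb (G : Type*) [Group G] [Fintype G] [MulAction G ι] (i : ι) : Finset ι :=
  Finset.univ.image fun g : G => g • i

omit [Fintype ι] in
lemma sum_orb {S : ι} (hS : ∀ g : G, g • S = S → g = 1) (f : ι → ℕ) :
    ∑ i ∈ orb G S, f i = ∑ g : G, f (g • S) := by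
  rw [orb, Finset.sum_image]
  intro a _ b _ hab
  have := hS (b⁻¹ * a) (by rw [mul_smul]; exact inv_smul_eq_iff.mpr hab)
  exact (inv_mul_eq_one.mp this).symm

omit [Fintype ι] in
lemma mem_orb {S i : ι} : i ∈ orb G S ↔ ∃ g : G, g • S = i := by simp [orb]

omit [Fintype ι] in
lemma self_mem_orb (S : ι) : S ∈ orb G S := mem_orb.mpr ⟨1, one_smul _ _⟩

lemma d_of_mem_orb {S i : ι} (h : i ∈ orb G S) : X.d i = X.d S := by
  obtain ⟨g, rfl⟩ := mem_orb.mp h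
  exact X.d_smul g S

omit [Fintype ι] in
lemma disjoint_orb {S T : ι} (h : T ∉ orb G S) : Disjoint (orb G S) (orb G T) := by
  rw [Finset.disjoint_left]
  intro i hi hi'
  obtain ⟨g, rfl⟩ := mem_orb.mp hi
  obtain ⟨g', h'⟩ := mem_orb.mp hi'
  exact h (mem_orb.mpr ⟨g'⁻¹ * g, by rw [mul_smul, inv_smul_eq_iff, h']⟩)

variable (hp : (Fintype.card G).Prime)

omit [Fintype ι] [DecidableEq ι] in
include hp in
lemma free_or_fixed (i : ι) : (∀ g : G, g • i = i → g = 1) ∨ ∀ g : G, g • i = i := by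
  have : Fact (Nat.card G).Prime := ⟨by rwa [Nat.card_eq_fintype_card]⟩
  rcases Subgroup.eq_bot_or_eq_top_of_prime_card (MulAction.stabilizer G i) with h | h
  · left
    intro g hg
    have : g ∈ MulAction.stabilizer G i := hg
    rwa [h, Subgroup.mem_bot] at this
  · right
    intro g
    have : g ∈ MulAction.stabilizer G i := h ▸ Subgroup.mem_top g
    exact this

omit [DecidableEq ι] in
include hp in
lemma dvd_of_fixed {i : ι} (h : ∀ g : G, g • i = i) : Fintype.card G ∣ X.d i := by
  have : 1 < Fintype.card G := hp.one_lt
  obtain ⟨g, hg⟩ := Fintype.exists_ne_of_one_lt_card this (1 : G)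
  exact X.dvd g i hg (h g)

omit [DecidableEq ι] in
include hp in
lemma free_o : ∀ g : G, g • X.o = X.o → g = 1 := by
  intro g hg
  by_contra hne
  have := X.dvd g _ hne hg
  rw [X.d_o] at this
  exact hp.one_lt.ne' (Nat.dvd_one.mp this)

lemma mem_orb_o {i : ι} : i ∈ orb G X.o ↔ X.d i = 1 := by
  constructor
  · intro h; rw [X.d_of_mem_orb h, X.d_o]
  · intro h; exact mem_orb.mpr (X.exists_smul i h)

lemma sum_linear (f : ι → ℕ) : (∑ i, if X.d i = 1 then f i else 0) = ∑ i ∈ orb G X.o, f i := by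
  rw [← Finset.sum_filter]
  refine Finset.sum_congr ?_ fun _ _ => rfl
  ext i
  rw [X.mem_orb_o]; simp

/-- Splitting off the linear part of a sum. -/
lemma sum_eq_linear_add (f : ι → ℕ) :
    ∑ i, f i = (∑ i ∈ orb G X.o, f i) + ∑ i ∈ (orb G X.o)ᶜ, f i :=
  (Finset.sum_add_sum_compl _ _).symm

-- Equivariance turns c(S, g o) into c(g⁻¹ S, o), so the linear contribution to r S is the
-- multiplicity of the whole orbit of S in the projective cover of o.
include hp in
lemma sum_orb_c (S : ι) : ∑ j ∈ orb G X.o, X.c S j * X.d j = X.κ S := by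
  rw [sum_orb (X.free_o hp), κ, ← Equiv.sum_comp (Equiv.inv G)]
  refine Finset.sum_congr rfl fun g _ => ?_
  rw [X.d_smul, X.d_o, mul_one, Equiv.inv_apply, ← X.c_smul g, smul_inv_smul]

lemma r_o_eq : X.r X.o = X.α + ∑ j ∈ (orb G X.o)ᶜ, X.c j X.o * X.d j := by
  rw [r_o, X.sum_eq_linear_add, α, sum_linear]
  congr 1
  exact Finset.sum_congr rfl fun i hi => by rw [X.mem_orb_o.mp hi, mul_one]

include hp in
lemma r_eq (S : ι) : X.r S = X.κ S + ∑ j ∈ (orb G X.o)ᶜ, X.c S j * X.d j := by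
  rw [r, X.sum_eq_linear_add, X.sum_orb_c hp]

lemma sum_orb_weight {S : ι} (hS : ∀ g : G, g • S = S → g = 1) :
    ∑ i ∈ orb G S, X.d i * X.r i = Fintype.card G * (X.d S * X.r S) := by
  rw [sum_orb hS]
  simp [X.d_smul, X.r_smul]

omit [Fintype ι] in
lemma sum_orb_fixed {S : ι} (hS : ∀ g : G, g • S = S) (f : ι → ℕ) :
    ∑ i ∈ orb G S, f i = f S := by
  have : orb G S = {S} := by
    ext i; rw [mem_orb, Finset.mem_singleton]
    constructor
    · rintro ⟨g, rfl⟩; exact hS g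
    · rintro rfl; exact ⟨1, hS 1⟩
  rw [this, Finset.sum_singleton]

/-- If ν fixes o, the socle repeats the top and c_oo ≥ 2. Otherwise ν o = g o with g o ≠ o, and g⁻¹
o is a second linear factor, since c(g⁻¹ o, o) = c(o, ν o) = c_oo. -/
lemma two_le_α : 2 ≤ X.α := by
  rw [α, X.sum_linear]
  by_cases hν : X.ν X.o = X.o
  · obtain ⟨i, hi, hc⟩ := X.nonlinear
    have := X.two_le X.o i hν (by rintro rfl; exact hi X.d_o) hc
    exact this.trans (Finset.single_le_sum (f := fun i => X.c i X.o) (fun _ _ => Nat.zero_le _)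
      (self_mem_orb (G := G) X.o))
  · obtain ⟨g, hg⟩ := X.exists_smul (X.ν X.o) (by rw [X.d_ν, X.d_o])
    have h1 : X.c (g⁻¹ • X.o) X.o = X.c X.o X.o := by
      rw [X.c_ν X.o X.o, ← hg, ← X.c_smul g, smul_inv_smul]
    have hne : g⁻¹ • X.o ≠ X.o := by
      intro h; apply hν; rw [← hg, ← inv_smul_eq_iff.mp h]
    have hsub : ({g⁻¹ • X.o, X.o} : Finset ι) ⊆ orb G X.o := by
      intro i hi
      rw [Finset.mem_insert, Finset.mem_singleton] at hi
      rcases hi with rfl | rfl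
      · exact mem_orb.mpr ⟨_, rfl⟩
      · exact self_mem_orb _
    have h2 := Finset.sum_le_sum_of_subset (f := fun i => X.c i X.o) hsub
    rw [Finset.sum_pair hne, h1] at h2
    have := X.one_le X.o
    omega

-- Besides the linear part κ, the sum r S contains d S twice: either ν S = S and c_SS ≥ 2, or S and
-- ν S are distinct of the same degree and c(S, ν S) = c_SS ≥ 1.
include hp in
lemma r_ge {S : ι} (hS : X.d S ≠ 1) (hc : 1 ≤ X.c S X.o) : X.κ S + 2 * X.d S ≤ X.r S := by
  rw [X.r_eq hp]
  refine Nat.add_le_add_left ?_ _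
  have hmem : S ∈ (orb G X.o)ᶜ := by rw [Finset.mem_compl, X.mem_orb_o]; exact hS
  by_cases hν : X.ν S = S
  · have h1 : 1 ≤ X.c X.o S := by rw [X.c_ν, hν] at hc; exact hc
    have h2 := X.two_le S X.o hν (by rintro rfl; exact hS X.d_o) h1
    exact (Nat.mul_le_mul_right _ h2).trans (Finset.single_le_sum
      (f := fun j => X.c S j * X.d j) (fun _ _ => Nat.zero_le _) hmem)
  · have hmem' : X.ν S ∈ (orb G X.o)ᶜ := by
      rw [Finset.mem_compl, X.mem_orb_o, X.d_ν]; exact hS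
    have hsub : ({X.ν S, S} : Finset ι) ⊆ (orb G X.o)ᶜ := by
      intro i hi
      rw [Finset.mem_insert, Finset.mem_singleton] at hi
      rcases hi with rfl | rfl <;> assumption
    have h2 := Finset.sum_le_sum_of_subset (f := fun j => X.c S j * X.d j) hsub
    rw [Finset.sum_pair hν, X.d_ν, ← X.c_ν] at h2
    have := X.one_le S
    nlinarith [Nat.mul_le_mul_right (X.d S) this]

omit [DecidableEq ι] in
lemma c_le_κ (S : ι) : X.c S X.o ≤ X.κ S := by
  have := Finset.single_le_sum (f := fun g : G => X.c (g • S) X.o) (fun _ _ => Nat.zero_le _)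
    (Finset.mem_univ 1)
  simpa [κ] using this

omit [DecidableEq ι] in
lemma d_le_r (i : ι) : X.d i ≤ X.r i :=
  (Nat.le_mul_of_pos_left _ (X.one_le i)).trans (Finset.single_le_sum
    (f := fun j => X.c i j * X.d j) (fun _ _ => Nat.zero_le _) (Finset.mem_univ i))

lemma c_mul_d_le {S : ι} (hS : X.d S ≠ 1) : X.α + X.c S X.o * X.d S ≤ X.r X.o := by
  rw [r_o_eq]
  refine Nat.add_le_add_left (Finset.single_le_sum
    (f := fun j => X.c j X.o * X.d j) (fun _ _ => Nat.zero_le _) ?_) _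
  rw [Finset.mem_compl, X.mem_orb_o]; exact hS

variable {N : ℕ} (hN : ∑ i, X.d i * X.r i = N * Fintype.card G)

include hp hN in
lemma weight_le {S : ι} (hS : X.d S ≠ 1) :
    Fintype.card G * X.r X.o + ∑ i ∈ orb G S, X.d i * X.r i ≤ N * Fintype.card G := by
  have hd : Disjoint (orb G X.o) (orb G S) := disjoint_orb (by rwa [X.mem_orb_o])
  have h1 := X.sum_orb_weight (X.free_o hp)
  rw [X.d_o, one_mul] at h1
  rw [← hN, ← h1, ← Finset.sum_union hd]
  exact Finset.sum_le_sum_of_subset (Finset.subset_univ _)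

include hp hN in
lemma weight_le₂ {S T : ι} (hS : X.d S ≠ 1) (hT : X.d T ≠ 1) (hST : T ∉ orb G S) :
    Fintype.card G * X.r X.o + ∑ i ∈ orb G S, X.d i * X.r i + ∑ i ∈ orb G T, X.d i * X.r i
      ≤ N * Fintype.card G := by
  have hd : Disjoint (orb G X.o) (orb G S) := disjoint_orb (by rwa [X.mem_orb_o])
  have hd' : Disjoint (orb G X.o) (orb G T) := disjoint_orb (by rwa [X.mem_orb_o])
  have h1 := X.sum_orb_weight (X.free_o hp)
  rw [X.d_o, one_mul] at h1
  rw [← hN, ← h1, ← Finset.sum_union hd, ← Finset.sum_union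
    (Finset.disjoint_union_left.mpr ⟨hd', disjoint_orb hST⟩)]
  exact Finset.sum_le_sum_of_subset (Finset.subset_univ _)

include hN in
lemma weight_eq {S : ι} (hp : (Fintype.card G).Prime) (hS : X.d S ≠ 1)
    (hall : ∀ i, X.d i ≠ 1 → i ∈ orb G S) :
    Fintype.card G * X.r X.o + ∑ i ∈ orb G S, X.d i * X.r i = N * Fintype.card G := by
  have hd : Disjoint (orb G X.o) (orb G S) := disjoint_orb (by rwa [X.mem_orb_o])
  have h1 := X.sum_orb_weight (X.free_o hp)
  rw [X.d_o, one_mul] at h1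
  rw [← hN, ← h1, ← Finset.sum_union hd]
  refine Finset.sum_congr ?_ fun _ _ => rfl
  ext i
  simp only [Finset.mem_union, Finset.mem_univ, iff_true]
  by_cases h : X.d i = 1
  · exact Or.inl (X.mem_orb_o.mpr h)
  · exact Or.inr (hall i h)

lemma compl_eq_orb {S : ι} (hS : X.d S ≠ 1) (hall : ∀ i, X.d i ≠ 1 → i ∈ orb G S) :
    (orb G X.o)ᶜ = orb G S := by
  ext i
  rw [Finset.mem_compl, X.mem_orb_o]
  exact ⟨hall i, fun h => by rwa [X.d_of_mem_orb h]⟩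

include hp in
/-- Weight of the orbit of an arbitrary nonlinear index. -/
lemma orbit_weight_ge {T : ι} (hT : X.d T ≠ 1) :
    4 * Fintype.card G ≤ ∑ i ∈ orb G T, X.d i * X.r i ∨
      ((∀ g : G, g • T = T) ∧ Fintype.card G ∣ X.d T ∧
        Fintype.card G * Fintype.card G ≤ ∑ i ∈ orb G T, X.d i * X.r i) := by
  have h0 := X.d_pos T
  have h1 := X.d_le_r T
  rcases free_or_fixed hp T with h | h
  · left
    rw [X.sum_orb_weight h, mul_comm]
    refine Nat.mul_le_mul_left _ ?_
    have : 2 ≤ X.d T := by omega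
    nlinarith
  · right
    have hdv := X.dvd_of_fixed hp h
    refine ⟨h, hdv, ?_⟩
    rw [sum_orb_fixed h]
    have := Nat.le_of_dvd h0 hdv
    exact Nat.mul_le_mul this (this.trans h1)

-- The bounds r_o ≥ 5 and r_S ≥ 9 leave no room for another nonlinear irreducible, so N = r_o + r_S
-- = α + 6b + 3δ with b = c_So and δ = c_SS ≥ 2. This forces b = 1, hence α = 2 and N = 8 + 3δ; no
-- allowed N below 17 is congruent to 2 modulo 3.
include hp hN in
lemma not_fixed_of_card_eq_three (hc : N = 12 ∨ N = 15 ∨ N = 16) (h3 : Fintype.card G = 3) {S : ι}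
    (hm : X.d S = 3) (hSo : 1 ≤ X.c S X.o) : ¬ ∀ g : G, g • S = S := by
  intro hfix
  have hS : X.d S ≠ 1 := by omega
  have hα := X.two_le_α
  have hr := X.r_ge hp hS hSo
  have hro := X.c_mul_d_le hS
  have hκ : X.κ S = 3 * X.c S X.o := by simp [κ, hfix, h3]
  have hall : ∀ i, X.d i ≠ 1 → i ∈ orb G S := by
    intro T hT
    by_contra hTS
    have h2 := X.weight_le₂ hp hN hS hT hTS
    rw [sum_orb_fixed hfix, h3, hm] at h2
    rw [hm] at hr hro
    have h4 := X.orbit_weight_ge hp hT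
    rw [h3] at h4
    rcases h4 with h4 | ⟨-, -, h4⟩ <;> omega
  have h4 := X.weight_eq hN hp hS hall
  rw [sum_orb_fixed hfix, h3, hm] at h4
  have h5 := X.r_o_eq
  have h6 := X.r_eq hp S
  rw [X.compl_eq_orb hS hall, sum_orb_fixed hfix, hm] at h5 h6
  have hδ : 2 ≤ X.c S S := by omega
  have hb : X.c S X.o = 1 := by omega
  have h7 := X.le_two S hS hb (fun i hi hiS => absurd (by
    obtain ⟨g, hg⟩ := mem_orb.mp (hall i hi)
    rw [← hg, hfix]) hiS)
  change X.α ≤ 2 at h7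
  omega

-- A fixed S has degree p m, and the weights of o and S must fit into N p. This eliminates
-- everything except p = 3, m = 1, which is treated separately.
include hp hN in
lemma not_fixed (hc : 3 ≤ Fintype.card G ∧ (N = 12 ∨ N = 15 ∨ N = 16) ∨
    5 ≤ Fintype.card G ∧ (N = 20 ∨ N = 21)) {S : ι} (hS : X.d S ≠ 1) (hSo : 1 ≤ X.c S X.o) :
    ¬ ∀ g : G, g • S = S := by
  intro hfix
  obtain ⟨m, hm⟩ := X.dvd_of_fixed hp hfix
  have hα := X.two_le_α
  have hr := X.r_ge hp hS hSo
  have hro := X.c_mul_d_le hS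
  have hκ : X.κ S = Fintype.card G * X.c S X.o := by simp [κ, hfix]
  have hw := X.weight_le hp hN hS
  rw [sum_orb_fixed hfix] at hw
  have hm0 : 1 ≤ m := by
    rcases Nat.eq_zero_or_pos m with h | h
    · have := X.d_pos S; rw [hm, h] at this; simp at this
    · exact h
  have key : ∀ p b : ℕ, Fintype.card G = p → X.c S X.o = b → False := by
    intro p b hpe hbe
    rw [hpe] at hw hm hκ hc
    rw [hbe] at hκ hro hSo
    rw [hm] at hr hro hw
    have hpp : 3 ≤ p := by omega
    -- With b, m ≥ 1 this yields 2 + 4p ≤ N: impossible for p ≥ 5 and N ≤ 21, and leaving only p = 3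
    -- for N ≤ 16.
    have hw' : p * (2 + b * (p * m) + m * (p * b + 2 * (p * m))) ≤ p * N := by
      calc p * (2 + b * (p * m) + m * (p * b + 2 * (p * m)))
          = p * (2 + b * (p * m)) + p * m * (p * b + 2 * (p * m)) := by ring
        _ ≤ p * X.r X.o + p * m * X.r S := by gcongr <;> omega
        _ ≤ _ := by rw [mul_comm p N]; exact hw
    have hw'' := Nat.le_of_mul_le_mul_left hw' (by omega)
    have hbm : p * m ≤ b * (p * m) := Nat.le_mul_of_pos_left _ hSo
    have hbm' : p ≤ m * (p * b) := by
      calc p = 1 * (p * 1) := by ring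
        _ ≤ _ := by gcongr
    have hmm : p * m ≤ m * (p * m) := Nat.le_mul_of_pos_left _ hm0
    have hpm : p ≤ p * m := Nat.le_mul_of_pos_right _ hm0
    rw [mul_add, mul_left_comm m 2] at hw''
    have hp3 : p = 3 := by omega
    subst hp3
    have hm1 : m = 1 := by
      by_contra hne
      have : 2 * (3 * 2) ≤ m * (3 * m) := Nat.mul_le_mul (by omega) (by omega)
      omega
    subst hm1
    exact X.not_fixed_of_card_eq_three hp hN (by omega) hpe (by omega) (by omega) hfix
  exact key _ _ rfl rfl

-- The orbit of S being free, p cancels and r_o + d_S r_S ≤ N. Degree at least 3 would make the left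
-- side at least 5 + 3 · 7 = 26.
include hp hN in
lemma free_of_nonlinear (hc : 3 ≤ Fintype.card G ∧ (N = 12 ∨ N = 15 ∨ N = 16) ∨
    5 ≤ Fintype.card G ∧ (N = 20 ∨ N = 21)) {S : ι} (hS : X.d S ≠ 1) (hSo : 1 ≤ X.c S X.o) :
    (∀ g : G, g • S = S → g = 1) ∧ X.d S = 2 ∧ X.r X.o + 2 * X.r S ≤ N := by
  have hfree := (free_or_fixed hp S).resolve_right (X.not_fixed hp hN hc hS hSo)
  have hw := X.weight_le hp hN hS
  rw [X.sum_orb_weight hfree, ← mul_add, mul_comm N] at hw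
  have hw' := Nat.le_of_mul_le_mul_left hw hp.pos
  have hα := X.two_le_α
  have hr := X.r_ge hp hS hSo
  have hro := X.c_mul_d_le hS
  have hκ := X.c_le_κ S
  have hd0 := X.d_pos S
  have hd : X.d S = 2 := by
    by_contra hne
    have h3 : 3 ≤ X.d S := by omega
    have h1 : 3 ≤ X.c S X.o * X.d S := by nlinarith
    have h2 : 3 * 7 ≤ X.d S * X.r S := Nat.mul_le_mul h3 (by omega)
    omega
  refine ⟨hfree, hd, ?_⟩
  rwa [hd] at hw'

include hp hN in
theorem false_of_dim (hc : 3 ≤ Fintype.card G ∧ (N = 12 ∨ N = 15 ∨ N = 16) ∨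
    5 ≤ Fintype.card G ∧ (N = 20 ∨ N = 21)) : False := by
  obtain ⟨S, hS, hSo⟩ := X.nonlinear
  obtain ⟨hfree, hd, hw⟩ := X.free_of_nonlinear hp hN hc hS hSo
  have hα := X.two_le_α
  have hr := X.r_ge hp hS hSo
  have hro := X.c_mul_d_le hS
  have hκ := X.c_le_κ S
  rw [hd] at hr hro
  have hsw : ∑ i ∈ orb G S, X.d i * X.r i = Fintype.card G * (2 * X.r S) := by
    rw [X.sum_orb_weight hfree, hd]
  -- An orbit of degree 3 adds at least 9 to r_o + 2 r_S ≥ 14 if it is free. If it is fixed then p =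
  -- 3, and 3 · 14 + 9 exceeds 3N with N ≤ 16.
  have hno3 : ∀ i, X.d i ≠ 3 := by
    intro T hT
    have hTS : T ∉ orb G S := fun h => by
      have := X.d_of_mem_orb h; omega
    have h2 := X.weight_le₂ hp hN hS (by omega) hTS
    rw [hsw] at h2
    have hrT := X.d_le_r T
    rcases free_or_fixed hp T with h | h
    · rw [X.sum_orb_weight h, ← mul_add, ← mul_add, mul_comm N, hT] at h2
      have := Nat.le_of_mul_le_mul_left h2 hp.pos
      omega
    · have h3 := X.dvd_of_fixed hp h
      rw [hT] at h3
      have h4 : Fintype.card G = 3 := by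
        have := Nat.le_of_dvd (by norm_num) h3
        omega
      rw [sum_orb_fixed h, hT, h4] at h2
      omega
  obtain ⟨m, hm0, hm2, hmr⟩ := X.tensor S hd hfree hno3
  have horb : ∑ i ∈ orb G S, X.r i * m i = 2 * X.r S := by
    rw [sum_orb hfree]
    simp only [X.r_smul]
    rw [← Finset.mul_sum, hm2, mul_comm]
  have hmr' : 2 * X.r X.o = ∑ i, X.r i * m i := hmr
  -- In the eigenvector equation for r, the orbit of S alone contributes 2 r_S to 2 r_o.
  have hge : X.r S ≤ X.r X.o := by
    have := Finset.sum_le_sum_of_subset (f := fun i => X.r i * m i) (Finset.subset_univ (orb G S))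
    omega
  have hin : ∀ T, X.d T ≠ 1 → T ∉ orb G S → X.c T X.o = 0 := by
    intro T hT hTS
    by_contra hne
    have hTo : 1 ≤ X.c T X.o := Nat.one_le_iff_ne_zero.mpr hne
    obtain ⟨hTf, hTd, -⟩ := X.free_of_nonlinear hp hN hc hT hTo
    have hrT := X.r_ge hp hT hTo
    have hκT := X.c_le_κ T
    have h2 := X.weight_le₂ hp hN hS hT hTS
    rw [hsw, X.sum_orb_weight hTf, ← mul_add, ← mul_add, mul_comm N] at h2
    have := Nat.le_of_mul_le_mul_left h2 hp.pos
    rw [hTd] at hrT this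
    omega
  have hsub : orb G S ⊆ (orb G X.o)ᶜ := fun i hi => by
    rw [Finset.mem_compl, X.mem_orb_o, X.d_of_mem_orb hi, hd]; decide
  have hro' : X.r X.o = X.α + X.κ S * 2 := by
    rw [r_o_eq, κ, ← sum_orb hfree (fun i => X.c i X.o), Finset.sum_mul,
      ← Finset.sum_subset hsub]
    · congr 1
      exact Finset.sum_congr rfl fun i hi => by rw [X.d_of_mem_orb hi, hd]
    · intro i hi hi'
      rw [Finset.mem_compl, X.mem_orb_o] at hi
      rw [hin i hi hi', zero_mul]
  -- With κ = 1 the only nonlinear factor of the projective cover is S, once; then α ≤ 2 and r_o ≤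
  -- 4, while r_o ≥ r_S ≥ 5.
  have hκ2 : 2 ≤ X.κ S := by
    by_contra hlt
    have hκ1 : X.κ S = 1 := by omega
    have hc1 : X.c S X.o = 1 := by omega
    have h7 := X.le_two S hS hc1 (fun i hi hiS => by
      by_cases hio : i ∈ orb G S
      · have h8 : ∑ i ∈ orb G S, X.c i X.o = 1 := by
          rw [sum_orb hfree]; exact hκ1
        have hsub' : ({i, S} : Finset ι) ⊆ orb G S := by
          intro j hj
          rw [Finset.mem_insert, Finset.mem_singleton] at hj
          rcases hj with rfl | rfl
          · exact hio
          · exact self_mem_orb _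
        have h9 := Finset.sum_le_sum_of_subset (f := fun i => X.c i X.o) hsub'
        rw [Finset.sum_pair hiS] at h9
        omega
      · exact hin i hi hio)
    change X.α ≤ 2 at h7
    omega
  have hp5 : 5 ≤ Fintype.card G ∧ (N = 20 ∨ N = 21) := by
    rcases hc with ⟨_, h⟩ | h
    · omega
    · exact h
  -- Now r_o ≥ r_S ≥ 6, and any further orbit has weight at least 4p, giving 22 ≤ N.
  have hall : ∀ i, X.d i ≠ 1 → i ∈ orb G S := by
    intro T hT
    by_contra hTS
    have h2 := X.weight_le₂ hp hN hS hT hTS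
    rw [hsw] at h2
    have h4 : 4 * Fintype.card G ≤ ∑ i ∈ orb G T, X.d i * X.r i := by
      rcases X.orbit_weight_ge hp hT with h | ⟨-, -, h⟩
      · exact h
      · exact (Nat.mul_le_mul_right _ (by omega)).trans h
    have h5 : Fintype.card G * (X.r X.o + 2 * X.r S + 4) ≤ Fintype.card G * N := by linarith
    have := Nat.le_of_mul_le_mul_left h5 hp.pos
    omega
  have heq := X.weight_eq hN hp hS hall
  rw [hsw, ← mul_add, mul_comm N] at heq
  have heq' := Nat.eq_of_mul_eq_mul_left hp.pos heq
  have hrr : X.r X.o = X.r S := by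
    have h1 := X.sum_eq_linear_add (fun i => X.r i * m i)
    rw [X.compl_eq_orb hS hall, horb, Finset.sum_eq_zero (s := orb G X.o) (fun i hi => by
      rw [hm0 i (X.mem_orb_o.mp hi), mul_zero])] at h1
    omega
  have hrS := X.r_eq hp S
  rw [X.compl_eq_orb hS hall] at hrS
  have hev : ∑ j ∈ orb G S, X.c S j * X.d j = (∑ j ∈ orb G S, X.c S j) * 2 := by
    rw [Finset.sum_mul]
    exact Finset.sum_congr rfl fun i hi => by rw [X.d_of_mem_orb hi, hd]
  rw [hev] at hrS
  -- From N = 3 r_S only N = 21, r_S = r_o = 7 survives. Since r_S is κ plus an even number and 2 ≤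
  -- κ ≤ 3, κ = 3, so α = 7 - 6 = 1, contradicting α ≥ 2.
  omega

end Orbits

end CartanSystem

/-! ### The dual algebra of a coalgebra and multiplicative matrices -/

section

open scoped TensorProduct
open Coalgebra HopfAlgebra

/-- The dual algebra of a coalgebra, with the convolution product. -/
abbrev ConvDual (k H : Type*) [Field k] [AddCommGroup H] [Module k H] : Type _ :=
  WithConv (H →ₗ[k] k)

namespace ConvDual

section Pairing

variable {k H : Type*} [Field k] [AddCommGroup H] [Module k H]

instance [FiniteDimensional k H] : FiniteDimensional k (ConvDual k H) :=
  (WithConv.linearEquiv k (H →ₗ[k] k)).symm.finiteDimensional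

lemma finrank_eq [FiniteDimensional k H] :
    Module.finrank k (ConvDual k H) = Module.finrank k H := by
  rw [(WithConv.linearEquiv k (H →ₗ[k] k)).finrank_eq]
  exact Subspace.dual_finrank_eq

@[simp] protected lemma add_apply (a b : ConvDual k H) (h : H) : (a + b) h = a h + b h := rfl
@[simp] protected lemma sub_apply (a b : ConvDual k H) (h : H) : (a - b) h = a h - b h := rfl
@[simp] protected lemma smul_apply (c : k) (a : ConvDual k H) (h : H) : (c • a) h = c * a h := rfl
@[simp] protected lemma zero_apply (h : H) : (0 : ConvDual k H) h = 0 := rfl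

lemma ext_apply {a b : ConvDual k H} (h : ∀ x, a x = b x) : a = b :=
  WithConv.ext (LinearMap.ext h)

lemma eq_of_forall_apply_eq {h h' : H} (e : ∀ a : ConvDual k H, a h = a h') : h = h' := by
  rw [← sub_eq_zero]
  refine (Module.forall_dual_apply_eq_zero_iff k (h - h')).mp fun f => ?_
  rw [map_sub, sub_eq_zero]
  exact e (WithConv.toConv f)

/-- Evaluation at an element. -/
def eval (h : H) : ConvDual k H →ₗ[k] k where
  toFun a := a h
  map_add' _ _ := rfl
  map_smul' _ _ := rfl

@[simp] lemma eval_apply (h : H) (a : ConvDual k H) : eval h a = a h := rfl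

lemma exists_forall_apply_eq [FiniteDimensional k H] (f : ConvDual k H →ₗ[k] k) :
    ∃ h : H, ∀ a : ConvDual k H, a h = f a := by
  obtain ⟨h, hh⟩ := (Module.evalEquiv k H).surjective
    (f ∘ₗ (WithConv.linearEquiv k (H →ₗ[k] k)).symm.toLinearMap)
  refine ⟨h, fun a => ?_⟩
  exact LinearMap.congr_fun hh a.ofConv

lemma tensor_eq_of_forall {z z' : H ⊗[k] H}
    (e : ∀ a b : H →ₗ[k] k, LinearMap.mul' k k (TensorProduct.map a b z) =
      LinearMap.mul' k k (TensorProduct.map a b z')) : z = z' := by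
  let B := Module.Basis.ofVectorSpace k H
  apply (B.tensorProduct B).ext_elem
  rintro ⟨i, j⟩
  have key : ∀ w : H ⊗[k] H, (B.tensorProduct B).repr w (i, j) =
      LinearMap.mul' k k (TensorProduct.map (B.coord i) (B.coord j) w) := by
    intro w
    induction w with
    | zero => simp
    | tmul x y => simp [mul_comm]
    | add x y hx hy => simp [hx, hy]
  rw [key, key, e]

end Pairing

section Coalgebra

variable {k H : Type*} [Field k] [AddCommGroup H] [Module k H] [Coalgebra k H]

/-- Together with its converse below, this is the dictionary between formulas for Δ(h) and formulas
for convolution products evaluated at h. -/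
lemma mul_apply_of_comul {ι : Type*} [Fintype ι] {h : H} {u v : ι → H}
    (e : comul (R := k) h = ∑ i, u i ⊗ₜ[k] v i) (a b : ConvDual k H) :
    (a * b) h = ∑ i, a (u i) * b (v i) := by
  rw [LinearMap.convMul_apply, e]
  simp

lemma comul_eq_of_mul_apply {ι : Type*} [Fintype ι] {h : H} {u v : ι → H}
    (e : ∀ a b : ConvDual k H, (a * b) h = ∑ i, a (u i) * b (v i)) :
    comul (R := k) h = ∑ i, u i ⊗ₜ[k] v i := by
  apply tensor_eq_of_forall
  intro a b
  have := e (WithConv.toConv a) (WithConv.toConv b)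
  rw [LinearMap.convMul_apply] at this
  rw [this]
  simp

@[simp] protected lemma one_apply (h : H) : (1 : ConvDual k H) h = counit (R := k) h := rfl

end Coalgebra

end ConvDual

/-- A matrix over a coalgebra is multiplicative if its entries comultiply like matrix
coefficients. -/
structure IsMultiplicative (k : Type*) {ι H : Type*} [Field k] [Fintype ι] [DecidableEq ι]
    [AddCommGroup H] [Module k H] [Coalgebra k H] (x : Matrix ι ι H) : Prop where
  comul : ∀ s t, comul (R := k) (x s t) = ∑ r, x s r ⊗ₜ[k] x r t
  counit : ∀ s t, counit (R := k) (x s t) = (1 : Matrix ι ι k) s t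

namespace IsMultiplicative

open ConvDual

section Coalgebra

variable {k ι H : Type*} [Field k] [Fintype ι] [DecidableEq ι]
    [AddCommGroup H] [Module k H] [Coalgebra k H] {x : Matrix ι ι H}

/-- Every matrix representation of the dual algebra comes from a multiplicative matrix. -/
theorem exists_of_algHom [FiniteDimensional k H] (ρ : ConvDual k H →ₐ[k] Matrix ι ι k) :
    ∃ x : Matrix ι ι H, IsMultiplicative k x ∧ ∀ a s t, a (x s t) = ρ a s t := by
  have h : ∀ s t, ∃ h : H, ∀ a : ConvDual k H, a h = ρ a s t := fun s t =>
    exists_forall_apply_eq (Matrix.entryLinearMap k k s t ∘ₗ ρ.toLinearMap)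
  choose x hx using h
  refine ⟨x, ⟨fun s t => comul_eq_of_mul_apply fun a b => ?_, fun s t => ?_⟩, fun a s t => hx s t a⟩
  · rw [hx, map_mul, Matrix.mul_apply]
    simp only [hx]
  · rw [← ConvDual.one_apply, hx, map_one]

/-- The representation of the dual algebra defined by a multiplicative matrix. -/
def rep (hx : IsMultiplicative k x) : ConvDual k H →ₐ[k] Matrix ι ι k where
  toFun a := Matrix.of fun s t => a (x s t)
  map_one' := by ext s t; exact hx.counit s t
  map_mul' a b := by
    ext s t
    rw [Matrix.of_apply, mul_apply_of_comul (hx.comul s t), Matrix.mul_apply]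
    rfl
  map_zero' := rfl
  map_add' _ _ := rfl
  commutes' c := by
    ext s t
    rw [Matrix.of_apply, Matrix.algebraMap_matrix_apply, LinearMap.convAlgebraMap_apply]
    rw [hx.counit, Matrix.one_apply]
    split_ifs <;> simp

@[simp] lemma rep_apply (hx : IsMultiplicative k x) (a : ConvDual k H) (s t : ι) :
    hx.rep a s t = a (x s t) := rfl

/-- The comodule structure of a coalgebra in coordinates. -/
theorem exists_regular [FiniteDimensional k H] (b : Module.Basis ι k H) :
    ∃ x : Matrix ι ι H, IsMultiplicative k x ∧
      ∀ j, Coalgebra.comul (R := k) (b j) = ∑ i, b i ⊗ₜ[k] x i j := by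
  have h1 : ∀ z : H ⊗[k] H, z = ∑ i, b i ⊗ₜ[k]
      (TensorProduct.lid k H (LinearMap.rTensor H (b.coord i) z)) := by
    intro z
    induction z with
    | zero => simp
    | tmul y w =>
      conv_lhs => rw [← b.sum_repr y, TensorProduct.sum_tmul]
      simp [TensorProduct.smul_tmul]
    | add y w hy hw =>
      simp only [map_add, TensorProduct.tmul_add, Finset.sum_add_distrib]
      rw [← hy, ← hw]
  let x : Matrix ι ι H := fun i j =>
    TensorProduct.lid k H (LinearMap.rTensor H (b.coord i) (Coalgebra.comul (R := k) (b j)))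
  have hb : ∀ j, Coalgebra.comul (R := k) (b j) = ∑ i, b i ⊗ₜ[k] x i j := fun j => h1 _
  have hx : ∀ i j (a : ConvDual k H), a (x i j) = (WithConv.toConv (b.coord i) * a) (b j) := by
    intro i j a
    rw [mul_apply_of_comul (hb j)]
    simp [Finsupp.single_apply]
  refine ⟨x, ⟨fun s t => comul_eq_of_mul_apply fun a c => ?_, fun s t => ?_⟩, hb⟩
  · rw [hx, ← mul_assoc, mul_apply_of_comul (hb t)]
    simp only [← hx]
  · rw [← ConvDual.one_apply, hx, mul_one, Matrix.one_apply]
    simp [Finsupp.single_apply, eq_comm]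

end Coalgebra

section Bialgebra

variable {k ι κ H : Type*} [Field k] [Fintype ι] [DecidableEq ι] [Fintype κ] [DecidableEq κ]
    [Ring H] [Bialgebra k H] {x : Matrix ι ι H} {y : Matrix κ κ H}

/-- The tensor product of two multiplicative matrices. -/
theorem kronecker (hx : IsMultiplicative k x) (hy : IsMultiplicative k y) :
    IsMultiplicative k (Matrix.of fun (i j : ι × κ) => x i.1 j.1 * y i.2 j.2) where
  comul s t := by
    simp only [Matrix.of_apply, Bialgebra.comul_mul, hx.comul, hy.comul, Finset.sum_mul_sum,
      Algebra.TensorProduct.tmul_mul_tmul]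
    rw [Fintype.sum_prod_type]
  counit s t := by
    simp only [Matrix.of_apply, Bialgebra.counit_mul, hx.counit, hy.counit, Matrix.one_apply,
      Prod.ext_iff]
    split_ifs <;> simp_all

end Bialgebra

section Hopf

variable {k ι H : Type*} [Field k] [Fintype ι] [DecidableEq ι] [Ring H] [HopfAlgebra k H]
  {x : Matrix ι ι H}

lemma map_antipode_mul (hx : IsMultiplicative k x) : x.map (antipode k) * x = 1 := by
  ext s t
  have h := mul_antipode_rTensor_comul_apply (R := k) (x s t)
  rw [hx.comul, hx.counit] at h
  simp only [map_sum, LinearMap.rTensor_tmul, LinearMap.mul'_apply] at h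
  rw [Matrix.mul_apply]
  simp only [Matrix.map_apply, h, Matrix.one_apply]
  split_ifs <;> simp

lemma mul_map_antipode (hx : IsMultiplicative k x) : x * x.map (antipode k) = 1 := by
  ext s t
  have h := mul_antipode_lTensor_comul_apply (R := k) (x s t)
  rw [hx.comul, hx.counit] at h
  simp only [map_sum, LinearMap.lTensor_tmul, LinearMap.mul'_apply] at h
  rw [Matrix.mul_apply]
  simp only [Matrix.map_apply, h, Matrix.one_apply]
  split_ifs <;> simp

/-- The contragredient of a multiplicative matrix. -/
theorem antipode_transpose (hx : IsMultiplicative k x) :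
    IsMultiplicative k ((x.map (antipode k)).transpose) where
  comul s t := by
    let Δ : H →ₐ[k] H ⊗[k] H := Bialgebra.comulAlgHom k H
    let l : H →ₐ[k] H ⊗[k] H := Algebra.TensorProduct.includeLeft
    let r : H →ₐ[k] H ⊗[k] H := Algebra.TensorProduct.includeRight
    have hmap : ∀ (f : H →ₐ[k] H ⊗[k] H) (u v : Matrix ι ι H), (u * v).map f = u.map f * v.map f :=
      fun f u v => Matrix.map_mul
    have hone : ∀ f : H →ₐ[k] H ⊗[k] H, (1 : Matrix ι ι H).map f = 1 :=
      fun f => Matrix.map_one f (map_zero f) (map_one f)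
    have h1 : x.map Δ = x.map l * x.map r := by
      ext i j
      rw [Matrix.mul_apply]
      simp [Δ, l, r, hx.comul]
    -- Both sides are inverses of the matrix Δ(x) = x_l x_r: on the left because S(x) inverts x, on
    -- the right by inverting the two factors in reverse order.
    have h2 : (x.map (antipode k)).map Δ =
        (x.map (antipode k)).map r * (x.map (antipode k)).map l := by
      have e1 : (x.map (antipode k)).map Δ * x.map Δ = 1 := by
        rw [← hmap, hx.map_antipode_mul, hone]
      have e2 : x.map Δ * ((x.map (antipode k)).map r * (x.map (antipode k)).map l) = 1 := by
        rw [h1, mul_assoc, ← mul_assoc (x.map r), ← hmap, hx.mul_map_antipode, hone, one_mul,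
          ← hmap, hx.mul_map_antipode, hone]
      exact left_inv_eq_right_inv e1 e2
    have h3 := congrFun (congrFun h2 t) s
    rw [Matrix.mul_apply] at h3
    simp only [Matrix.map_apply] at h3
    change Coalgebra.comul (R := k) (antipode k (x t s)) = _ at h3
    rw [Matrix.transpose_apply, Matrix.map_apply, h3]
    simp [l, r]
  counit s t := by
    simp only [Matrix.transpose_apply, Matrix.map_apply, counit_antipode, hx.counit]
    rw [Matrix.one_apply, Matrix.one_apply]
    simp [eq_comm]

end Hopf

end IsMultiplicative

/-! ### Integrals, bijectivity of the antipode, the Frobenius form on the dual -/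

namespace HopfIntegral

open ConvDual

section Contract

variable {k V : Type*} [Field k] [AddCommGroup V] [Module k V]

/-- Contraction of the second tensor factor. -/
noncomputable def contract (G : V →ₗ[k] k) : V ⊗[k] V →ₗ[k] V :=
  (TensorProduct.rid k V).toLinearMap ∘ₗ LinearMap.lTensor V G

@[simp] lemma contract_tmul (G : V →ₗ[k] k) (u v : V) : contract G (u ⊗ₜ[k] v) = G v • u := by
  simp [contract]

lemma contract_map (G : V →ₗ[k] k) (f g : Module.End k V) (z : V ⊗[k] V) :
    contract G (TensorProduct.map f g z) = f (contract (G ∘ₗ g) z) := by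
  induction z with
  | zero => simp
  | tmul u v => simp
  | add z w hz hw => simp only [map_add, hz, hw]

lemma exists_contract_ne_zero {z : V ⊗[k] V} (hz : z ≠ 0) : ∃ G : V →ₗ[k] k, contract G z ≠ 0 := by
  by_contra! h
  refine hz (tensor_eq_of_forall fun a b => ?_)
  have h1 : ∀ w : V ⊗[k] V, LinearMap.mul' k k (TensorProduct.map a b w) = a (contract b w) := by
    intro w
    induction w with
    | zero => simp
    | tmul u v => simp [mul_comm]
    | add z w hz hw => simp only [map_add, hz, hw]
  rw [h1, h, map_zero, map_zero, map_zero]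

end Contract

variable {k H : Type*} [Field k] [Ring H] [HopfAlgebra k H]

section Antipode

variable {ι : Type*} [Fintype ι] [DecidableEq ι] {x : Matrix ι ι H} (hx : IsMultiplicative k x)
include hx

lemma sum_mul_antipode (s t : ι) :
    ∑ l, x s l * antipode k (x l t) = if s = t then 1 else 0 := by
  simpa [Matrix.mul_apply, Matrix.one_apply] using congrFun (congrFun hx.mul_map_antipode s) t

lemma sum_antipode_mul (s t : ι) :
    ∑ l, antipode k (x s l) * x l t = if s = t then 1 else 0 := by
  simpa [Matrix.mul_apply, Matrix.one_apply] using congrFun (congrFun hx.map_antipode_mul s) t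

lemma sum_antipode_mul_sq (s t : ι) :
    ∑ l, antipode k (x l t) * antipode k (antipode k (x s l)) = if s = t then 1 else 0 := by
  have h := congrArg (antipode k) (sum_antipode_mul hx s t)
  simp only [map_sum, antipode_mul_antidistrib] at h
  rw [h]
  split_ifs <;> simp

lemma sum_sq_mul_antipode (s t : ι) :
    ∑ l, antipode k (antipode k (x l t)) * antipode k (x s l) = if s = t then 1 else 0 := by
  have h := congrArg (antipode k) (sum_mul_antipode hx s t)
  simp only [map_sum, antipode_mul_antidistrib] at h
  rw [h]
  split_ifs <;> simp

end Antipode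

section Integral

variable {ι : Type*} [Fintype ι] [DecidableEq ι] {b : Module.Basis ι k H} {x : Matrix ι ι H}
  (hx : IsMultiplicative k x) (hb : ∀ j, comul (R := k) (b j) = ∑ i, b i ⊗ₜ[k] x i j)

omit [DecidableEq ι] in
include hb in
lemma basis_eq_sum (j : ι) : b j = ∑ i, counit (R := k) (b i) • x i j := by
  apply eq_of_forall_apply_eq (k := k)
  intro a
  rw [← one_mul a, mul_apply_of_comul (hb j)]
  simp [map_sum]

omit [DecidableEq ι] in
include hb in
/-- To verify a linear statement it is enough to check matrix coefficients. -/
lemma forall_of_coeff {p : H → Prop} (h0 : p 0) (hadd : ∀ u v, p u → p v → p (u + v))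
    (hsmul : ∀ (c : k) u, p u → p (c • u)) (hc : ∀ i j, p (x i j)) (h : H) : p h := by
  have hsum : ∀ (f : ι → H), (∀ i, p (f i)) → p (∑ i, f i) := fun f hf =>
    Finset.sum_induction f p hadd h0 (fun i _ => hf i)
  rw [← b.sum_repr h]
  refine hsum _ fun j => hsmul _ _ ?_
  rw [basis_eq_sum hb j]
  exact hsum _ fun i => hsmul _ _ (hc i j)

/-- A candidate for a left integral. -/
noncomputable def integral (b : Module.Basis ι k H) (x : Matrix ι ι H) (y : H) : H :=
  ∑ i, ∑ j, b.coord j (antipode k (antipode k (x i j)) * y) • b i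

-- In Sweedler notation the candidate is the partial trace ∑_j b^j(S²(b_j₍₂₎) y) b_j₍₁₎. Two
-- expansions of Δ(x_pq b_j), contracted against suitable functionals and summed over q and j, are
-- collapsed by the antipode identities to x_pt L and to ε(x_pt) L.
include hx hb in
lemma mul_integral (h y : H) : h * integral b x y = counit (R := k) h • integral b x y := by
  refine forall_of_coeff hb (p := fun h => h * integral b x y = counit (R := k) h • integral b x y)
    (by simp) (fun u v hu hv => by rw [add_mul, hu, hv, map_add, add_smul])
    (fun c u hu => by rw [smul_mul_assoc, hu, map_smul, smul_smul, smul_eq_mul]) (fun p t => ?_) h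
  have key : ∀ (q j : ι) (G : H →ₗ[k] k),
      ∑ l, ∑ i, G (x l q * x i j) • (x p l * b i) =
        ∑ m, ∑ i, (b.coord m (x p q * b j) * G (x i m)) • b i := by
    intro q j G
    have h1 : comul (R := k) (x p q * b j) =
        ∑ l, ∑ i, (x p l * b i) ⊗ₜ[k] (x l q * x i j) := by
      rw [Bialgebra.comul_mul, hx.comul, hb, Finset.sum_mul_sum]
      simp only [Algebra.TensorProduct.tmul_mul_tmul]
    have h2 : comul (R := k) (x p q * b j) =
        ∑ m, b.coord m (x p q * b j) • ∑ i, b i ⊗ₜ[k] x i m := by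
      conv_lhs => rw [← b.sum_repr (x p q * b j), map_sum]
      refine Finset.sum_congr rfl fun m _ => ?_
      rw [map_smul, hb]; rfl
    have h3 := congrArg (contract G) (h1.symm.trans h2)
    simp only [map_sum, map_smul, contract_tmul, Finset.smul_sum, smul_smul] at h3
    exact h3
  have hG := fun q j => key q j (b.coord j ∘ₗ LinearMap.mulLeft k (antipode k (x q t)) ∘ₗ
    LinearMap.mulRight k y ∘ₗ antipode k ∘ₗ antipode k)
  simp only [LinearMap.comp_apply, LinearMap.mulLeft_apply, LinearMap.mulRight_apply,
    antipode_mul_antidistrib] at hG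
  have hsum := Finset.sum_congr (rfl : (Finset.univ : Finset ι) = Finset.univ) fun q _ =>
    Finset.sum_congr (rfl : (Finset.univ : Finset ι) = Finset.univ) fun j _ => hG q j
  have hL : ∑ q, ∑ j, ∑ l, ∑ i, b.coord j (antipode k (x q t) *
      (antipode k (antipode k (x l q)) * antipode k (antipode k (x i j)) * y)) • (x p l * b i) =
      x p t * integral b x y := by
    calc _ = ∑ j, ∑ l, ∑ i, ∑ q, b.coord j (antipode k (x q t) *
          (antipode k (antipode k (x l q)) * antipode k (antipode k (x i j)) * y)) •
            (x p l * b i) := by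
          rw [Finset.sum_comm]
          refine Finset.sum_congr rfl fun j _ => ?_
          rw [Finset.sum_comm]
          exact Finset.sum_congr rfl fun l _ => Finset.sum_comm
      _ = ∑ j, ∑ l, ∑ i, (if l = t then b.coord j (antipode k (antipode k (x i j)) * y) •
            (x p l * b i) else 0) := by
          refine Finset.sum_congr rfl fun j _ => Finset.sum_congr rfl fun l _ =>
            Finset.sum_congr rfl fun i _ => ?_
          rw [← Finset.sum_smul, ← map_sum]
          simp only [← mul_assoc]
          rw [← Finset.sum_mul, ← Finset.sum_mul, sum_antipode_mul_sq hx]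
          split_ifs <;> simp
      _ = _ := by
          simp only [integral, Finset.mul_sum, mul_smul_comm]
          rw [Finset.sum_comm (s := Finset.univ (α := ι))]
          rw [Finset.sum_eq_single t (fun l _ hl => by simp [hl]) (by simp), Finset.sum_comm]
          simp
  have hR : ∑ q, ∑ j, ∑ m, ∑ i, (b.coord m (x p q * b j) * b.coord j (antipode k (x q t) *
      (antipode k (antipode k (x i m)) * y))) • b i =
      counit (R := k) (x p t) • integral b x y := by
    calc _ = ∑ i, ∑ m, ∑ q, ∑ j, (b.coord m (x p q * b j) * b.coord j (antipode k (x q t) *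
          (antipode k (antipode k (x i m)) * y))) • b i := by
          rw [Finset.sum_congr rfl fun q _ => Finset.sum_congr rfl fun j _ => Finset.sum_comm]
          rw [Finset.sum_congr rfl fun q _ => Finset.sum_comm, Finset.sum_comm]
          refine Finset.sum_congr rfl fun i _ => ?_
          rw [Finset.sum_congr rfl fun q _ => Finset.sum_comm, Finset.sum_comm]
      _ = ∑ i, ∑ m, (if p = t then b.coord m (antipode k (antipode k (x i m)) * y) else 0) • b i := by
          refine Finset.sum_congr rfl fun i _ => Finset.sum_congr rfl fun m _ => ?_
          have h4 : ∀ q, ∑ j, b.coord m (x p q * b j) * b.coord j (antipode k (x q t) *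
              (antipode k (antipode k (x i m)) * y)) = b.coord m (x p q * (antipode k (x q t) *
              (antipode k (antipode k (x i m)) * y))) := by
            intro q
            conv_rhs => rw [← b.sum_repr (antipode k (x q t) *
              (antipode k (antipode k (x i m)) * y))]
            simp only [Finset.mul_sum, mul_smul_comm, map_sum, map_smul, smul_eq_mul]
            exact Finset.sum_congr rfl fun j _ => mul_comm _ _
          simp only [← Finset.sum_smul, h4]
          congr 1
          rw [← map_sum]
          simp only [← mul_assoc]
          rw [← Finset.sum_mul, ← Finset.sum_mul, sum_mul_antipode hx]
          split_ifs <;> simp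
      _ = _ := by
          rw [hx.counit, Matrix.one_apply, integral]
          split_ifs <;> simp
  rw [← hL, ← hR]
  simpa only [mul_assoc] using hsum

-- If every candidate vanished, inserting S(x_mi) y in place of y and summing over i would collapse
-- S²(x_ij) S(x_mi) to a Kronecker delta, so every coordinate b^m(y) would be 0.
include hx in
lemma exists_integral_ne_zero [Nonempty ι] : ∃ y, integral b x y ≠ 0 := by
  by_contra hcon
  push Not at hcon
  have h1 : ∀ y i, ∑ j, b.coord j (antipode k (antipode k (x i j)) * y) = 0 := by
    intro y i
    have h := hcon y
    simp only [integral, ← Finset.sum_smul] at h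
    exact Fintype.linearIndependent_iff.mp b.linearIndependent _ h i
  have h2 : ∀ m y, b.coord m y = 0 := by
    intro m y
    have h := Finset.sum_eq_zero fun i (_ : i ∈ Finset.univ) => h1 (antipode k (x m i) * y) i
    rw [Finset.sum_comm] at h
    simp only [← mul_assoc, ← map_sum, ← Finset.sum_mul, sum_sq_mul_antipode hx] at h
    rw [Finset.sum_eq_single m (fun j _ hj => by simp [hj.symm]) (by simp)] at h
    simpa using h
  obtain ⟨m⟩ := ‹Nonempty ι›
  have := h2 m (b m)
  simp at this

include hx hb in
/-- A nonzero left integral has trivial annihilator for the twisted action of the dual. -/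
lemma eq_zero_of_integral {L : H} (hL0 : L ≠ 0) (hL : ∀ h : H, h * L = counit (R := k) h • L)
    {a : ConvDual k H} (ha : contract (a.ofConv ∘ₗ antipode k) (comul (R := k) L) = 0) : a = 0 := by
  let v : ι → H := fun i => ∑ j, b.coord j L • x i j
  have hv : comul (R := k) L = ∑ i, b i ⊗ₜ[k] v i := by
    conv_lhs => rw [← b.sum_repr L, map_sum]
    simp only [map_smul, hb, v, TensorProduct.tmul_sum, TensorProduct.tmul_smul, Finset.smul_sum]
    exact Finset.sum_comm
  have hvv : ∀ t, comul (R := k) (v t) = ∑ i, x t i ⊗ₜ[k] v i := by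
    intro t
    simp only [v, map_sum, map_smul, hx.comul, TensorProduct.tmul_sum, TensorProduct.tmul_smul,
      Finset.smul_sum]
    exact Finset.sum_comm
  -- This is the identity h L₍₁₎ ⊗ S(L₍₂₎) = L₍₁₎ ⊗ S(L₍₂₎) h for a left integral L, with the second
  -- factor contracted.
  have key : ∀ (h : H) (G : H →ₗ[k] k),
      ∑ i, G (antipode k (v i)) • (h * b i) = ∑ i, G (antipode k (v i) * h) • b i := by
    intro h
    refine forall_of_coeff hb (p := fun h => ∀ (G : H →ₗ[k] k),
      ∑ i, G (antipode k (v i)) • (h * b i) = ∑ i, G (antipode k (v i) * h) • b i)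
      (by simp) (fun u v hu hv G => by
        simp only [add_mul, mul_add, smul_add, map_add, add_smul, Finset.sum_add_distrib, hu, hv])
      (fun c u hu G => by
        simp only [smul_mul_assoc, mul_smul_comm, map_smul, smul_eq_mul, mul_smul,
          ← Finset.smul_sum, ← hu]
        rw [Finset.smul_sum]
        exact Finset.sum_congr rfl fun i _ => smul_comm _ _ _) (fun p t G => ?_) h
    have h1 : ∀ (q : ι) (G : H →ₗ[k] k), ∑ l, ∑ i, G (x l q * v i) • (x p l * b i) =
        (if p = q then (1 : k) else 0) • ∑ i, G (v i) • b i := by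
      intro q G
      have e := congrArg (fun z => contract G (comul (R := k) z)) (hL (x p q))
      simp only [Bialgebra.comul_mul, hx.comul, hv, map_smul, Finset.sum_mul_sum,
        Algebra.TensorProduct.tmul_mul_tmul, map_sum, contract_tmul] at e
      rw [e, hx.counit, Matrix.one_apply]
    have h2 := Finset.sum_congr (rfl : (Finset.univ : Finset ι) = Finset.univ) fun q _ =>
      h1 q (G ∘ₗ LinearMap.mulRight k (x q t) ∘ₗ antipode k)
    simp only [LinearMap.comp_apply, LinearMap.mulRight_apply, antipode_mul_antidistrib] at h2
    have hL' : ∑ q, ∑ l, ∑ i, G (antipode k (v i) * antipode k (x l q) * x q t) • (x p l * b i) =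
        ∑ i, G (antipode k (v i)) • (x p t * b i) := by
      rw [Finset.sum_comm]
      calc _ = ∑ l, ∑ i, (if l = t then G (antipode k (v i)) • (x p l * b i) else 0) := by
            refine Finset.sum_congr rfl fun l _ => ?_
            rw [Finset.sum_comm]
            refine Finset.sum_congr rfl fun i _ => ?_
            rw [← Finset.sum_smul, ← map_sum]
            simp only [mul_assoc]
            rw [← Finset.mul_sum, sum_antipode_mul hx]
            split_ifs <;> simp
        _ = _ := by
            rw [Finset.sum_eq_single t (fun l _ hl => by simp [hl]) (by simp)]
            simp
    rw [← hL', h2, Finset.sum_eq_single p (fun q _ hq => by simp [hq.symm]) (by simp)]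
    simp
  have h1 : ∀ i h, a (antipode k (v i) * h) = 0 := by
    intro i h
    have e := key h a.ofConv
    have e2 : ∑ i, a (antipode k (v i)) • b i = 0 := by
      rw [← ha, hv]; simp
    have e3 : ∀ i, a (antipode k (v i)) = 0 :=
      Fintype.linearIndependent_iff.mp b.linearIndependent _ e2
    simp only [e3, zero_smul, Finset.sum_const_zero] at e
    exact Fintype.linearIndependent_iff.mp b.linearIndependent _ e.symm i
  obtain ⟨t, ht⟩ : ∃ t, counit (R := k) (v t) ≠ 0 := by
    by_contra hcon
    push Not at hcon
    apply hL0
    apply eq_of_forall_apply_eq (k := k)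
    intro c
    rw [← mul_one c, mul_apply_of_comul hv]
    simp [hcon]
  apply ext_apply
  intro h
  -- Applying S writes the nonzero scalar ε(v_t) as ∑ S(v_i) S²(x_ti); multiplying by h and applying
  -- a gives 0, so a(h) = 0.
  have h2 : ∑ i, antipode k (x t i) * v i = algebraMap k H (counit (R := k) (v t)) := by
    have := mul_antipode_rTensor_comul_apply (R := k) (v t)
    rw [hvv] at this
    simpa using this
  have h3 := congrArg (antipode k) h2
  simp only [map_sum, antipode_mul_antidistrib] at h3
  rw [Algebra.algebraMap_eq_smul_one, map_smul, antipode_one] at h3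
  have h4 := congrArg (fun z => a (z * h)) h3
  simp only [Finset.sum_mul, map_sum, mul_assoc, h1, Finset.sum_const_zero, smul_mul_assoc, one_mul,
    map_smul, smul_eq_mul] at h4
  exact (mul_eq_zero.mp h4.symm).resolve_left ht

end Integral

variable (k H) [FiniteDimensional k H]

/-- The antipode of a finite-dimensional Hopf algebra is bijective, and the dual algebra is
Frobenius. -/
theorem antipode_bijective_and_exists_frobenius : Function.Bijective (antipode k (A := H)) ∧
    ∃ φ : ConvDual k H →ₗ[k] k, ∀ a, (∀ c, φ (a * c) = 0) → a = 0 := by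
  rcases subsingleton_or_nontrivial H with hH | hH
  · refine ⟨⟨fun _ _ _ => Subsingleton.elim _ _, fun y => ⟨y, Subsingleton.elim _ _⟩⟩, 0,
      fun a _ => ext_apply fun x => ?_⟩
    rw [Subsingleton.elim x 0, map_zero, map_zero]
  let b := Module.finBasis k H
  obtain ⟨x, hx, hb⟩ := IsMultiplicative.exists_regular b
  have : Nonempty (Fin (Module.finrank k H)) := ⟨⟨0, Module.finrank_pos⟩⟩
  obtain ⟨y, hy⟩ := exists_integral_ne_zero (b := b) hx
  set L := integral b x y
  have hL : ∀ h : H, h * L = counit (R := k) h • L := fun h => mul_integral hx hb h y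
  have hbij : Function.Bijective (antipode k (A := H)) := by
    have hsurj : Function.Surjective (antipode k (A := H)) := by
      rw [← LinearMap.range_eq_top]
      by_contra hne
      obtain ⟨f, hf0, hf⟩ := Submodule.exists_le_ker_of_lt_top _ (lt_top_iff_ne_top.mpr hne)
      have hz : f ∘ₗ antipode k = 0 := by
        ext h
        exact hf ⟨h, rfl⟩
      have := eq_zero_of_integral hx hb hy hL (a := WithConv.toConv f) (by
        change contract (f ∘ₗ antipode k) _ = 0
        rw [hz]
        simp [contract])
      exact hf0 (congrArg WithConv.ofConv this)
    exact ⟨(LinearMap.injective_iff_surjective).mpr hsurj, hsurj⟩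
  refine ⟨hbij, eval L, ?_⟩
  -- T sends a to L₍₁₎ a(L₍₂₎). Its bijectivity is exactly the nondegeneracy of (a, c) ↦ (a * c)(L)
  -- = a(T c).
  let T : ConvDual k H →ₗ[k] H :=
    { toFun := fun a => contract a.ofConv (comul (R := k) L)
      map_add' := fun a c => by
        simp [contract, LinearMap.lTensor_add]
      map_smul' := fun r a => by
        simp [contract, LinearMap.lTensor_smul] }
  have hT : Function.Injective T := by
    rw [← LinearMap.ker_eq_bot, LinearMap.ker_eq_bot']
    intro a ha
    let Sinv := (LinearEquiv.ofBijective _ hbij).symm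
    have := eq_zero_of_integral hx hb hy hL (a := WithConv.toConv (a.ofConv ∘ₗ Sinv.toLinearMap)) (by
      rw [← ha]
      change contract ((a.ofConv ∘ₗ Sinv.toLinearMap) ∘ₗ antipode k) _ = contract a.ofConv _
      congr 1
      ext h
      simp [Sinv])
    apply ext_apply
    intro h
    have e := congrArg (fun f : ConvDual k H => f (antipode k h)) this
    simpa [Sinv] using e
  have hTs : Function.Surjective T :=
    (LinearMap.injective_iff_surjective_of_finrank_eq_finrank ConvDual.finrank_eq).mp hT
  have hmul : ∀ a c : ConvDual k H, (a * c) L = a (T c) := by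
    intro a c
    rw [LinearMap.convMul_apply]
    change _ = a.ofConv (contract c.ofConv _)
    generalize comul (R := k) L = z
    induction z with
    | zero => simp
    | tmul u w => simp [mul_comm]
    | add u w hu hw => simp only [map_add, hu, hw]
  intro a ha
  apply ext_apply
  intro h
  obtain ⟨c, rfl⟩ := hTs h
  rw [← hmul]
  exact ha c

end HopfIntegral

/-! ### Group-like elements of prime order have trace zero -/

section Fourier

/-- A self-convolutive family of multiplicities on a cyclic group of prime order is constant. -/
theorem fourier_eq_zero {k : Type*} [Field k] [CharZero k] {p : ℕ} [Fact p.Prime]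
    {ψ : AddChar (ZMod p) k} (hψ : ψ.IsPrimitive) {t : ZMod p → k} {v : ZMod p → ℕ} {N : k}
    (hv : ∀ s, (p : k) * v s = ∑ i, ψ (-(s * i)) * t i) (hpos : ∀ s, 1 ≤ v s)
    (ht : ∀ i, t i * t i = N * t i) (h0 : t 0 = N) : t 1 = 0 := by
  have hp0 : (p : k) ≠ 0 := Nat.cast_ne_zero.mpr (Fact.out : p.Prime).ne_zero
  have horth : ∀ c : ZMod p, ∑ s, ψ (s * c) = if c = 0 then (p : k) else 0 := by
    intro c
    have := AddChar.sum_mulShift c hψ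
    rw [ZMod.card] at this
    rw [this]
    split_ifs <;> simp
  have hinv : ∀ j, ∑ s, ψ (s * j) * (v s : k) = t j := by
    intro j
    apply mul_left_cancel₀ hp0
    calc (p : k) * ∑ s, ψ (s * j) * v s = ∑ s, ∑ i, ψ (s * (j - i)) * t i := by
          rw [Finset.mul_sum]
          refine Finset.sum_congr rfl fun s _ => ?_
          rw [mul_left_comm, hv, Finset.mul_sum]
          refine Finset.sum_congr rfl fun i _ => ?_
          rw [← mul_assoc, ← AddChar.map_add_eq_mul]
          congr 2; ring
      _ = ∑ i, (∑ s, ψ (s * (j - i))) * t i := by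
          rw [Finset.sum_comm]; simp only [Finset.sum_mul]
      _ = _ := by
          simp only [horth, sub_eq_zero, ite_mul, zero_mul, Finset.sum_ite_eq, Finset.mem_univ,
            if_true]
  have hsum : ∑ s, (v s : k) = N := by
    rw [← h0, ← hinv 0]; simp
  have hconv : ∀ s, ∑ a, (v a : k) * v (s - a) = N * v s := by
    intro s
    apply mul_left_cancel₀ hp0
    calc (p : k) * ∑ a, (v a : k) * v (s - a)
        = ∑ a, ∑ j, (v a : k) * (ψ (-((s - a) * j)) * t j) := by
          rw [Finset.mul_sum]
          refine Finset.sum_congr rfl fun a _ => ?_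
          rw [mul_left_comm, hv, Finset.mul_sum]
      _ = ∑ j, ψ (-(s * j)) * t j * ∑ a, ψ (a * j) * v a := by
          rw [Finset.sum_comm]
          refine Finset.sum_congr rfl fun j _ => ?_
          rw [Finset.mul_sum]
          refine Finset.sum_congr rfl fun a _ => ?_
          have : ψ (-((s - a) * j)) = ψ (-(s * j)) * ψ (a * j) := by
            rw [← AddChar.map_add_eq_mul]; congr 1; ring
          rw [this]; ring
      _ = N * ∑ j, ψ (-(s * j)) * t j := by
          rw [Finset.mul_sum]
          refine Finset.sum_congr rfl fun j _ => ?_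
          rw [hinv, mul_assoc, ht]; ring
      _ = _ := by rw [← hv]; ring
  have hconvN : ∀ s, ∑ a, v a * v (s - a) = ∑ a, v a * v s := by
    intro s
    have := hconv s
    rw [← hsum, Finset.sum_mul] at this
    exact_mod_cast this
  -- At a minimum s of v, the equation ∑ v_a v_(s-a) = ∑ v_a v_s, with all v_a positive, forces
  -- equality in each term, so v is constant and its nontrivial Fourier coefficient vanishes.
  obtain ⟨s, -, hs⟩ := Finset.exists_min_image Finset.univ v ⟨0, Finset.mem_univ _⟩
  have hconst : ∀ a, v (s - a) = v s := by
    intro a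
    have h1 := (Finset.sum_eq_sum_iff_of_le (fun a _ => Nat.mul_le_mul_left (v a)
      (hs (s - a) (Finset.mem_univ _)))).mp (hconvN s).symm a (Finset.mem_univ a)
    exact (Nat.eq_of_mul_eq_mul_left (hpos a) h1).symm
  have hconst' : ∀ a, v a = v s := fun a => by
    have := hconst (s - a); rwa [sub_sub_cancel] at this
  rw [← hinv 1]
  simp only [hconst', ← Finset.sum_mul, horth]
  rw [if_neg one_ne_zero, zero_mul]

end Fourier

namespace GroupLikeTrace

variable {k H : Type*} [Field k] [Ring H] [HopfAlgebra k H] [FiniteDimensional k H]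

/-- The tensor identity for the regular module. -/
noncomputable def twist (k H : Type*) [Field k] [Ring H] [HopfAlgebra k H] :
    H ⊗[k] H →ₗ[k] H ⊗[k] H :=
  TensorProduct.lift ((LinearMap.mul k (H ⊗[k] H)).compl₁₂ (comul (R := k))
    (Algebra.TensorProduct.includeRight (R := k) (A := H) (B := H)).toLinearMap)

omit [FiniteDimensional k H] in
lemma twist_tmul (h w : H) : twist k H (h ⊗ₜ w) = comul (R := k) h * (1 ⊗ₜ w) := by
  simp [twist]

/-- A preimage of h ⊗ w is h₍₁₎ ⊗ S(h₍₂₎) w. -/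
lemma twist_surjective : Function.Surjective (twist k H) := by
  intro z
  induction z with
  | zero => exact ⟨0, map_zero _⟩
  | add z w hz hw =>
    obtain ⟨a, rfl⟩ := hz
    obtain ⟨b, rfl⟩ := hw
    exact ⟨a + b, map_add _ _ _⟩
  | tmul h w =>
    let b := Module.finBasis k H
    obtain ⟨x, hx, hb⟩ := IsMultiplicative.exists_regular b
    rw [← b.sum_repr h]
    refine ⟨∑ j, b.repr h j • ∑ i, b i ⊗ₜ (antipode k (x i j) * w), ?_⟩
    rw [TensorProduct.sum_tmul, map_sum]
    refine Finset.sum_congr rfl fun j _ => ?_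
    rw [map_smul, map_sum, ← TensorProduct.smul_tmul']
    congr 1
    simp only [twist_tmul, hb, Finset.sum_mul, Algebra.TensorProduct.tmul_mul_tmul, mul_one]
    rw [Finset.sum_comm]
    simp only [← TensorProduct.tmul_sum, ← mul_assoc, ← Finset.sum_mul,
      HopfIntegral.sum_mul_antipode hx]
    simp [TensorProduct.tmul_ite]

/-- The tensor identity conjugates g ⊗ 1 into g ⊗ g; the traces of these two operators are compared.
-/
lemma trace_mulLeft_mul_self {g : H} (hg : IsGroupLikeElem k g) :
    LinearMap.trace k H (LinearMap.mulLeft k g) * LinearMap.trace k H (LinearMap.mulLeft k g) =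
      Module.finrank k H * LinearMap.trace k H (LinearMap.mulLeft k g) := by
  let T : (H ⊗[k] H) ≃ₗ[k] (H ⊗[k] H) := LinearEquiv.ofBijective (twist k H)
    ⟨LinearMap.injective_iff_surjective.mpr twist_surjective, twist_surjective⟩
  have h1 : T.conj (TensorProduct.map (LinearMap.mulLeft k g) LinearMap.id) =
      TensorProduct.map (LinearMap.mulLeft k g) (LinearMap.mulLeft k g) := by
    apply LinearMap.ext
    intro z
    obtain ⟨z, rfl⟩ := T.surjective z
    rw [LinearEquiv.conj_apply]
    simp only [LinearMap.comp_apply, LinearEquiv.coe_coe, LinearEquiv.symm_apply_apply]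
    change twist k H _ = TensorProduct.map _ _ (twist k H z)
    induction z with
    | zero => simp
    | add z w hz hw => simp only [map_add, hz, hw]
    | tmul h w =>
      rw [TensorProduct.map_tmul, LinearMap.mulLeft_apply, LinearMap.id_apply, twist_tmul,
        twist_tmul, Bialgebra.comul_mul, hg.comul_eq_tmul_self, mul_assoc]
      generalize comul (R := k) h * (1 ⊗ₜ w) = y
      induction y with
      | zero => simp
      | add z w hz hw => simp only [map_add, mul_add, hz, hw]
      | tmul h w => simp
  have h2 := LinearMap.trace_conj' (TensorProduct.map (LinearMap.mulLeft k g) LinearMap.id) T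
  rw [h1, LinearMap.trace_tensorProduct', LinearMap.trace_tensorProduct', LinearMap.trace_id] at h2
  rw [h2, mul_comm]

variable [IsAlgClosed k] [CharZero k]

/-- Left multiplication by a nontrivial group-like element of prime order has trace zero. -/
theorem trace_mulLeft_eq_zero {p : ℕ} [hp : Fact p.Prime] (g : GroupLike k H) (hgp : g ^ p = 1)
    (hg1 : g ≠ 1) : LinearMap.trace k H (LinearMap.mulLeft k (g : H)) = 0 := by
  have hp0 : (p : k) ≠ 0 := Nat.cast_ne_zero.mpr hp.out.ne_zero
  have : NeZero (p : k) := ⟨hp0⟩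
  obtain ⟨ζ, hζ⟩ := HasEnoughRootsOfUnity.exists_primitiveRoot k p
  have hψ := AddChar.zmodChar_primitive_of_primitive_root p hζ
  set ψ := AddChar.zmodChar p hζ.pow_eq_one
  let γ : ZMod p → GroupLike k H := fun i => g ^ i.val
  have hγ : ∀ i j, γ (i + j) = γ i * γ j := by
    intro i j
    change g ^ (i + j).val = g ^ i.val * g ^ j.val
    rw [← pow_add, ZMod.val_add, ← pow_eq_pow_mod _ hgp]
  have hord : orderOf g = p := orderOf_eq_prime hgp hg1
  have hγi : Function.Injective γ := by
    intro i j hij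
    apply ZMod.val_injective p
    refine pow_injOn_Iio_orderOf ?_ ?_ hij
    · rw [hord]; exact ZMod.val_lt i
    · rw [hord]; exact ZMod.val_lt j
  -- These are the character idempotents of the group generated by g. Linear independence of
  -- group-likes makes them nonzero, so every eigenvalue multiplicity is positive, as the Fourier
  -- argument requires.
  let e : ZMod p → H := fun s => (p : k)⁻¹ • ∑ i, ψ (-(s * i)) • (γ i : H)
  have he : ∀ s, IsIdempotentElem (e s) := by
    intro s
    have h1 : (∑ i, ψ (-(s * i)) • (γ i : H)) * (∑ i, ψ (-(s * i)) • (γ i : H)) =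
        (p : k) • ∑ i, ψ (-(s * i)) • (γ i : H) := by
      rw [Finset.sum_mul_sum]
      have h2 : ∀ i, ∑ j, (ψ (-(s * i)) • (γ i : H)) * (ψ (-(s * j)) • (γ j : H)) =
          ∑ j, ψ (-(s * j)) • (γ j : H) := by
        intro i
        rw [← Equiv.sum_comp (Equiv.addLeft i) (fun j => ψ (-(s * j)) • (γ j : H))]
        refine Finset.sum_congr rfl fun j _ => ?_
        rw [Equiv.coe_addLeft, hγ, GroupLike.val_mul, smul_mul_smul_comm,
          ← AddChar.map_add_eq_mul]
        congr 2; ring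
      simp only [h2, Finset.sum_const, Finset.card_univ, ZMod.card]
      rw [Nat.cast_smul_eq_nsmul]
    change _ • _ * _ • _ = _ • _
    rw [smul_mul_smul_comm, h1, smul_smul, mul_assoc, inv_mul_cancel₀ hp0, mul_one]
  have hne : ∀ s, e s ≠ 0 := by
    intro s h
    have h1 := (smul_eq_zero.mp h).resolve_left (inv_ne_zero hp0)
    have h2 := Fintype.linearIndependent_iff.mp
      ((linearIndep_groupLikeVal (R := k) (A := H)).comp γ hγi) _ h1 0
    simp at h2
  have hL : ∀ a : H, IsIdempotentElem a → IsIdempotentElem (LinearMap.mulLeft k a) := by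
    intro a ha
    rw [IsIdempotentElem, Module.End.mul_eq_comp, ← LinearMap.mulLeft_mul, ha.eq]
  have := fourier_eq_zero (N := (Module.finrank k H : k)) hψ
    (t := fun i => LinearMap.trace k H (LinearMap.mulLeft k (γ i : H)))
    (v := fun s => Module.finrank k (LinearMap.range (LinearMap.mulLeft k (e s)))) ?_ ?_ ?_ ?_
  · simpa [γ, ZMod.val_one] using this
  · intro s
    rw [← LinearMap.trace_eq_finrank_range (hL _ (he s))]
    have : LinearMap.mulLeft k (e s) = (p : k)⁻¹ • ∑ i, ψ (-(s * i)) •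
        LinearMap.mulLeft k (γ i : H) := by
      ext z; simp [e, Finset.sum_mul]
    rw [this]
    simp only [map_smul, map_sum, smul_eq_mul]
    rw [mul_inv_cancel_left₀ hp0]
  · intro s
    rw [Nat.one_le_iff_ne_zero, ← Nat.pos_iff_ne_zero, Module.finrank_pos_iff]
    refine ⟨⟨⟨_, 1, rfl⟩, 0, fun h => hne s ?_⟩⟩
    simpa using congrArg Subtype.val h
  · intro i
    exact trace_mulLeft_mul_self (γ i).2
  · simp [γ]

end GroupLikeTrace

/-! ### Action of group-likes on irreducible characters, and stable characters -/

lemma LinearMap.trace_matrix_trace_mul_comm {k V ι : Type*} [Field k] [AddCommGroup V] [Module k V]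
    [Fintype ι] (M N : Matrix ι ι (Module.End k V)) :
    LinearMap.trace k V (M * N).trace = LinearMap.trace k V (N * M).trace := by
  simp only [Matrix.trace, Matrix.diag_apply, Matrix.mul_apply, map_sum]
  rw [Finset.sum_comm]
  exact Finset.sum_congr rfl fun s _ => Finset.sum_congr rfl fun t _ =>
    LinearMap.trace_mul_comm k _ _

lemma Matrix.eq_zero_of_trace_mul {k ι : Type*} [Field k] [Fintype ι] [DecidableEq ι]
    {M : Matrix ι ι k} (h : ∀ N, (M * N).trace = 0) : M = 0 := by
  ext s t
  have := h (Matrix.single t s 1)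
  rw [Matrix.trace_mul_single] at this
  simpa using this

/-- A matrix of finite order whose nontrivial powers are traceless has size divisible by its
order. -/
lemma dvd_finrank_of_trace_pow {k V : Type*} [Field k] [CharZero k] [AddCommGroup V] [Module k V]
    [FiniteDimensional k V] {p : ℕ} (hp : 0 < p) {T : Module.End k V} (hT : T ^ p = 1)
    (htr : ∀ i, 0 < i → i < p → LinearMap.trace k V (T ^ i) = 0) : p ∣ Module.finrank k V := by
  have hp0 : (p : k) ≠ 0 := Nat.cast_ne_zero.mpr hp.ne'
  have h1 : T * ∑ i ∈ Finset.range p, T ^ i = ∑ i ∈ Finset.range p, T ^ i := by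
    rw [Finset.mul_sum]
    simp only [← pow_succ']
    have e1 := Finset.sum_range_succ (fun i => T ^ i) p
    have e2 := Finset.sum_range_succ' (fun i => T ^ i) p
    rw [e1, hT, pow_zero] at e2
    exact (add_right_cancel e2).symm
  have h2 : ∀ j, T ^ j * ∑ i ∈ Finset.range p, T ^ i = ∑ i ∈ Finset.range p, T ^ i := by
    intro j
    induction j with
    | zero => simp
    | succ j ih => rw [pow_succ, mul_assoc, h1, ih]
  have h3 : (∑ i ∈ Finset.range p, T ^ i) * ∑ i ∈ Finset.range p, T ^ i =
      (p : k) • ∑ i ∈ Finset.range p, T ^ i := by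
    rw [Finset.sum_mul]
    simp only [h2, Finset.sum_const, Finset.card_range, Nat.cast_smul_eq_nsmul]
  have hidem : IsIdempotentElem ((p : k)⁻¹ • ∑ i ∈ Finset.range p, T ^ i) := by
    rw [IsIdempotentElem, smul_mul_smul_comm, h3, smul_smul, mul_assoc, inv_mul_cancel₀ hp0,
      mul_one]
  have h4 := LinearMap.trace_eq_finrank_range hidem
  rw [map_smul, map_sum, Finset.sum_eq_single_of_mem 0 (Finset.mem_range.mpr hp)
    (fun i hi hi0 => htr i (Nat.pos_of_ne_zero hi0) (Finset.mem_range.mp hi)), pow_zero,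
    LinearMap.trace_one, smul_eq_mul, inv_mul_eq_iff_eq_mul₀ hp0] at h4
  exact ⟨_, by exact_mod_cast h4⟩

namespace SplitPresentation

section Blocks

variable {k A : Type*} [Field k] [Ring A] [Algebra k A] (P : SplitPresentation k A)

/-- The irreducible representations. -/
def rep (i : Fin P.n) : A →ₐ[k] Matrix (Fin (P.d i)) (Fin (P.d i)) k :=
  (Pi.evalAlgHom k _ i).comp P.q

lemma rep_apply (i : Fin P.n) (a : A) : P.rep i a = P.q a i := rfl

lemma trace_rep (i : Fin P.n) (a : A) : (P.rep i a).trace = P.tr i a := rfl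

lemma exists_rep_eq (i : Fin P.n) (M : Matrix (Fin (P.d i)) (Fin (P.d i)) k) :
    ∃ a, P.rep i a = M ∧ ∀ j, j ≠ i → P.rep j a = 0 := by
  obtain ⟨a, ha⟩ := P.q_surjective (Pi.single i M)
  exact ⟨a, by simp [rep_apply, ha], fun j hj => by simp [rep_apply, ha, Pi.single_eq_of_ne hj]⟩

lemma rep_surjective (i : Fin P.n) : Function.Surjective (P.rep i) := fun M =>
  (P.exists_rep_eq i M).imp fun _ h => h.1

lemma rep_eq_zero_of_tr {θ : A ≃ₐ[k] A} {i j : Fin P.n} (h : ∀ a, P.tr i (θ a) = P.tr j a) {a : A}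
    (ha : P.rep j a = 0) : P.rep i (θ a) = 0 := by
  apply Matrix.eq_zero_of_trace_mul
  intro N
  obtain ⟨b, rfl⟩ := P.rep_surjective i N
  obtain ⟨b, rfl⟩ := θ.surjective b
  rw [← map_mul, ← map_mul, trace_rep, h, ← trace_rep, map_mul, ha, zero_mul, Matrix.trace_zero]

/-- Automorphisms of matrix algebras are inner. -/
lemma _root_.Matrix.exists_conj_of_algEquiv {n : ℕ}
    (α : Matrix (Fin n) (Fin n) k ≃ₐ[k] Matrix (Fin n) (Fin n) k) :
    ∃ u : (Matrix (Fin n) (Fin n) k)ˣ, ∀ M, α M * u = u * M := by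
  let e := Matrix.toLinAlgEquiv' (R := k) (n := Fin n)
  obtain ⟨T, hT⟩ := AlgEquiv.eq_linearEquivConjAlgEquiv ((e.symm.trans α).trans e)
  have h1 : ∀ M, e (α M) * T.toLinearMap = T.toLinearMap * e M := by
    intro M
    have h := congrArg (fun f : Module.End k (Fin n → k) ≃ₐ[k] Module.End k (Fin n → k) =>
      f (e M)) hT
    simp only [AlgEquiv.trans_apply, AlgEquiv.symm_apply_apply] at h
    rw [h]
    ext v
    simp [LinearEquiv.conjAlgEquiv_apply]
  have h2 : T.toLinearMap * T.symm.toLinearMap = 1 := by ext; simp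
  have h3 : T.symm.toLinearMap * T.toLinearMap = 1 := by ext; simp
  refine ⟨⟨e.symm T.toLinearMap, e.symm T.symm.toLinearMap, ?_, ?_⟩, fun M => ?_⟩
  · rw [← map_mul, h2, map_one]
  · rw [← map_mul, h3, map_one]
  · apply e.injective
    change e (α M * e.symm T.toLinearMap) = e (e.symm T.toLinearMap * M)
    rw [map_mul, map_mul]
    simp only [AlgEquiv.apply_symm_apply]
    exact h1 M

/-- An automorphism fixing an irreducible character acts on the representation by conjugation. -/
theorem exists_conj (θ : A ≃ₐ[k] A) (i : Fin P.n) (h : ∀ a, P.tr i (θ a) = P.tr i a) :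
    ∃ u : (Matrix (Fin (P.d i)) (Fin (P.d i)) k)ˣ, ∀ a, P.rep i (θ a) * u = u * P.rep i a := by
  have hker : ∀ a b, P.rep i a = P.rep i b → P.rep i (θ a) = P.rep i (θ b) := by
    intro a b hab
    rw [← sub_eq_zero, ← map_sub, ← map_sub]
    exact P.rep_eq_zero_of_tr h (by rw [map_sub, hab, sub_self])
  choose s hs using P.rep_surjective i
  let α : Matrix (Fin (P.d i)) (Fin (P.d i)) k →ₐ[k] Matrix (Fin (P.d i)) (Fin (P.d i)) k :=
    AlgHom.ofLinearMap
      { toFun := fun M => P.rep i (θ (s M))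
        map_add' := fun M N => by
          rw [← map_add, ← map_add]
          exact hker _ _ (by simp only [map_add, hs])
        map_smul' := fun c M => by
          rw [RingHom.id_apply, ← map_smul, ← map_smul]
          exact hker _ _ (by simp only [map_smul, hs]) }
      (by
        change P.rep i (θ (s 1)) = 1
        rw [hker _ 1 (by rw [hs, map_one]), map_one, map_one])
      (fun M N => by
        change P.rep i (θ (s (M * N))) = P.rep i (θ (s M)) * P.rep i (θ (s N))
        rw [← map_mul, ← map_mul]
        exact hker _ _ (by simp only [map_mul, hs]))
  have hα : ∀ a, α (P.rep i a) = P.rep i (θ a) := fun a => hker _ _ (hs _)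
  have hαs : Function.Surjective α := by
    intro M
    exact ⟨P.rep i (θ.symm (s M)), by rw [hα, AlgEquiv.apply_symm_apply, hs]⟩
  obtain ⟨u, hu⟩ := Matrix.exists_conj_of_algEquiv (AlgEquiv.ofBijective α
    ⟨(LinearMap.injective_iff_surjective (f := α.toLinearMap)).mpr hαs, hαs⟩)
  refine ⟨u, fun a => ?_⟩
  have h1 : α (P.rep i a) * u = u * P.rep i a := hu (P.rep i a)
  rw [hα] at h1
  exact h1

end Blocks

end SplitPresentation

namespace ConvDual

variable {k H : Type*} [Field k] [Ring H] [HopfAlgebra k H]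

/-- Translation by a group-like element, as an automorphism of the dual algebra. -/
noncomputable def leftTranslate (g : GroupLike k H) : ConvDual k H ≃ₐ[k] ConvDual k H :=
  AlgEquiv.ofLinearEquiv
    { toFun := fun a => WithConv.toConv (a.ofConv ∘ₗ LinearMap.mulLeft k (g : H))
      invFun := fun a => WithConv.toConv (a.ofConv ∘ₗ LinearMap.mulLeft k ((g⁻¹ : GroupLike k H) : H))
      map_add' := fun _ _ => rfl
      map_smul' := fun _ _ => rfl
      left_inv := fun a => ext_apply fun h => by
        change a ((g : H) * (((g⁻¹ : GroupLike k H) : H) * h)) = a h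
        rw [← mul_assoc, ← GroupLike.val_mul, mul_inv_cancel, GroupLike.val_one, one_mul]
      right_inv := fun a => ext_apply fun h => by
        change a (((g⁻¹ : GroupLike k H) : H) * ((g : H) * h)) = a h
        rw [← mul_assoc, ← GroupLike.val_mul, inv_mul_cancel, GroupLike.val_one, one_mul] }
    (ext_apply fun h => by
      change counit (R := k) ((g : H) * h) = counit (R := k) h
      simp [Bialgebra.counit_mul])
    (fun a b => ext_apply fun h => by
      change (a * b) ((g : H) * h) = _
      rw [LinearMap.convMul_apply, LinearMap.convMul_apply, Bialgebra.comul_mul,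
        g.2.comul_eq_tmul_self]
      change _ = LinearMap.mul' k k (TensorProduct.map (a.ofConv ∘ₗ LinearMap.mulLeft k (g : H))
        (b.ofConv ∘ₗ LinearMap.mulLeft k (g : H)) _)
      generalize comul (R := k) h = z
      induction z with
      | zero => simp
      | add z w hz hw => simp only [mul_add, map_add, hz, hw]
      | tmul u v => simp)

lemma leftTranslate_apply (g : GroupLike k H) (a : ConvDual k H) (h : H) :
    leftTranslate g a h = a ((g : H) * h) := rfl

lemma leftTranslate_one (a : ConvDual k H) : leftTranslate (1 : GroupLike k H) a = a :=
  ext_apply fun h => by rw [leftTranslate_apply, GroupLike.val_one, one_mul]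

lemma leftTranslate_leftTranslate (g h : GroupLike k H) (a : ConvDual k H) :
    leftTranslate g (leftTranslate h a) = leftTranslate (h * g) a :=
  ext_apply fun x => by simp only [leftTranslate_apply, GroupLike.val_mul, mul_assoc]

end ConvDual

namespace SplitPresentation

open ConvDual

variable {k H : Type*} [Field k] [CharZero k] [Ring H] [HopfAlgebra k H]
  (P : SplitPresentation k (ConvDual k H))

lemma exists_act (g : GroupLike k H) : ∃ π : Equiv.Perm (Fin P.n),
    (∀ i a, P.tr i (leftTranslate g a) = P.tr (π i) a) ∧ ∀ i, P.d (π i) = P.d i :=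
  P.exists_perm (leftTranslate g).toLinearEquiv (by simp) (Or.inl (by simp))

/-- The permutation of the irreducible characters induced by a group-like element. -/
noncomputable def act (g : GroupLike k H) : Equiv.Perm (Fin P.n) := (P.exists_act g).choose

lemma tr_leftTranslate (g : GroupLike k H) (i : Fin P.n) (a : ConvDual k H) :
    P.tr i (leftTranslate g a) = P.tr (P.act g i) a := (P.exists_act g).choose_spec.1 i a

lemma d_act (g : GroupLike k H) (i : Fin P.n) : P.d (P.act g i) = P.d i :=
  (P.exists_act g).choose_spec.2 i

lemma act_one (i : Fin P.n) : P.act 1 i = i :=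
  P.tr_injective fun a => by rw [← tr_leftTranslate, leftTranslate_one]

lemma act_mul (g h : GroupLike k H) (i : Fin P.n) : P.act (g * h) i = P.act g (P.act h i) :=
  P.tr_injective fun a => by rw [← tr_leftTranslate, ← tr_leftTranslate, ← tr_leftTranslate,
    leftTranslate_leftTranslate]

/-- The action of the group of group-like elements on the irreducible characters. -/
@[reducible] noncomputable def mulAction : MulAction (GroupLike k H) (Fin P.n) where
  smul g i := P.act g i
  one_smul := P.act_one
  mul_smul := P.act_mul

lemma c_act [FiniteDimensional k H] (g : GroupLike k H) (i j : Fin P.n) :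
    P.c (P.act g i) (P.act g j) = P.c i j :=
  P.c_perm (leftTranslate g) (P.act g) (P.tr_leftTranslate g) i j

/-- Evaluation at a group-like element is an irreducible character. -/
lemma exists_index (g : GroupLike k H) :
    ∃ i, P.d i = 1 ∧ ∀ a : ConvDual k H, P.tr i a = a (g : H) := by
  have hmul : ∀ a b : ConvDual k H, (a * b) (g : H) = a (g : H) * b (g : H) := by
    intro a b
    rw [LinearMap.convMul_apply, g.2.comul_eq_tmul_self]
    simp
  have hone : (1 : ConvDual k H) (g : H) = 1 := by
    rw [ConvDual.one_apply, g.2.counit_eq_one]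
  have hT : P.IsTraceForm (eval (g : H)) := by
    constructor
    · intro a b
      simp only [eval_apply, hmul, mul_comm]
    · intro a ha
      obtain ⟨m, hm⟩ := P.isNilpotent_of_mem_J ha
      have hpow : ∀ m : ℕ, (a ^ m) (g : H) = (a (g : H)) ^ m := by
        intro m
        induction m with
        | zero => rw [pow_zero, pow_zero, hone]
        | succ m ih => rw [pow_succ, hmul, ih, pow_succ]
      have := hpow m
      rw [hm, ConvDual.zero_apply] at this
      exact IsReduced.eq_zero _ ⟨m, this.symm⟩
  have h1 : ∀ i, ∃ m : ℕ, (P.e i) (g : H) = m := by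
    intro i
    have h : (P.e i) (g : H) * (P.e i) (g : H) = (P.e i) (g : H) := by
      rw [← hmul, (P.e_idem i).eq]
    rcases IsIdempotentElem.iff_eq_zero_or_one.mp h with h | h
    · exact ⟨0, by rw [h, Nat.cast_zero]⟩
    · exact ⟨1, by rw [h, Nat.cast_one]⟩
  -- Evaluation at a group-like is multiplicative, so it is a combination of irreducible characters
  -- with coefficients 0 or 1; its value 1 at the unit leaves one linear character.
  choose m hm using h1
  have hsum : ∀ a : ConvDual k H, a (g : H) = ∑ i, (m i : k) * P.tr i a := by
    intro a
    have := hT.eq_sum P a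
    simpa only [eval_apply, hm] using this
  have h2 : ∑ i, m i * P.d i = 1 := by
    have := hsum 1
    rw [hone] at this
    simp only [tr_one] at this
    exact_mod_cast this.symm
  obtain ⟨i, -, hi⟩ := Finset.exists_ne_zero_of_sum_ne_zero (by rw [h2]; exact one_ne_zero)
  have hle := Finset.single_le_sum (f := fun i => m i * P.d i) (fun _ _ => Nat.zero_le _)
    (Finset.mem_univ i)
  have hi1 : m i * P.d i = 1 := by omega
  have hm1 := Nat.eq_one_of_mul_eq_one_right hi1
  have hd1 := Nat.eq_one_of_mul_eq_one_left hi1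
  refine ⟨i, hd1, fun a => ?_⟩
  have hrest : ∀ j, j ≠ i → m j = 0 := by
    intro j hj
    have h3 := Finset.sum_le_sum_of_subset (f := fun i => m i * P.d i)
      (Finset.subset_univ ({j, i} : Finset (Fin P.n)))
    rw [Finset.sum_pair hj, h2, hi1] at h3
    have h4 : m j * P.d j = 0 := by omega
    exact (Nat.mul_eq_zero.mp h4).resolve_right (NeZero.ne _)
  rw [hsum, Finset.sum_eq_single i (fun j _ hj => by rw [hrest j hj, Nat.cast_zero, zero_mul])
    (by simp), hm1, Nat.cast_one, one_mul]

/-- The trivial character. -/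
noncomputable def o : Fin P.n := (P.exists_index 1).choose

lemma d_o : P.d P.o = 1 := (P.exists_index 1).choose_spec.1

lemma tr_o (a : ConvDual k H) : P.tr P.o a = a 1 := (P.exists_index 1).choose_spec.2 a

lemma tr_act_o (g : GroupLike k H) (a : ConvDual k H) : P.tr (P.act g P.o) a = a (g : H) := by
  rw [← tr_leftTranslate, tr_o, leftTranslate_apply, mul_one]

/-- Linear characters are evaluations at group-like elements. -/
lemma exists_groupLike [FiniteDimensional k H] {i : Fin P.n} (hi : P.d i = 1) :
    ∃ g : GroupLike k H, P.act g P.o = i := by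
  obtain ⟨h, hh⟩ := exists_forall_apply_eq (P.tr i)
  have hg : IsGroupLikeElem k h := by
    constructor
    · rw [← ConvDual.one_apply, hh, tr_one, hi, Nat.cast_one]
    · have := comul_eq_of_mul_apply (k := k) (ι := Unit) (h := h) (u := fun _ => h) (v := fun _ => h)
        (fun a b => by rw [hh, tr_mul_of_linear hi]; simp [hh])
      simpa using this
  exact ⟨⟨h, hg⟩, P.tr_injective fun a => by rw [tr_act_o, ← hh]⟩

section Stable

variable [FiniteDimensional k H]

omit [CharZero k] in
/-- Multiplicative matrix of an irreducible representation. -/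
lemma exists_coeff (i : Fin P.n) : ∃ x : Matrix (Fin (P.d i)) (Fin (P.d i)) H,
    IsMultiplicative k x ∧ ∀ a s t, a (x s t) = P.rep i a s t :=
  IsMultiplicative.exists_of_algHom (P.rep i)

/-- The intertwiner gives x w' = w' (g x) for the coefficient matrix x. Let the entries of x act on
H by left multiplication. Since x is invertible, w' and w' · L_g are conjugate up to the order of
factors under the trace, so tr(w') dim H = tr(w') tr(L_g) = 0. -/
lemma trace_eq_zero_of_conj {g : GroupLike k H}
    (hg : LinearMap.trace k H (LinearMap.mulLeft k (g : H)) = 0) {i : Fin P.n}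
    {w w' : Matrix (Fin (P.d i)) (Fin (P.d i)) k} (hww : w' * w = 1) (hww' : w * w' = 1)
    (hw : ∀ a, P.rep i (leftTranslate g a) * w = w * P.rep i a) : w'.trace = 0 := by
  obtain ⟨x, hx, hxr⟩ := P.exists_coeff i
  let L : H →ₐ[k] Module.End k H := Algebra.lmul k H
  let W' : Matrix (Fin (P.d i)) (Fin (P.d i)) (Module.End k H) :=
    w'.map (algebraMap k (Module.End k H))
  have h1 : x * w'.map (algebraMap k H) = w'.map (algebraMap k H) * (g : H) • x := by
    ext s t
    apply eq_of_forall_apply_eq (k := k)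
    intro a
    have h2 : P.rep i a * w' = w' * P.rep i (leftTranslate g a) := by
      calc P.rep i a * w' = w' * w * P.rep i a * w' := by rw [hww, one_mul]
        _ = w' * (P.rep i (leftTranslate g a) * w) * w' := by rw [hw]; simp only [mul_assoc]
        _ = _ := by rw [mul_assoc, mul_assoc, hww', mul_one]
    have h3 := congrFun (congrFun h2 s) t
    simp only [Matrix.mul_apply, ← hxr, leftTranslate_apply] at h3
    simp only [Matrix.mul_apply, Matrix.map_apply, map_sum, Matrix.smul_apply, smul_eq_mul,
      ← Algebra.smul_def, ← Algebra.commutes (R := k) (A := H), map_smul]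
    rw [← h3]
    exact Finset.sum_congr rfl fun r _ => mul_comm _ _
  have hX : x.map L * (x.map (antipode k)).map L = 1 := by
    rw [← Matrix.map_mul, hx.mul_map_antipode, Matrix.map_one _ (map_zero L) (map_one L)]
  have h4 : x.map L * W' = W' * (L g) • x.map L := by
    have := congrArg (fun M => M.map L) h1
    simp only [Matrix.map_mul] at this
    convert this using 2
    · ext s t v; simp [W', L, Algebra.smul_def]
    · ext s t v; simp [W', L, Algebra.smul_def]
    · ext s t v; simp [L, mul_assoc]
  have h5 : x.map L * W' * (x.map (antipode k)).map L = W' * (L g) • (1 : Matrix (Fin (P.d i)) (Fin (P.d i)) (Module.End k H)) := by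
    rw [h4, mul_assoc, Matrix.smul_mul, hX]
  have h6 : LinearMap.trace k H (x.map L * W' * (x.map (antipode k)).map L).trace =
      LinearMap.trace k H W'.trace := by
    rw [LinearMap.trace_matrix_trace_mul_comm, ← mul_assoc]
    have hX' : (x.map (antipode k)).map L * x.map L = 1 := by
      rw [← Matrix.map_mul, hx.map_antipode_mul, Matrix.map_one _ (map_zero L) (map_one L)]
    rw [hX', one_mul]
  have hN : (Module.finrank k H : k) ≠ 0 := by
    have : 0 < Module.finrank k H := by
      have : Nontrivial H := ⟨⟨(g : H), 0, g.2.ne_zero⟩⟩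
      exact Module.finrank_pos
    exact Nat.cast_ne_zero.mpr this.ne'
  have h7 : LinearMap.trace k H W'.trace = w'.trace * Module.finrank k H := by
    simp only [Matrix.trace, Matrix.diag_apply, map_sum, W', Matrix.map_apply,
      Algebra.algebraMap_eq_smul_one, map_smul, LinearMap.trace_one, smul_eq_mul, Finset.sum_mul]
  have h8 : LinearMap.trace k H (W' * (L g) • (1 : Matrix (Fin (P.d i)) (Fin (P.d i)) (Module.End k H))).trace = 0 := by
    simp only [Matrix.trace, Matrix.diag_apply, map_sum]
    refine Finset.sum_eq_zero fun s _ => ?_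
    have : (W' * (L g) • (1 : Matrix (Fin (P.d i)) (Fin (P.d i)) (Module.End k H))) s s = w' s s • L g := by
      rw [Matrix.mul_apply, Finset.sum_eq_single s (fun r _ hr => by
        simp [Matrix.one_apply_ne hr]) (by simp)]
      ext v
      simp [W']
    rw [this, map_smul]
    change _ • LinearMap.trace k H (LinearMap.mulLeft k (g : H)) = 0
    rw [hg, smul_zero]
  rw [← h6, h5, h8] at h7
  exact (mul_eq_zero.mp h7.symm).resolve_right hN

/-- The degree of a character stable under a group-like element of prime order `p` is divisible
by `p`. -/
theorem dvd_of_act_eq [IsAlgClosed k] {p : ℕ} (hp : p.Prime) {g : GroupLike k H} (hgp : g ^ p = 1)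
    (hg1 : g ≠ 1) {i : Fin P.n} (hi : P.act g i = i) : p ∣ P.d i := by
  have : Fact p.Prime := ⟨hp⟩
  obtain ⟨u, hu⟩ := P.exists_conj (leftTranslate g) i (fun a => by rw [tr_leftTranslate, hi])
  have hpow : ∀ (v : Matrix (Fin (P.d i)) (Fin (P.d i)) k)
      (_ : ∀ a, P.rep i (leftTranslate g a) * v = v * P.rep i a) (m : ℕ) (a : ConvDual k H),
      P.rep i (leftTranslate (g ^ m) a) * v ^ m = v ^ m * P.rep i a := by
    intro v hv m
    induction m with
    | zero => intro a; rw [pow_zero, pow_zero, leftTranslate_one, one_mul, mul_one]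
    | succ m ih =>
      intro a
      rw [pow_succ g, ← leftTranslate_leftTranslate, pow_succ', ← mul_assoc, hv, mul_assoc, ih, mul_assoc]
  -- Schur's lemma: u^p intertwines the representation with itself because g^p = 1. Dividing u by a
  -- p-th root of the scalar gives v with v^p = 1.
  obtain ⟨c, hc⟩ := Matrix.mem_range_scalar_of_commute_single (M := (u : Matrix _ _ k) ^ p)
    (fun s t _ => by
      obtain ⟨a, ha⟩ := P.rep_surjective i (Matrix.single s t 1)
      have := hpow u hu p a
      rw [hgp, leftTranslate_one, ha] at this
      exact this)
  have hc0 : c ≠ 0 := by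
    rintro rfl
    have h1 : (↑(u ^ p) : Matrix (Fin (P.d i)) (Fin (P.d i)) k) = 0 := by
      rw [Units.val_pow_eq_pow_val, ← hc, map_zero]
    exact (u ^ p).ne_zero h1
  obtain ⟨z, hz⟩ := IsAlgClosed.exists_pow_nat_eq c hp.pos
  have hz0 : z ≠ 0 := by rintro rfl; rw [zero_pow hp.ne_zero] at hz; exact hc0 hz.symm
  set v : Matrix (Fin (P.d i)) (Fin (P.d i)) k := z⁻¹ • (u : Matrix _ _ k) with hv
  have hvp : v ^ p = 1 := by
    rw [hv, smul_pow, ← hc, inv_pow, hz, Matrix.scalar_apply, ← Matrix.smul_one_eq_diagonal,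
      smul_smul, inv_mul_cancel₀ hc0, one_smul]
  have hvv : ∀ a, P.rep i (leftTranslate g a) * v = v * P.rep i a := by
    intro a
    rw [hv, mul_smul_comm, hu, smul_mul_assoc]
  have hfin : p ∣ Module.finrank k (Fin (P.d i) → k) := by
    refine dvd_finrank_of_trace_pow hp.pos (T := Matrix.toLinAlgEquiv' v) (by
      rw [← map_pow, hvp, map_one]) (fun j hj hjp => ?_)
    rw [← map_pow]
    change LinearMap.trace k _ (Matrix.toLin' (v ^ j)) = 0
    rw [Matrix.trace_toLin'_eq]
    have hne : g ^ (p - j) ≠ 1 := by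
      intro h
      have h1 : orderOf g = p := orderOf_eq_prime hgp hg1
      have h2 := Nat.le_of_dvd (by omega) (orderOf_dvd_of_pow_eq_one h)
      omega
    -- The power v^j is inverse to v^(p-j), which intertwines the twist by g^(p-j) ≠ 1.
    refine P.trace_eq_zero_of_conj (g := g ^ (p - j)) (w := v ^ (p - j)) ?_ ?_ ?_
      (hpow v hvv (p - j))
    · exact GroupLikeTrace.trace_mulLeft_eq_zero (p := p) _ (by rw [← pow_mul, mul_comm, pow_mul,
        hgp, one_pow]) hne
    · rw [← pow_add, show j + (p - j) = p by omega, hvp]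
    · rw [← pow_add, show p - j + j = p by omega, hvp]
  simpa using hfin

end Stable

end SplitPresentation

/-! ### The regular character and tensor products -/

namespace ConvDual

section Hit

variable {k H : Type*} [Field k] [AddCommGroup H] [Module k H] [Coalgebra k H]

/-- The action of the dual algebra obtained by contracting the first tensor factor. -/
noncomputable def hit (a : ConvDual k H) : Module.End k H :=
  (TensorProduct.lid k H).toLinearMap ∘ₗ LinearMap.rTensor H a.ofConv ∘ₗ comul

lemma apply_hit (a c : ConvDual k H) (h : H) : c (hit a h) = (a * c) h := by
  rw [LinearMap.convMul_apply, hit]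
  simp only [LinearMap.comp_apply, LinearEquiv.coe_coe]
  generalize comul (R := k) h = z
  induction z with
  | zero => simp
  | add z w hz hw => simp only [map_add, hz, hw]
  | tmul u v => simp

/-- `hit a` is the transpose of left convolution by a. -/
lemma trace_hit [FiniteDimensional k H] (a : ConvDual k H) :
    LinearMap.trace k H (hit a) = LinearMap.trace k (ConvDual k H) (LinearMap.mulLeft k a) := by
  rw [← LinearMap.trace_transpose' (hit a),
    ← LinearMap.trace_conj' (LinearMap.mulLeft k a) (WithConv.linearEquiv k (H →ₗ[k] k))]
  congr 1
  ext c h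
  exact apply_hit a (WithConv.toConv c) h

end Hit

section MulRight

variable {k H : Type*} [Field k] [Ring H] [Algebra k H]

/-- Translation of a functional by right multiplication. -/
def comulRight (y : H) (a : ConvDual k H) : ConvDual k H :=
  WithConv.toConv (a.ofConv ∘ₗ LinearMap.mulRight k y)

lemma comulRight_apply (y : H) (a : ConvDual k H) (h : H) : comulRight y a h = a (h * y) := rfl

end MulRight

end ConvDual

namespace IsMultiplicative

open ConvDual

variable {k ι H : Type*} [Field k] [Fintype ι] [DecidableEq ι] [Ring H] [HopfAlgebra k H]
  {y : Matrix ι ι H}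

/-- The regular character absorbs other characters. -/
theorem sum_trace_hit [FiniteDimensional k H] (hy : IsMultiplicative k y) (a : ConvDual k H) :
    ∑ s, LinearMap.trace k H (hit (comulRight (y s s) a)) =
      Fintype.card ι * LinearMap.trace k H (hit a) := by
  -- Right multiplication by the entries of y is invertible through the antipode and intertwines the
  -- tensor product of the regular comodule with y and a direct sum of regular comodules.
  let B : Matrix ι ι (Module.End k H) := Matrix.of fun t s => LinearMap.mulRight k (y s t)
  let B' : Matrix ι ι (Module.End k H) :=
    Matrix.of fun t s => LinearMap.mulRight k (antipode k (y s t))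
  let O : Matrix ι ι (Module.End k H) := Matrix.of fun r s => hit (comulRight (y s r) a)
  let O' : Matrix ι ι (Module.End k H) := Matrix.of fun r s => if r = s then hit a else 0
  have hB : B * B' = 1 := by
    ext t s h
    simp only [B, B', Matrix.mul_apply, Matrix.of_apply, LinearMap.sum_apply,
      Module.End.mul_apply, LinearMap.mulRight_apply, mul_assoc, ← Finset.mul_sum]
    rw [HopfIntegral.sum_antipode_mul hy, Matrix.one_apply]
    simp only [eq_comm (a := s)]
    split_ifs <;> simp
  have hB' : B' * B = 1 := by
    ext t s h
    simp only [B, B', Matrix.mul_apply, Matrix.of_apply, LinearMap.sum_apply,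
      Module.End.mul_apply, LinearMap.mulRight_apply, mul_assoc, ← Finset.mul_sum]
    rw [HopfIntegral.sum_mul_antipode hy, Matrix.one_apply]
    simp only [eq_comm (a := s)]
    split_ifs <;> simp
  have hO : O' * B = B * O := by
    ext t s h
    simp only [O', O, B, Matrix.mul_apply, Matrix.of_apply, LinearMap.sum_apply, ite_mul, zero_mul,
      Finset.sum_ite_eq, Finset.mem_univ, if_true, Module.End.mul_apply, LinearMap.mulRight_apply]
    apply eq_of_forall_apply_eq (k := k)
    intro c
    have h1 : c (∑ r, hit (comulRight (y s r) a) h * y r t) =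
        ∑ r, (comulRight (y s r) a * comulRight (y r t) c) h := by
      rw [map_sum]
      refine Finset.sum_congr rfl fun r _ => ?_
      rw [← apply_hit]; rfl
    rw [h1, apply_hit]
    simp only [LinearMap.convMul_apply, Bialgebra.comul_mul, hy.comul]
    generalize Coalgebra.comul (R := k) h = z
    induction z with
    | zero => simp
    | add z w hz hw => simp only [map_add, add_mul, hz, hw, Finset.sum_add_distrib]
    | tmul u v => simp [Finset.mul_sum, comulRight]
  have h1 : LinearMap.trace k H O.trace = LinearMap.trace k H O'.trace := by
    rw [show O = B' * (O' * B) by rw [hO, ← mul_assoc, hB', one_mul],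
      LinearMap.trace_matrix_trace_mul_comm, mul_assoc, hB, mul_one]
  simpa [Matrix.trace, O, O', ← nsmul_eq_mul] using h1

/-- Decomposition of the character of a multiplicative matrix into irreducible characters. -/
theorem exists_trace_rep_eq [CharZero k] (P : SplitPresentation k (ConvDual k H))
    (hy : IsMultiplicative k y) : ∃ m : Fin P.n → ℕ,
      (∀ j, (m j : k) = (hy.rep (P.e j)).trace) ∧
      ∀ a, (hy.rep a).trace = ∑ j, (m j : k) * P.tr j a := by
  let ρ : ConvDual k H →ₐ[k] Module.End k (ι → k) :=
    (Matrix.toLinAlgEquiv' (R := k) (n := ι)).toAlgHom.comp hy.rep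
  have hρ : ∀ a, LinearMap.trace k (ι → k) (ρ a) = (hy.rep a).trace := fun a =>
    Matrix.trace_toLin'_eq _
  have h1 := fun a => (P.isTraceForm_trace ρ).eq_sum P a
  simp only [LinearMap.comp_apply, AlgHom.toLinearMap_apply, hρ] at h1
  refine ⟨fun j => Module.finrank k (LinearMap.range (ρ (P.e j))), fun j => ?_, fun a => ?_⟩
  · rw [← hρ, LinearMap.trace_eq_finrank_range ((P.e_idem j).map ρ)]
  · rw [h1]
    refine Finset.sum_congr rfl fun j _ => ?_
    rw [← hρ, LinearMap.trace_eq_finrank_range ((P.e_idem j).map ρ)]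

end IsMultiplicative

namespace SplitPresentation

open ConvDual

variable {k H : Type*} [Field k] [CharZero k] [Ring H] [HopfAlgebra k H] [FiniteDimensional k H]
  (P : SplitPresentation k (ConvDual k H))

/-- The multiplicative matrix of an irreducible representation. -/
noncomputable def coeff (i : Fin P.n) : Matrix (Fin (P.d i)) (Fin (P.d i)) H :=
  (P.exists_coeff i).choose

omit [CharZero k] in
lemma isMultiplicative_coeff (i : Fin P.n) : IsMultiplicative k (P.coeff i) :=
  (P.exists_coeff i).choose_spec.1

omit [CharZero k] in
lemma apply_coeff (i : Fin P.n) (a : ConvDual k H) (s t : Fin (P.d i)) :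
    a (P.coeff i s t) = P.rep i a s t := (P.exists_coeff i).choose_spec.2 a s t

section Tensor

variable {ι : Type*} [Fintype ι] [DecidableEq ι] {y : Matrix ι ι H} (hy : IsMultiplicative k y)

/-- The multiplicity of the `j`-th irreducible in the product of the `i`-th one with `y`. -/
noncomputable def tmult (i j : Fin P.n) : ℕ :=
  (((P.isMultiplicative_coeff i).kronecker hy).exists_trace_rep_eq P).choose j

lemma tmult_eq (i j : Fin P.n) : (P.tmult hy i j : k) =
    (((P.isMultiplicative_coeff i).kronecker hy).rep (P.e j)).trace :=
  (((P.isMultiplicative_coeff i).kronecker hy).exists_trace_rep_eq P).choose_spec.1 j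

lemma trace_kronecker (i : Fin P.n) (a : ConvDual k H) :
    (((P.isMultiplicative_coeff i).kronecker hy).rep a).trace =
      ∑ j, (P.tmult hy i j : k) * P.tr j a :=
  (((P.isMultiplicative_coeff i).kronecker hy).exists_trace_rep_eq P).choose_spec.2 a

omit [CharZero k] in
lemma trace_kronecker_eq_sum (i : Fin P.n) (a : ConvDual k H) :
    (((P.isMultiplicative_coeff i).kronecker hy).rep a).trace =
      ∑ s, P.tr i (comulRight (y s s) a) := by
  simp only [Matrix.trace, Matrix.diag_apply, IsMultiplicative.rep_apply, Matrix.of_apply,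
    Fintype.sum_prod_type, tr_apply]
  rw [Finset.sum_comm]
  refine Finset.sum_congr rfl fun s _ => Finset.sum_congr rfl fun t _ => ?_
  rw [← rep_apply, ← apply_coeff]
  rfl

/-- The multiplicities of the regular representation are an eigenvector for tensor products. -/
theorem sum_r_mul_tmult : ∑ i, P.r i * P.tmult hy i P.o = Fintype.card ι * P.r P.o := by
  have h := hy.sum_trace_hit (P.e P.o)
  simp only [trace_hit, P.trace_mulLeft] at h
  rw [Finset.sum_comm] at h
  simp only [← Finset.mul_sum, ← P.trace_kronecker_eq_sum hy, ← P.tmult_eq hy] at h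
  simp only [tr_e, mul_ite, mul_one, mul_zero, Finset.sum_ite_eq', Finset.mem_univ, if_true] at h
  exact_mod_cast h

end Tensor

/-- An irreducible tensored with its dual contains the trivial representation. -/
lemma one_le_tmult_dual (i : Fin P.n) :
    1 ≤ P.tmult (P.isMultiplicative_coeff i).antipode_transpose i P.o := by
  rw [Nat.one_le_iff_ne_zero]
  intro h0
  have hx := P.isMultiplicative_coeff i
  set ρ := (hx.kronecker hx.antipode_transpose).rep
  have h1 : (ρ (P.e P.o)).trace = 0 := by
    rw [← P.tmult_eq hx.antipode_transpose, h0, Nat.cast_zero]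
  have hidem : IsIdempotentElem (Matrix.toLin' (ρ (P.e P.o))) := by
    rw [IsIdempotentElem, Module.End.mul_eq_comp, ← Matrix.toLin'_mul, ← map_mul, (P.e_idem _).eq]
  rw [← Matrix.trace_toLin'_eq, LinearMap.trace_eq_finrank_range hidem, Nat.cast_eq_zero,
    Submodule.finrank_eq_zero, LinearMap.range_eq_bot] at h1
  -- The identity of End(V), viewed in V ⊗ V*, is an invariant vector because x S(x) = 1.
  let w : Fin (P.d i) × Fin (P.d i) → k := fun t => if t.1 = t.2 then 1 else 0
  have h2 := congrFun (LinearMap.congr_fun h1 w) (0, 0)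
  rw [Matrix.toLin'_apply, Matrix.mulVec, dotProduct] at h2
  simp only [ρ, IsMultiplicative.rep_apply, Matrix.of_apply, Matrix.transpose_apply,
    Matrix.map_apply, Fintype.sum_prod_type, w, mul_ite, mul_one, mul_zero, Finset.sum_ite_eq,
    Finset.mem_univ, if_true, ← map_sum, HopfIntegral.sum_mul_antipode hx,
    LinearMap.zero_apply, Pi.zero_apply] at h2
  rw [← P.tr_o, tr_e, if_pos rfl] at h2
  exact one_ne_zero h2

section Semisimple

lemma r_o_eq_sum {φ : ConvDual k H →ₗ[k] k} (hφ : ∀ a, (∀ b, φ (a * b) = 0) → a = 0)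
    (o : Fin P.n) : P.r o = ∑ j, P.c j o * P.d j := by
  obtain ⟨ν, hd, hc, -⟩ := P.exists_nakayama_perm hφ
  rw [r, ← Equiv.sum_comp ν]
  exact Finset.sum_congr rfl fun j _ => by rw [hd, ← hc]

/-- If the trivial representation is projective then the radical vanishes. -/
theorem J_eq_bot (h : ∀ z ∈ P.J, z * P.e P.o = 0) : P.J = ⊥ := by
  obtain ⟨-, φ, hφ⟩ := HopfIntegral.antipode_bijective_and_exists_frobenius k H
  have hz : ∀ z, z * P.e P.o = P.tr P.o z • P.e P.o := by
    intro z
    have h1 := h _ (mul_e_sub_mem_J P.d_o z)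
    rw [sub_mul, mul_assoc, smul_mul_assoc, (P.e_idem _).eq, sub_eq_zero] at h1
    exact h1
  have hc : ∀ i, P.c i P.o ≤ if i = P.o then 1 else 0 := by
    intro i
    have hle : LinearMap.range (sandwich (k := k) (P.e i) (P.e P.o)) ≤
        Submodule.span k {P.e i * P.e P.o} := by
      rintro _ ⟨z, rfl⟩
      rw [sandwich_apply, hz z, mul_smul_comm]
      exact Submodule.smul_mem _ _ (Submodule.mem_span_singleton_self _)
    have h2 : P.c i P.o ≤ Module.finrank k (Submodule.span k {P.e i * P.e P.o}) :=
      Submodule.finrank_mono hle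
    split_ifs with hi
    · exact h2.trans ((finrank_span_le_card _).trans (by simp))
    · rw [hz, tr_e, if_neg (Ne.symm hi), zero_smul] at h2
      rwa [Submodule.span_zero_singleton, finrank_bot] at h2
  have hro : P.r P.o ≤ 1 := by
    rw [P.r_o_eq_sum hφ]
    refine (Finset.sum_le_sum fun j _ => Nat.mul_le_mul_right (P.d j) (hc j)).trans ?_
    simp [P.d_o]
  -- A projective trivial module is a line, so r_o ≤ 1. Since i ⊗ i* contains o, the eigenvector
  -- equation gives r_i ≤ d_i r_o ≤ d_i; then dim A ≤ ∑ d_i² and the radical is 0.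
  have hr : ∀ i, P.r i ≤ P.d i := by
    intro i
    have h3 := P.sum_r_mul_tmult (P.isMultiplicative_coeff i).antipode_transpose
    have h4 := Finset.single_le_sum (f := fun j =>
      P.r j * P.tmult (P.isMultiplicative_coeff i).antipode_transpose j P.o)
      (fun _ _ => Nat.zero_le _) (Finset.mem_univ i)
    rw [h3, Fintype.card_fin] at h4
    calc P.r i ≤ _ := Nat.le_mul_of_pos_right _ (P.one_le_tmult_dual i)
      _ ≤ _ := h4
      _ ≤ P.d i * 1 := Nat.mul_le_mul_left _ hro
      _ = _ := mul_one _
  have hdim : Module.finrank k (ConvDual k H) ≤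
      Module.finrank k ((i : Fin P.n) → Matrix (Fin (P.d i)) (Fin (P.d i)) k) := by
    rw [P.finrank_eq, Module.finrank_pi_fintype]
    refine Finset.sum_le_sum fun i _ => ?_
    rw [Module.finrank_matrix]
    simp only [Fintype.card_fin, Module.finrank_self, mul_one]
    exact Nat.mul_le_mul_left _ (hr i)
  have hinj : Function.Injective P.q.toLinearMap :=
    (LinearMap.injective_iff_surjective_of_finrank_eq_finrank (le_antisymm hdim
      (LinearMap.finrank_le_finrank_of_surjective (f := P.q.toLinearMap) P.q_surjective))).mpr
      P.q_surjective
  exact LinearMap.ker_eq_bot.mpr hinj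

end Semisimple

end SplitPresentation

/-! ### The coradical, and skew-primitives as extensions of linear characters -/

namespace SplitPresentation

open ConvDual

section Subcoalgebra

variable {k H : Type*} [Field k] [AddCommGroup H] [Module k H] [Coalgebra k H]

lemma mul_apply_eq_zero_left {E : Submodule k H} (hE : IsSubcoalgebra k E) {a : ConvDual k H}
    (ha : ∀ x ∈ E, a x = 0) (b : ConvDual k H) : ∀ x ∈ E, (a * b) x = 0 := by
  intro x hx
  obtain ⟨z, hz⟩ := hE x hx
  rw [LinearMap.convMul_apply, ← hz]
  clear hz
  induction z with
  | zero => simp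
  | tmul u v => simp [ha u.1 u.2]
  | add z w hz hw => simp only [map_add, hz, hw, add_zero]

lemma mul_apply_eq_zero_right {E : Submodule k H} (hE : IsSubcoalgebra k E) {a : ConvDual k H}
    (ha : ∀ x ∈ E, a x = 0) (b : ConvDual k H) : ∀ x ∈ E, (b * a) x = 0 := by
  intro x hx
  obtain ⟨z, hz⟩ := hE x hx
  rw [LinearMap.convMul_apply, ← hz]
  clear hz
  induction z with
  | zero => simp
  | tmul u v => simp [ha v.1 v.2]
  | add z w hz hw => simp only [map_add, hz, hw, add_zero]

end Subcoalgebra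

variable {k H : Type*} [Field k] [Ring H] [HopfAlgebra k H] [FiniteDimensional k H]
  (P : SplitPresentation k (ConvDual k H))

/-- The span of the matrix coefficients of an irreducible representation. -/
noncomputable def coeffSpan (i : Fin P.n) : Submodule k H :=
  Submodule.span k (Set.range fun st : Fin (P.d i) × Fin (P.d i) => P.coeff i st.1 st.2)

lemma coeff_mem_coeffSpan (i : Fin P.n) (s t : Fin (P.d i)) : P.coeff i s t ∈ P.coeffSpan i :=
  Submodule.subset_span ⟨(s, t), rfl⟩

lemma apply_eq_zero_of_rep {i : Fin P.n} {a : ConvDual k H} (ha : P.rep i a = 0) :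
    ∀ x ∈ P.coeffSpan i, a x = 0 := by
  intro x hx
  induction hx using Submodule.span_induction with
  | mem x hx =>
    obtain ⟨⟨s, t⟩, rfl⟩ := hx
    rw [apply_coeff, ha]; rfl
  | zero => exact map_zero _
  | add x y _ _ hx hy => rw [map_add, hx, hy, add_zero]
  | smul c x _ hx => rw [map_smul, hx, smul_zero]

lemma isSubcoalgebra_coeffSpan (i : Fin P.n) : IsSubcoalgebra k (P.coeffSpan i) := by
  intro x hx
  induction hx using Submodule.span_induction with
  | mem x hx =>
    obtain ⟨⟨s, t⟩, rfl⟩ := hx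
    simp only [(P.isMultiplicative_coeff i).comul]
    refine Submodule.sum_mem _ fun r _ => ?_
    exact ⟨(⟨_, P.coeff_mem_coeffSpan i s r⟩ : P.coeffSpan i) ⊗ₜ
      (⟨_, P.coeff_mem_coeffSpan i r t⟩ : P.coeffSpan i), rfl⟩
  | zero => rw [map_zero]; exact zero_mem _
  | add x y _ _ hx hy => rw [map_add]; exact add_mem hx hy
  | smul c x _ hx => rw [map_smul]; exact Submodule.smul_mem _ _ hx

/-- This is dual to the simplicity of a matrix block. A functional that vanishes on a proper
subcoalgebra E but is nonzero in the block generates, under two-sided convolution, functionals that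
vanish on E and represent all matrix units; hence E = 0. -/
lemma isSimpleSubcoalgebra_coeffSpan (i : Fin P.n) :
    IsSimpleSubcoalgebra k (P.coeffSpan i) where
  isSubcoalgebra := P.isSubcoalgebra_coeffSpan i
  ne_bot h := by
    have h1 := P.coeff_mem_coeffSpan i 0 0
    rw [h, Submodule.mem_bot] at h1
    have h2 := (P.isMultiplicative_coeff i).counit 0 0
    rw [h1, map_zero, Matrix.one_apply_eq] at h2
    exact zero_ne_one h2
  eq_bot_or_eq E hE hEi := by
    by_contra! hcon
    obtain ⟨hE0, hEne⟩ := hcon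
    obtain ⟨x, hx, hxE⟩ := SetLike.exists_of_lt (lt_of_le_of_ne hEi hEne)
    obtain ⟨f, hfx, hf⟩ := Submodule.exists_le_ker_of_notMem hxE
    set a : ConvDual k H := WithConv.toConv f
    have ha : ∀ y ∈ E, a y = 0 := fun y hy => hf hy
    have hM : P.rep i a ≠ 0 := fun h => hfx (P.apply_eq_zero_of_rep h x hx)
    obtain ⟨s, t, hst⟩ : ∃ s t, P.rep i a s t ≠ 0 := by
      by_contra! hcon
      exact hM (Matrix.ext hcon)
    have hunit : ∀ u v, ∃ b : ConvDual k H, P.rep i b = Matrix.single u v 1 ∧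
        ∀ y ∈ E, b y = 0 := by
      intro u v
      obtain ⟨c, hc⟩ := P.rep_surjective i (Matrix.single u s ((P.rep i a s t)⁻¹))
      obtain ⟨c', hc'⟩ := P.rep_surjective i (Matrix.single t v 1)
      refine ⟨c * a * c', ?_, mul_apply_eq_zero_left hE (mul_apply_eq_zero_right hE ha c) c'⟩
      rw [map_mul, map_mul, hc, hc', Matrix.single_mul_mul_single, inv_mul_cancel₀ hst, one_mul]
    choose b hb hbE using hunit
    apply hE0
    rw [eq_bot_iff]
    intro y hy
    rw [Submodule.mem_bot]
    apply eq_of_forall_apply_eq (k := k)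
    intro c
    rw [map_zero]
    have h1 : P.rep i (c - ∑ u, ∑ v, P.rep i c u v • b u v) = 0 := by
      simp only [map_sub, map_sum, map_smul, hb, Matrix.smul_single, smul_eq_mul, mul_one]
      rw [← Matrix.matrix_eq_sum_single, sub_self]
    have h2 := P.apply_eq_zero_of_rep h1 y (hEi hy)
    rw [ConvDual.sub_apply, sub_eq_zero] at h2
    rw [h2]
    change eval y _ = 0
    simp [hbE _ _ y hy]

/-- A coalgebra whose dual algebra has no radical is cosemisimple. -/
theorem isCosemisimple_of_J_eq_bot (hJ : P.J = ⊥) : IsCosemisimple k H := by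
  rw [IsCosemisimple]
  by_contra hne
  obtain ⟨f, hf0, hf⟩ := Submodule.exists_le_ker_of_lt_top _ (lt_top_iff_ne_top.mpr hne)
  apply hf0
  have h1 : (WithConv.toConv f : ConvDual k H) ∈ P.J := by
    rw [mem_J]
    funext i
    ext s t
    change P.rep i _ s t = 0
    rw [← apply_coeff]
    exact hf ((le_sSup (P.isSimpleSubcoalgebra_coeffSpan i) : P.coeffSpan i ≤ coradical k H)
      (P.coeff_mem_coeffSpan i s t))
  rw [hJ, Submodule.mem_bot] at h1
  exact congrArg WithConv.ofConv h1

/-- For a non-cosemisimple Hopf algebra the trivial representation of the dual is not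
projective. -/
theorem exists_mul_e_ne_zero [CharZero k] (hH : ¬ IsCosemisimple k H) :
    ∃ z ∈ P.J, z * P.e P.o ≠ 0 := by
  by_contra! h
  exact hH (P.isCosemisimple_of_J_eq_bot (P.J_eq_bot h))

omit [FiniteDimensional k H] in
lemma sub_sum_e_mem_J {ε : ConvDual k H} (hqε : P.q ε = fun i => if P.d i = 1 then 1 else 0) :
    ε - ∑ i, (if P.d i = 1 then P.e i else 0) ∈ P.J := by
  rw [mem_J, map_sub, hqε, map_sum, sub_eq_zero]
  funext j
  rw [Finset.sum_apply, Finset.sum_eq_single j (fun i _ hij => by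
    split_ifs
    · rw [q_e, Pi.single_eq_of_ne hij.symm]
    · rw [map_zero]; rfl) (by simp)]
  split_ifs with h
  · rw [q_e, Pi.single_eq_same, single_one_of_linear h]
  · rw [map_zero]; rfl

section Extensions

variable [CharZero k] (hNSP : ∀ x : H, ¬ IsNontrivialSkewPrimitive k x)
include hNSP

/-- A functional f that vanishes on J² but not on e_i z e_j produces an element x of H with Δ(x) = g
⊗ x + x ⊗ h, where g, h are the group-likes of i, j. Were x a multiple of g - h, z would vanish on
it, since z is in J; but z(x) = f(e_i z e_j) ≠ 0. -/
lemma e_mul_e_mem {i j : Fin P.n} (hi : P.d i = 1) (hj : P.d j = 1) {z : ConvDual k H}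
    (hz : z ∈ P.J) : P.e i * z * P.e j ∈ P.J * P.J := by
  by_contra hne
  obtain ⟨f, hfz, hf⟩ := Submodule.exists_le_ker_of_notMem hne
  have hf0 : ∀ y ∈ P.J * P.J, f y = 0 := fun y hy => hf hy
  obtain ⟨g, rfl⟩ := P.exists_groupLike hi
  obtain ⟨h, rfl⟩ := P.exists_groupLike hj
  set i := P.act g P.o
  set j := P.act h P.o
  -- The correction term f(e_i e_j) tr_i makes the functional a derivation between the characters i
  -- and j.
  obtain ⟨x, hx⟩ := exists_forall_apply_eq (f ∘ₗ LinearMap.mulLeft k (P.e i) ∘ₗ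
    LinearMap.mulRight k (P.e j) - f (P.e i * P.e j) • P.tr i)
  have hx' : ∀ a : ConvDual k H, a x = f (P.e i * a * P.e j) - f (P.e i * P.e j) * P.tr i a := by
    intro a
    rw [hx]
    simp [mul_assoc]
  have hder : ∀ a b : ConvDual k H, (a * b) x = P.tr i a * b x + a x * P.tr j b := by
    intro a b
    have h1 : f ((P.e i * a - P.tr i a • P.e i) * (b * P.e j - P.tr j b • P.e j)) = 0 :=
      hf0 _ (P.mul_mem_JJ (e_mul_sub_mem_J hi a) (mul_e_sub_mem_J hj b))
    have h2 : (P.e i * a - P.tr i a • P.e i) * (b * P.e j - P.tr j b • P.e j) =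
        P.e i * (a * b) * P.e j - P.tr j b • (P.e i * a * P.e j) - P.tr i a • (P.e i * b * P.e j)
          + (P.tr i a * P.tr j b) • (P.e i * P.e j) := by
      simp only [sub_mul, mul_sub, smul_mul_assoc, mul_smul_comm, mul_assoc, smul_smul, smul_sub,
        mul_comm (P.tr j b)]
      abel
    rw [h2] at h1
    simp only [map_add, map_sub, map_smul, smul_eq_mul] at h1
    rw [hx', hx', hx', tr_mul_of_linear hi]
    linear_combination h1
  have hcomul : comul (R := k) x = (g : H) ⊗ₜ[k] x + x ⊗ₜ[k] (h : H) := by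
    have := comul_eq_of_mul_apply (k := k) (ι := Fin 2) (h := x) (u := ![(g : H), x])
      (v := ![x, (h : H)]) (fun a b => by
        rw [hder, Fin.sum_univ_two]
        simp [i, j, tr_act_o])
    simpa [Fin.sum_univ_two] using this
  have hspan : x ∈ Submodule.span k {(g : H) - h} := by
    by_contra hns
    exact hNSP x ⟨g, h, g.2, h.2, hcomul, hns⟩
  obtain ⟨c, rfl⟩ := Submodule.mem_span_singleton.mp hspan
  have hzx := hx' z
  rw [map_smul, map_sub, ← tr_act_o, ← tr_act_o, (P.isTraceForm_tr _).nil z hz,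
    (P.isTraceForm_tr _).nil z hz] at hzx
  apply hfz
  simpa using hzx.symm

/-- Without nontrivial skew-primitives there are no extensions between linear characters. -/
theorem linear_mul_linear_mem {ε : ConvDual k H}
    (hqε : P.q ε = fun i => if P.d i = 1 then 1 else 0) {z : ConvDual k H} (hz : z ∈ P.J) :
    ε * z * ε ∈ P.J * P.J := by
  have hδ := P.sub_sum_e_mem_J hqε
  set s : ConvDual k H := ∑ i, if P.d i = 1 then P.e i else 0 with hs
  have h1 : s * z * s ∈ P.J * P.J := by
    rw [hs, Finset.sum_mul, Finset.sum_mul_sum]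
    refine Submodule.sum_mem _ fun i _ => Submodule.sum_mem _ fun j _ => ?_
    split_ifs with hi hj
    · exact P.e_mul_e_mem hNSP hi hj hz
    · rw [mul_zero]; exact zero_mem _
    · rw [zero_mul, zero_mul]; exact zero_mem _
    · rw [mul_zero]; exact zero_mem _
  have h2 : ε * z * ε = (ε - s) * (z * ε) + (s * z) * (ε - s) + s * z * s := by
    simp only [sub_mul, mul_sub, mul_assoc]
    abel
  rw [h2]
  exact add_mem (add_mem (P.mul_mem_JJ hδ (P.mul_mem_J_right _ hz))
    (P.mul_mem_JJ (P.mul_mem_J_left _ hz) hδ)) h1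

end Extensions

end SplitPresentation

/-! ### The tensor product of an irreducible with its dual -/

namespace ConvDual

variable {k H : Type*} [Field k] [Ring H] [HopfAlgebra k H] [FiniteDimensional k H]

/-- Composition with the antipode. -/
noncomputable def antipodeDual (k H : Type*) [Field k] [Ring H] [HopfAlgebra k H]
    [FiniteDimensional k H] : ConvDual k H ≃ₗ[k] ConvDual k H :=
  (WithConv.linearEquiv k (H →ₗ[k] k)).trans
    ((LinearEquiv.ofBijective (antipode k (A := H))
      (HopfIntegral.antipode_bijective_and_exists_frobenius k H).1).dualMap.trans
    (WithConv.linearEquiv k (H →ₗ[k] k)).symm)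

lemma antipodeDual_apply (a : ConvDual k H) (h : H) : antipodeDual k H a h = a (antipode k h) := rfl

lemma antipodeDual_one : antipodeDual k H 1 = 1 :=
  ext_apply fun h => by
    rw [antipodeDual_apply, ConvDual.one_apply, ConvDual.one_apply, counit_antipode]

lemma antipodeDual_mul (a b : ConvDual k H) :
    antipodeDual k H (a * b) = antipodeDual k H b * antipodeDual k H a := by
  obtain ⟨x, hx, hb⟩ := IsMultiplicative.exists_regular (Module.finBasis k H)
  refine ext_apply fun h => ?_
  refine HopfIntegral.forall_of_coeff hb (p := fun h => antipodeDual k H (a * b) h =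
    (antipodeDual k H b * antipodeDual k H a) h) ?_ (fun u v hu hv => ?_) (fun c u hu => ?_)
    (fun i j => ?_) h
  · rw [map_zero, map_zero]
  · rw [map_add, map_add, hu, hv]
  · rw [map_smul, map_smul, hu]
  · have h1 := hx.antipode_transpose.comul j i
    simp only [Matrix.transpose_apply, Matrix.map_apply] at h1
    rw [antipodeDual_apply, mul_apply_of_comul h1, mul_apply_of_comul (hx.comul i j)]
    exact Finset.sum_congr rfl fun r _ => mul_comm _ _

end ConvDual

lemma Matrix.eq_zero_of_isIdempotentElem_of_trace {k ι : Type*} [Field k] [CharZero k] [Fintype ι]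
    [DecidableEq ι] {M : Matrix ι ι k} (hM : IsIdempotentElem M) (h : M.trace = 0) : M = 0 := by
  have h1 : IsIdempotentElem (Matrix.toLin' M) := by
    rw [IsIdempotentElem, Module.End.mul_eq_comp, ← Matrix.toLin'_mul, hM.eq]
  rw [← Matrix.trace_toLin'_eq, LinearMap.trace_eq_finrank_range h1, Nat.cast_eq_zero,
    Submodule.finrank_eq_zero, LinearMap.range_eq_bot] at h
  exact (LinearEquiv.map_eq_zero_iff Matrix.toLin').mp h

namespace SplitPresentation

open ConvDual

variable {k H : Type*} [Field k] [CharZero k] [Ring H] [HopfAlgebra k H] [FiniteDimensional k H]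
  (P : SplitPresentation k (ConvDual k H))

omit [FiniteDimensional k H] in
lemma act_o_injective {g h : GroupLike k H} (e : P.act g P.o = P.act h P.o) : g = h := by
  apply GroupLike.val_injective
  apply eq_of_forall_apply_eq (k := k)
  intro a
  rw [← P.tr_act_o, ← P.tr_act_o, e]

/-- The sum of the translates of e_o detects all linear characters at once, since G acts simply
transitively on them. -/
lemma sum_tr_leftTranslate_e_o [Fintype (GroupLike k H)] (j : Fin P.n) :
    ∑ g : GroupLike k H, P.tr j (leftTranslate g (P.e P.o)) = if P.d j = 1 then 1 else 0 := by
  simp only [tr_leftTranslate, tr_e]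
  split_ifs with h
  · obtain ⟨l, rfl⟩ := P.exists_groupLike h
    rw [Finset.sum_eq_single l⁻¹ (fun g _ hg => if_neg fun e => hg ?_) (by simp),
      ← act_mul, inv_mul_cancel, act_one, if_pos rfl]
    rw [← act_mul] at e
    exact eq_inv_of_mul_eq_one_left (P.act_o_injective (e.trans (P.act_one _).symm))
  · refine Finset.sum_eq_zero fun g _ => if_neg fun e => h ?_
    rw [← P.d_act g, e, d_o]

omit [CharZero k] [FiniteDimensional k H] in
/-- A representation that identifies an idempotent `ε` lifting the linear block with the identity
kills the radical. -/
lemma map_eq_zero_of_map_eq_one {B : Type*} [Ring B] [Algebra k B] (ρ : ConvDual k H →ₐ[k] B)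
    {ε : ConvDual k H} (hε : ∀ z ∈ P.J, ε * z * ε ∈ P.J * P.J) (h1 : ρ ε = 1) {z : ConvDual k H}
    (hz : z ∈ P.J) : ρ z = 0 := by
  -- With ρ(ε) = 1, the image of J is contained in its own square, hence in all its powers, and is
  -- therefore 0.
  have hM : P.J.map ρ.toLinearMap ≤ P.J.map ρ.toLinearMap * P.J.map ρ.toLinearMap := by
    rw [← Submodule.map_mul]
    rintro _ ⟨z, hz, rfl⟩
    exact ⟨ε * z * ε, hε z hz, by simp [h1]⟩
  have hpow : ∀ m : ℕ, P.J.map ρ.toLinearMap ≤ (P.J.map ρ.toLinearMap) ^ (m + 1) := by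
    intro m
    induction m with
    | zero => rw [zero_add, pow_one]
    | succ m ih =>
      refine hM.trans ?_
      rw [pow_succ]
      exact mul_le_mul' ih le_rfl
  obtain ⟨m, hm⟩ := P.exists_pow_J_eq_zero
  have h2 : P.J ^ (m + 1) = ⊥ := by
    rw [pow_succ, (Submodule.eq_bot_iff _).mpr hm, Submodule.bot_mul]
  have h3 := hpow m (Submodule.mem_map_of_mem hz)
  rw [← Submodule.map_pow, h2, Submodule.map_bot, Submodule.mem_bot] at h3
  exact h3

section Square

variable (S : Fin P.n)

/-- The representation on the tensor product of an irreducible with its dual. -/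
noncomputable abbrev endRep : ConvDual k H →ₐ[k]
    Matrix (Fin (P.d S) × Fin (P.d S)) (Fin (P.d S) × Fin (P.d S)) k :=
  ((P.isMultiplicative_coeff S).kronecker (P.isMultiplicative_coeff S).antipode_transpose).rep

variable {S}

omit [CharZero k] in
/-- Semi-invariant vectors in the tensor product of an irreducible with its dual. -/
lemma rep_mul_eq_of_endRep (g : GroupLike k H) {w : Matrix (Fin (P.d S)) (Fin (P.d S)) k}
    (hw : ∀ (a : ConvDual k H) (s u : Fin (P.d S)), ∑ p, P.endRep S a (s, u) p * w p.1 p.2 =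
      a (g : H) * w s u) (a : ConvDual k H) :
    P.rep S a * w = w * P.rep S (leftTranslate g a) := by
  have hx := P.isMultiplicative_coeff S
  set x := P.coeff S
  have h1 : ∀ s u, ∑ t, ∑ v, w t v • (x s t * antipode k (x v u)) = w s u • (g : H) := by
    intro s u
    apply eq_of_forall_apply_eq (k := k)
    intro a
    have := hw a s u
    simp only [map_sum, map_smul, smul_eq_mul]
    rw [mul_comm, ← this, Fintype.sum_prod_type]
    exact Finset.sum_congr rfl fun t _ => Finset.sum_congr rfl fun v _ => mul_comm _ _
  have h2 : ∀ s r, ∑ t, w t r • x s t = ∑ u, w s u • ((g : H) * x u r) := by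
    intro s r
    have h3 : ∑ u, (∑ t, ∑ v, w t v • (x s t * antipode k (x v u))) * x u r =
        ∑ t, w t r • x s t := by
      simp only [Finset.sum_mul, smul_mul_assoc, mul_assoc]
      rw [Finset.sum_comm]
      refine Finset.sum_congr rfl fun t _ => ?_
      rw [Finset.sum_comm]
      simp only [← Finset.smul_sum, ← Finset.mul_sum, HopfIntegral.sum_antipode_mul hx]
      simp
    rw [← h3]
    simp only [h1, smul_mul_assoc]
  ext s r
  have h4 := congrArg (fun h => a h) (h2 s r)
  simp only [map_sum, map_smul, smul_eq_mul, ← leftTranslate_apply] at h4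
  rw [Matrix.mul_apply, Matrix.mul_apply]
  simp only [x, apply_coeff] at h4
  rw [← h4]
  exact Finset.sum_congr rfl fun t _ => mul_comm _ _

/-- If an irreducible `S` has trivial stabilizer then its endomorphism comodule is not a sum of
linear characters. -/
lemma endRep_linear_ne_one {ε : ConvDual k H} (hNE : ∀ z ∈ P.J, ε * z * ε ∈ P.J * P.J)
    (hqε : P.q ε = fun i => if P.d i = 1 then 1 else 0) (hd : P.d S ≠ 1)
    (hfree : ∀ g, P.act g S = S → g = 1) : P.endRep S ε ≠ 1 := by
  intro h1
  set ρ := P.endRep S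
  have hJ : ∀ z ∈ P.J, ρ z = 0 := fun z hz => P.map_eq_zero_of_map_eq_one ρ hNE h1 hz
  have heig : ∀ {i : Fin P.n}, P.d i = 1 → ∀ a, ρ a * ρ (P.e i) = P.tr i a • ρ (P.e i) := by
    intro i hi a
    have := hJ _ (mul_e_sub_mem_J hi a)
    rwa [map_sub, sub_eq_zero, map_mul, map_smul] at this
  -- The columns of ρ(e_g) are semi-invariant vectors, that is, intertwiners between S and its
  -- translate by g. By freeness they vanish for g ≠ 1.
  have hcol : ∀ (g : GroupLike k H) (q : Fin (P.d S) × Fin (P.d S)) (a : ConvDual k H),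
      P.rep S a * Matrix.of (fun t v => ρ (P.e (P.act g P.o)) (t, v) q) =
        Matrix.of (fun t v => ρ (P.e (P.act g P.o)) (t, v) q) * P.rep S (leftTranslate g a) := by
    intro g q a
    refine P.rep_mul_eq_of_endRep g (fun a s u => ?_) a
    have h2 := congrFun (congrFun (heig (i := P.act g P.o) (by rw [d_act, d_o]) a) (s, u)) q
    rw [tr_act_o, Matrix.mul_apply] at h2
    exact h2
  have hzero : ∀ {i}, P.d i = 1 → i ≠ P.o → ρ (P.e i) = 0 := by
    intro i hi hio
    obtain ⟨g, rfl⟩ := P.exists_groupLike hi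
    have hg : P.act g S ≠ S := fun e => hio (by rw [hfree g e, act_one])
    obtain ⟨a, ha, ha'⟩ := P.exists_rep_eq S 1
    have h2 : P.rep S (leftTranslate g a) = 0 :=
      P.rep_eq_zero_of_tr (P.tr_leftTranslate g S) (ha' _ hg)
    ext ⟨t, v⟩ q
    have h3 := hcol g q a
    rw [ha, h2, one_mul, mul_zero] at h3
    exact congrFun (congrFun h3 t) v
  have hone : ρ (P.e P.o) = 1 := by
    have h2 := hJ _ (P.sub_sum_e_mem_J hqε)
    rw [map_sub, h1, map_sum, Finset.sum_eq_single P.o (fun i _ hi => by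
      split_ifs with h
      · exact hzero h hi
      · exact map_zero _) (by simp), if_pos P.d_o, sub_eq_zero] at h2
    exact h2.symm
  have h0 : 0 < P.d S := Nat.pos_of_ne_zero (NeZero.ne _)
  let u : Fin (P.d S) := ⟨0, by omega⟩
  let v : Fin (P.d S) := ⟨1, by omega⟩
  have huv : u ≠ v := by simp [u, v]
  -- Now S ⊗ S* is trivial, so every matrix commutes with the image of S; the units E_uv and E_uu do
  -- not.
  obtain ⟨a, ha⟩ := P.rep_surjective S (Matrix.single u u 1)
  have h2 := congrFun (congrFun (hcol 1 (u, v) a) u) v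
  rw [leftTranslate_one, act_one, hone, ha, Matrix.mul_apply, Matrix.mul_apply,
    Finset.sum_eq_single u (fun j _ hj => by simp [hj.symm]) (by simp),
    Finset.sum_eq_zero (fun j _ => by simp [huv])] at h2
  simp at h2

end Square

/-- The multiplicities of the trivial representation in products with the dual of a
two-dimensional irreducible with trivial stabilizer. -/
theorem exists_tensor_multiplicities [Fintype (GroupLike k H)] {ε : ConvDual k H}
    (hε : IsIdempotentElem ε) (hqε : P.q ε = fun i => if P.d i = 1 then 1 else 0)
    (hNE : ∀ z ∈ P.J, ε * z * ε ∈ P.J * P.J) {S : Fin P.n} (hS : P.d S = 2)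
    (hfree : ∀ g, P.act g S = S → g = 1) (h3 : ∀ i, P.d i ≠ 3) :
    ∃ m : Fin P.n → ℕ, (∀ i, P.d i = 1 → m i = 0) ∧ ∑ g, m (P.act g S) = 2 ∧
      2 * P.r P.o = ∑ i, P.r i * m i := by
  have hx := P.isMultiplicative_coeff S
  have hy := hx.antipode_transpose
  refine ⟨fun i => P.tmult hy i P.o, fun i hi => ?_, ?_, ?_⟩
  -- A linear character tensored with S* is irreducible of degree 2, so it does not contain o.
  · obtain ⟨π, hπ, hπd⟩ := P.exists_perm (antipodeDual k H) antipodeDual_one (Or.inr antipodeDual_mul)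
    obtain ⟨h, rfl⟩ := P.exists_groupLike hi
    have h1 : (P.tmult hy (P.act h P.o) P.o : k) = 0 := by
      rw [tmult_eq, P.trace_kronecker_eq_sum hy]
      calc _ = P.tr S (antipodeDual k H (leftTranslate h (P.e P.o))) := by
            rw [← trace_rep, Matrix.trace]
            refine Finset.sum_congr rfl fun s _ => ?_
            rw [tr_act_o, Matrix.diag_apply, ← apply_coeff]
            rfl
        _ = 0 := by
            rw [hπ, tr_leftTranslate, tr_e, if_neg]
            intro e
            have := P.d_act h (π S)
            rw [e, hπd, hS, d_o] at this
            omega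
    exact_mod_cast h1
  · set n := P.tmult hy S
    have htr : ∀ a, (P.endRep S a).trace = ∑ j, (n j : k) * P.tr j a := P.trace_kronecker hy S
    -- The trivial character occurs in g S ⊗ S* as often as the linear character of g⁻¹ occurs in S
    -- ⊗ S*.
    have h1 : ∑ g, P.tmult hy (P.act g S) P.o = ∑ j, if P.d j = 1 then n j else 0 := by
      have : ((∑ g, P.tmult hy (P.act g S) P.o : ℕ) : k) =
          ((∑ j, if P.d j = 1 then n j else 0 : ℕ) : k) := by
        calc _ = ∑ g : GroupLike k H, (P.endRep S (leftTranslate g (P.e P.o))).trace := by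
              rw [Nat.cast_sum]
              refine Finset.sum_congr rfl fun g _ => ?_
              rw [tmult_eq, P.trace_kronecker_eq_sum hy]
              refine Eq.trans ?_ (P.trace_kronecker_eq_sum hy S _).symm
              refine Finset.sum_congr rfl fun s _ => ?_
              rw [← tr_leftTranslate]
              congr 1
              refine ext_apply fun h => ?_
              simp only [leftTranslate_apply, comulRight_apply, mul_assoc]
          _ = _ := by
              simp only [htr]
              rw [Finset.sum_comm]
              simp only [← Finset.mul_sum, sum_tr_leftTranslate_e_o]
              push_cast
              exact Finset.sum_congr rfl fun j _ => by split_ifs <;> simp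
      exact_mod_cast this
    rw [h1]
    have h4 : ∑ j, n j * P.d j = 4 := by
      have := htr 1
      rw [map_one, Matrix.trace_one] at this
      simp only [tr_one, Fintype.card_prod, Fintype.card_fin, hS] at this
      have h : ((2 * 2 : ℕ) : k) = ((∑ j, n j * P.d j : ℕ) : k) := by
        rw [this]; push_cast; rfl
      exact_mod_cast h.symm
    have hsplit : ∑ j, n j * P.d j =
        (∑ j, if P.d j = 1 then n j else 0) + ∑ j, if P.d j = 1 then 0 else n j * P.d j := by
      rw [← Finset.sum_add_distrib]
      exact Finset.sum_congr rfl fun j _ => by split_ifs with h <;> simp [h]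
    have hl1 : 1 ≤ ∑ j, if P.d j = 1 then n j else 0 := by
      have := Finset.single_le_sum (f := fun j => if P.d j = 1 then n j else 0)
        (fun _ _ => Nat.zero_le _) (Finset.mem_univ P.o)
      rw [if_pos P.d_o] at this
      exact (P.one_le_tmult_dual S).trans this
    have heven : 2 ∣ ∑ j, if P.d j = 1 then 0 else n j * P.d j := by
      refine Finset.dvd_sum fun j _ => ?_
      have hle := Finset.single_le_sum (f := fun j => if P.d j = 1 then 0 else n j * P.d j)
        (fun _ _ => Nat.zero_le _) (Finset.mem_univ j)
      split_ifs at hle ⊢ with h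
      · exact dvd_zero _
      · have hd0 : P.d j ≠ 0 := NeZero.ne _
        have hd3 := h3 j
        rcases Nat.eq_zero_or_pos (n j) with h0 | h0
        · rw [h0, zero_mul]; exact dvd_zero _
        · have h5 : P.d j ≤ n j * P.d j := Nat.le_mul_of_pos_left _ h0
          have h6 : P.d j = 2 := by omega
          rw [h6]; exact Dvd.intro_left _ rfl
    have hne4 : (∑ j, if P.d j = 1 then n j else 0) ≠ 4 := by
      intro h
      refine P.endRep_linear_ne_one hNE hqε (by omega) hfree ?_
      rw [← sub_eq_zero, ← neg_sub, neg_eq_zero]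
      refine Matrix.eq_zero_of_isIdempotentElem_of_trace (hε.map (P.endRep S)).one_sub ?_
      rw [Matrix.trace_sub, htr, Matrix.trace_one, Fintype.card_prod, Fintype.card_fin, hS, sub_eq_zero]
      simp only [tr_linear_idempotent hqε, mul_ite, mul_one, mul_zero]
      have h7 : ((∑ j, if P.d j = 1 then n j else 0 : ℕ) : k) = ((4 : ℕ) : k) := by rw [h]
      push_cast at h7 ⊢
      rw [h7]
    -- The degree 4 splits into a linear part and an even nonlinear part. The linear part is at
    -- least 1 and is not 4, so it equals 2.
    omega
  · have := P.sum_r_mul_tmult hy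
    rw [Fintype.card_fin] at this
    rw [this, hS]

end SplitPresentation

/-! ### Quantum binomial formulas -/

section QuantumBinomial

/-- Gaussian binomial coefficients. -/
def gaussBinom {k : Type*} [Field k] (ζ : k) : ℕ → ℕ → k
  | _, 0 => 1
  | 0, _ + 1 => 0
  | n + 1, j + 1 => ζ ^ (j + 1) * gaussBinom ζ n (j + 1) + gaussBinom ζ n j

variable {k : Type*} [Field k] {ζ : k}

@[simp] lemma gaussBinom_zero_right (n : ℕ) : gaussBinom ζ n 0 = 1 := by
  cases n <;> rfl

lemma gaussBinom_eq_zero {n j : ℕ} (h : n < j) : gaussBinom ζ n j = 0 := by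
  induction n generalizing j with
  | zero => obtain ⟨j, rfl⟩ := Nat.exists_eq_succ_of_ne_zero h.ne'; rfl
  | succ n ih =>
    obtain ⟨j, rfl⟩ := Nat.exists_eq_succ_of_ne_zero (Nat.ne_zero_of_lt h)
    rw [gaussBinom, ih (by omega), ih (by omega), mul_zero, add_zero]

lemma gaussBinom_self (n : ℕ) : gaussBinom ζ n n = 1 := by
  induction n with
  | zero => rfl
  | succ n ih => rw [gaussBinom, ih, gaussBinom_eq_zero (Nat.lt_succ_self n), mul_zero, zero_add]

/-- This is the quantum form of (j+1) C(n+1, j+1) = (n+1) C(n, j). At a root of unity of order n + 1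
it kills the middle coefficients. -/
lemma geom_sum_mul_gaussBinom (n j : ℕ) :
    (∑ i ∈ Finset.range (j + 1), ζ ^ i) * gaussBinom ζ (n + 1) (j + 1) =
      (∑ i ∈ Finset.range (n + 1), ζ ^ i) * gaussBinom ζ n j := by
  have hq : ∀ m, ∑ i ∈ Finset.range (m + 1), ζ ^ i = 1 + ζ * ∑ i ∈ Finset.range m, ζ ^ i := by
    intro m
    rw [geom_sum_succ, add_comm]
  induction n generalizing j with
  | zero =>
    rcases j with - | j
    · simp [gaussBinom]
    · simp [gaussBinom]
  | succ n ih =>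
    have h1 := ih j
    rcases j with - | j
    · have h3 : gaussBinom ζ (n + 1 + 1) 1 =
        ζ ^ 1 * gaussBinom ζ (n + 1) 1 + gaussBinom ζ (n + 1) 0 := rfl
      rw [hq (n + 1)]
      simp only [gaussBinom_zero_right, zero_add, Finset.sum_range_one, pow_zero, one_mul,
        mul_one] at h1 h3 ⊢
      rw [h3, h1]; ring
    · have h2 := ih j
      rw [gaussBinom, mul_add]
      rw [hq (n + 1), add_mul, mul_assoc ζ, one_mul]
      have h3 : gaussBinom ζ (n + 1) (j + 1) =
        ζ ^ (j + 1) * gaussBinom ζ n (j + 1) + gaussBinom ζ n j := rfl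
      calc _ = ζ ^ (j + 1 + 1) * ((∑ i ∈ Finset.range (j + 1 + 1), ζ ^ i) *
            gaussBinom ζ (n + 1) (j + 1 + 1)) + (1 + ζ * ∑ i ∈ Finset.range (j + 1), ζ ^ i) *
            gaussBinom ζ (n + 1) (j + 1) := by rw [← hq]; ring
        _ = ζ ^ (j + 1 + 1) * ((∑ i ∈ Finset.range (n + 1), ζ ^ i) * gaussBinom ζ n (j + 1)) +
            gaussBinom ζ (n + 1) (j + 1) +
            ζ * ((∑ i ∈ Finset.range (n + 1), ζ ^ i) * gaussBinom ζ n j) := by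
          rw [h1, ← h2]; ring
        _ = _ := by rw [h3]; ring

variable {B : Type*} [Ring B] [Algebra k B] {a b : B}

lemma pow_mul_of_skew_comm (hab : a * b = ζ • (b * a)) (n : ℕ) : a * b ^ n = ζ ^ n • (b ^ n * a) := by
  induction n with
  | zero => simp
  | succ n ih =>
    rw [pow_succ, ← mul_assoc, ih, smul_mul_assoc, mul_assoc, hab, mul_smul_comm, smul_smul,
      ← pow_succ, mul_assoc]

lemma mul_pow_of_skew_comm (hab : a * b = ζ • (b * a)) (n : ℕ) : a ^ n * b = ζ ^ n • (b * a ^ n) := by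
  induction n with
  | zero => simp
  | succ n ih =>
    rw [pow_succ', mul_assoc, ih, mul_smul_comm, ← mul_assoc, hab, smul_mul_assoc, smul_smul,
      ← pow_succ, mul_assoc]

/-- The quantum binomial theorem. -/
theorem add_pow_of_skew_comm (hab : a * b = ζ • (b * a)) (n : ℕ) :
    (a + b) ^ n = ∑ j ∈ Finset.range (n + 1), gaussBinom ζ n j • (b ^ j * a ^ (n - j)) := by
  induction n with
  | zero => simp
  | succ n ih =>
    have h1 : ∀ j ∈ Finset.range (n + 1), a * (gaussBinom ζ n j • (b ^ j * a ^ (n - j))) =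
        (ζ ^ j * gaussBinom ζ n j) • (b ^ j * a ^ (n + 1 - j)) := by
      intro j hj
      rw [Finset.mem_range] at hj
      rw [mul_smul_comm, ← mul_assoc, pow_mul_of_skew_comm hab, smul_mul_assoc, smul_smul,
        mul_assoc, ← pow_succ', show n - j + 1 = n + 1 - j by omega, mul_comm]
    have h2 : ∀ j, b * (gaussBinom ζ n j • (b ^ j * a ^ (n - j))) =
        gaussBinom ζ n j • (b ^ (j + 1) * a ^ (n + 1 - (j + 1))) := by
      intro j
      rw [mul_smul_comm, ← mul_assoc, ← pow_succ', Nat.add_sub_add_right]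
    rw [pow_succ', ih, add_mul, Finset.mul_sum, Finset.mul_sum, Finset.sum_congr rfl h1,
      Finset.sum_congr rfl fun j _ => h2 j, Finset.sum_range_succ' _ (n + 1)]
    simp only [gaussBinom, add_smul, Finset.sum_add_distrib]
    rw [Finset.sum_range_succ (fun j => (ζ ^ (j + 1) * gaussBinom ζ n (j + 1)) • _) n,
      gaussBinom_eq_zero (Nat.lt_succ_self n), mul_zero, zero_smul, add_zero,
      Finset.sum_range_succ' _ n]
    simp only [pow_zero, one_mul, gaussBinom_zero_right, one_smul, Nat.sub_zero]
    abel

/-- At a root of unity of order `p` the quantum binomial theorem has no mixed terms. -/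
theorem add_pow_prime_of_skew_comm (hab : a * b = ζ • (b * a)) {p : ℕ} (hp : p.Prime)
    (hζ : ζ ^ p = 1) (hζ1 : ζ ≠ 1) : (a + b) ^ p = a ^ p + b ^ p := by
  have hord : orderOf ζ = p := by
    have := Fact.mk hp
    exact orderOf_eq_prime hζ hζ1
  have hsum : ∀ j, 0 < j → j < p → (∑ i ∈ Finset.range j, ζ ^ i) ≠ 0 := by
    intro j hj hjp h
    have h1 := geom_sum_mul ζ j
    rw [h, zero_mul] at h1
    have := Nat.le_of_dvd hj (hord ▸ orderOf_dvd_of_pow_eq_one (sub_eq_zero.mp h1.symm))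
    omega
  obtain ⟨q, rfl⟩ := Nat.exists_eq_succ_of_ne_zero hp.ne_zero
  have hp0 : (∑ i ∈ Finset.range (q + 1), ζ ^ i) = 0 := by
    have h1 := geom_sum_mul ζ (q + 1)
    rw [hζ, sub_self] at h1
    exact (mul_eq_zero.mp h1).resolve_right (sub_ne_zero.mpr hζ1)
  rw [add_pow_of_skew_comm hab, Finset.sum_range_succ, Finset.sum_range_succ',
    Finset.sum_eq_zero fun j hj => ?_]
  · simp [gaussBinom_self]
  · rw [Finset.mem_range] at hj
    have := geom_sum_mul_gaussBinom (ζ := ζ) q j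
    rw [hp0, zero_mul] at this
    rw [(mul_eq_zero.mp this).resolve_left (hsum _ (by omega) (by omega)), zero_smul]

/-- The first two terms of the quantum binomial theorem. -/
lemma pow_mul_add_pow_of_skew_comm (hab : a * b = ζ • (b * a)) {m : ℕ} (hb : b ^ (m + 2) = 0)
    (n : ℕ) : b ^ m * (a + b) ^ (n + 1) =
      b ^ m * a ^ (n + 1) + (∑ i ∈ Finset.range (n + 1), ζ ^ i) • (b ^ (m + 1) * a ^ n) := by
  induction n with
  | zero => simp [mul_add, pow_succ]
  | succ n ih =>
    have h1 : b ^ m * a ^ (n + 1) * b = ζ ^ (n + 1) • (b ^ (m + 1) * a ^ (n + 1)) := by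
      rw [mul_assoc, mul_pow_of_skew_comm hab, mul_smul_comm, ← mul_assoc, ← pow_succ]
    have h2 : b ^ (m + 1) * a ^ n * b = 0 := by
      rw [mul_assoc, mul_pow_of_skew_comm hab, mul_smul_comm, ← mul_assoc, ← pow_succ, hb,
        zero_mul, smul_zero]
    rw [pow_succ (a + b), ← mul_assoc, ih, add_mul, mul_add, h1, smul_mul_assoc, mul_add, h2,
      add_zero, mul_assoc, ← pow_succ, mul_assoc, ← pow_succ, Finset.sum_range_succ _ (n + 1),
      add_smul, add_assoc, add_comm (ζ ^ (n + 1) • _)]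

end QuantumBinomial

/-! ### Freeness over a truncated polynomial algebra via the tensor square -/

namespace TensorShift

open HopfIntegral

variable {k V : Type*} [Field k] [AddCommGroup V] [Module k V] {Γ X : Module.End k V} {ζ : k}

/-- The action of a `(t, 1)`-primitive element on a tensor product. -/
noncomputable def shift (Γ X : Module.End k V) : Module.End k (V ⊗[k] V) :=
  TensorProduct.map Γ X + TensorProduct.map X 1

lemma map_mul_map (f g f' g' : Module.End k V) : TensorProduct.map f g * TensorProduct.map f' g' =
    TensorProduct.map (f * f') (g * g') := (TensorProduct.map_comp f g f' g').symm

lemma shift_commute (m : ℕ) : Commute (TensorProduct.map (1 : Module.End k V) (X ^ m)) (shift Γ X) := by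
  rw [Commute, SemiconjBy, shift, mul_add, add_mul]
  simp only [map_mul_map, one_mul, mul_one, ← pow_succ, ← pow_succ']

lemma map_mul_shift (h : Γ * X = ζ • (X * Γ)) :
    TensorProduct.map Γ Γ * shift Γ X = ζ • (shift Γ X * TensorProduct.map Γ Γ) := by
  rw [shift, mul_add, add_mul]
  simp only [map_mul_map, one_mul, mul_one, h, TensorProduct.map_smul_left,
    TensorProduct.map_smul_right, smul_add]

lemma shift_pow_apply {z : V ⊗[k] V} (hz : TensorProduct.map (1 : Module.End k V) X z = 0) (n : ℕ) :
    (shift Γ X ^ n) z = TensorProduct.map (X ^ n) 1 z := by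
  induction n with
  | zero => rw [pow_zero, pow_zero, Module.End.one_apply, TensorProduct.map_one,
      Module.End.one_apply]
  | succ n ih =>
    rw [pow_succ', Module.End.mul_apply, ih, shift, LinearMap.add_apply, ← Module.End.mul_apply,
      ← Module.End.mul_apply, map_mul_map, map_mul_map, mul_one, mul_one, ← pow_succ',
      ← mul_one (Γ * X ^ n), ← one_mul X, ← map_mul_map, Module.End.mul_apply, one_mul X, hz,
      map_zero, zero_add]

/-- A power of the shift is injective where the same power of `X` is left invertible. -/
lemma eq_zero_of_shift_pow {p n : ℕ} (hX : X ^ p = 0) {Y : Module.End k V} {z : V ⊗[k] V}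
    (hz : TensorProduct.map (Y * X ^ n) 1 z = z) (h : (shift Γ X ^ n) z = 0) : z = 0 := by
  -- Powers of 1 ⊗ X are peeled off from the top: on the kernel of 1 ⊗ X the n-th power of the shift
  -- is X^n ⊗ 1, which Y inverts on the vectors considered.
  have key : ∀ m ≤ p, TensorProduct.map (1 : Module.End k V) (X ^ (p - m)) z = 0 := by
    intro m
    induction m with
    | zero => intro _; rw [Nat.sub_zero, hX, TensorProduct.map_zero_right, LinearMap.zero_apply]
    | succ m ih =>
      intro hm
      set z' := TensorProduct.map (1 : Module.End k V) (X ^ (p - (m + 1))) z with hz'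
      have h1 : TensorProduct.map (1 : Module.End k V) X z' = 0 := by
        rw [hz', ← Module.End.mul_apply, map_mul_map, one_mul, ← pow_succ',
          show p - (m + 1) + 1 = p - m by omega, ih (by omega)]
      have h2 : (shift Γ X ^ n) z' = 0 := by
        rw [hz', ← Module.End.mul_apply, ← ((shift_commute _).pow_right n).eq,
          Module.End.mul_apply, h, map_zero]
      rw [shift_pow_apply h1] at h2
      have h3 : TensorProduct.map (Y * X ^ n) 1 z' = z' := by
        conv_rhs => rw [hz', ← hz]
        rw [hz', ← Module.End.mul_apply, ← Module.End.mul_apply, map_mul_map, map_mul_map,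
          mul_one, one_mul, mul_one, one_mul]
      rw [← h3, ← one_mul (1 : Module.End k V), ← map_mul_map, Module.End.mul_apply, h2, map_zero]
  have := key p le_rfl
  rwa [Nat.sub_self, pow_zero, TensorProduct.map_one] at this

/-- Tensors all of whose contractions lie in a subspace. -/
noncomputable def contractMem (F : Submodule k V) : Submodule k (V ⊗[k] V) :=
  ⨅ G : V →ₗ[k] k, F.comap (contract G)

lemma mem_contractMem {F : Submodule k V} {z : V ⊗[k] V} :
    z ∈ contractMem F ↔ ∀ G : V →ₗ[k] k, contract G z ∈ F := by
  simp [contractMem]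

lemma shift_mem_contractMem {F : Submodule k V} (hΓ : ∀ v ∈ F, Γ v ∈ F) (hX : ∀ v ∈ F, X v ∈ F)
    {z : V ⊗[k] V} (hz : z ∈ contractMem F) : shift Γ X z ∈ contractMem F := by
  rw [mem_contractMem] at *
  intro G
  rw [shift, LinearMap.add_apply, map_add, contract_map, contract_map]
  exact add_mem (hΓ _ (hz _)) (hX _ (hz _))

/-- If X v ∈ F, then modulo F ⊗ V the n-th power of Γ ⊗ X + X ⊗ 1 sends v ⊗ w to Γ^n v ⊗ X^n w. As
X^n w ≠ 0, contraction in the second factor isolates Γ^n v. -/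
lemma mem_of_shift_pow {F : Submodule k V} (hΓ : ∀ v ∈ F, Γ v ∈ F) (hX : ∀ v ∈ F, X v ∈ F)
    (hΓX : Γ * X = ζ • (X * Γ)) (hζ : ζ ≠ 0) {n : ℕ} {w : V} (hw : (X ^ n) w ≠ 0)
    (hF : ∀ z, (shift Γ X ^ n) z ∈ contractMem F) {v : V} (hv : X v ∈ F) : (Γ ^ n) v ∈ F := by
  have hpow : ∀ n : ℕ, ∀ v ∈ F, (Γ ^ n) v ∈ F := by
    intro n
    induction n with
    | zero => intro v hv; simpa using hv
    | succ n ih => intro v hv; rw [pow_succ, Module.End.mul_apply]; exact ih _ (hΓ v hv)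
  have hXΓ : ∀ n : ℕ, X ((Γ ^ n) v) ∈ F := by
    intro n
    have h1 := LinearMap.congr_fun (mul_pow_of_skew_comm hΓX n) v
    rw [Module.End.mul_apply, LinearMap.smul_apply, Module.End.mul_apply] at h1
    have h2 := hpow n _ hv
    rw [h1] at h2
    exact (Submodule.smul_mem_iff F (pow_ne_zero n hζ)).mp h2
  have key : ∀ n : ℕ, (shift Γ X ^ n) (v ⊗ₜ w) - (Γ ^ n) v ⊗ₜ (X ^ n) w ∈ contractMem F := by
    intro n
    induction n with
    | zero => simp
    | succ n ih =>
      have h1 := shift_mem_contractMem hΓ hX ih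
      have h2 : X ((Γ ^ n) v) ⊗ₜ[k] (X ^ n) w ∈ contractMem F := by
        rw [mem_contractMem]
        intro G
        rw [contract_tmul]
        exact Submodule.smul_mem _ _ (hXΓ n)
      have h3 := add_mem h1 h2
      convert h3 using 1
      rw [map_sub, pow_succ', pow_succ', pow_succ', Module.End.mul_apply, Module.End.mul_apply,
        Module.End.mul_apply, shift, LinearMap.add_apply (TensorProduct.map Γ X) _ ((Γ ^ n) v ⊗ₜ _),
        TensorProduct.map_tmul, TensorProduct.map_tmul, Module.End.one_apply]
      abel
  have h1 := (Submodule.sub_mem_iff_right _ (hF (v ⊗ₜ w))).mp (key n)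
  obtain ⟨G, hG⟩ := Module.Projective.exists_dual_ne_zero k hw
  have h2 := mem_contractMem.mp h1 G
  rw [contract_tmul] at h2
  exact (Submodule.smul_mem_iff F hG).mp h2

lemma exists_pseudoinverse {U : Type*} [AddCommGroup U] [Module k U] (f : Module.End k U) :
    ∃ g : Module.End k U, f * g * f = f := by
  obtain ⟨g, hg⟩ := LinearMap.exists_rightInverse_of_surjective f.rangeRestrict
    f.range_rangeRestrict
  obtain ⟨g', hg'⟩ := LinearMap.exists_extend g
  refine ⟨g', LinearMap.ext fun v => ?_⟩
  have h1 : g' (f v) = g (f.rangeRestrict v) := LinearMap.congr_fun hg' (f.rangeRestrict v)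
  have h2 := congrArg Subtype.val (LinearMap.congr_fun hg (f.rangeRestrict v))
  rw [Module.End.mul_apply, Module.End.mul_apply, h1]
  exact h2

lemma exists_equivariant_pseudoinverse [CharZero k] {p : ℕ} (hp : 0 < p) {Q : Module.End k V} {ξ : k}
    (hΓ : Γ ^ p = 1) (hξ : ξ ^ p = 1) (hΓQ : Γ * Q = ξ • (Q * Γ)) :
    ∃ Q' : Module.End k V, Q * Q' * Q = Q ∧ Q' * Γ = ξ • (Γ * Q') := by
  obtain ⟨n, rfl⟩ := Nat.exists_eq_succ_of_ne_zero hp.ne'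
  have hp0 : ((n + 1 : ℕ) : k) ≠ 0 := Nat.cast_ne_zero.mpr hp.ne'
  obtain ⟨Z, hZ⟩ := exists_pseudoinverse Q
  -- These are the twisted conjugates ξ^i Γ^i Z Γ^(-i), with Γ^n for the inverse of Γ. Each is a
  -- pseudoinverse of Q, hence so is their average, which is equivariant.
  let f : ℕ → Module.End k V := fun i => ξ ^ i • (Γ ^ i * Z * Γ ^ (n * i))
  have hf : ∀ i, ξ • (Γ * f i) = f (i + 1) * Γ := by
    intro i
    have h1 : Γ ^ (n * (i + 1)) * Γ = Γ ^ (n * i) := by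
      rw [← pow_succ, show n * (i + 1) + 1 = n * i + (n + 1) by ring, pow_add, hΓ, mul_one]
    simp only [f, mul_smul_comm, smul_mul_assoc, smul_smul, mul_assoc, h1]
    simp only [← mul_assoc, ← pow_succ']
  have hQf : ∀ i, Q * f i * Q = Q := by
    intro i
    have h1 : ∀ j, Γ ^ j * Q = ξ ^ j • (Q * Γ ^ j) := mul_pow_of_skew_comm hΓQ
    calc Q * f i * Q = (ξ ^ i • (Q * Γ ^ i)) * Z * (Γ ^ (n * i) * Q) := by
          simp only [f, mul_smul_comm, smul_mul_assoc, mul_assoc]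
      _ = ξ ^ (n * i) • (Γ ^ i * (Q * Z * Q) * Γ ^ (n * i)) := by
          rw [← h1 i, h1 (n * i)]
          simp only [mul_smul_comm, mul_assoc]
      _ = (ξ ^ (n * i) * ξ ^ i) • (Q * (Γ ^ i * Γ ^ (n * i))) := by
          rw [hZ, h1, smul_mul_assoc, smul_smul, mul_assoc]
      _ = Q := by
          rw [← pow_add, ← pow_add, show n * i + i = (n + 1) * i by ring,
            show i + n * i = (n + 1) * i by ring, pow_mul, pow_mul, hξ, hΓ, one_pow, one_pow,
            one_smul, mul_one]
  have h0 : f (n + 1) = f 0 := by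
    simp only [f]
    rw [hξ, hΓ, mul_comm n, pow_mul, hΓ]
    simp
  refine ⟨((n + 1 : ℕ) : k)⁻¹ • ∑ i ∈ Finset.range (n + 1), f i, ?_, ?_⟩
  · simp only [mul_smul_comm, smul_mul_assoc, Finset.mul_sum, Finset.sum_mul, hQf,
      Finset.sum_const, Finset.card_range]
    rw [← Nat.cast_smul_eq_nsmul k, smul_smul, inv_mul_cancel₀ hp0, one_smul]
  · have h1 : ∑ i ∈ Finset.range (n + 1), f i = ∑ i ∈ Finset.range (n + 1), f (i + 1) := by
      have e1 := Finset.sum_range_succ f (n + 1)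
      rw [Finset.sum_range_succ', h0] at e1
      exact (add_right_cancel e1).symm
    rw [smul_mul_assoc, h1, Finset.sum_mul, ← Finset.sum_congr rfl fun i _ => hf i, ← h1]
    simp only [Finset.mul_sum, mul_smul_comm, Finset.smul_sum]
    exact Finset.sum_congr rfl fun i _ => smul_comm _ _ _

section Trace

variable [CharZero k] [FiniteDimensional k V]

/-- An idempotent commuting with an operator of order `p` all of whose twisted traces vanish has
rank divisible by `p`. -/
lemma dvd_finrank_range {p : ℕ} (hp : 0 < p) (hΓ : Γ ^ p = 1) {E : Module.End k V}
    (hE : IsIdempotentElem E) (hΓE : Commute Γ E)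
    (htr : ∀ i, 0 < i → i < p → LinearMap.trace k V (Γ ^ i * E) = 0) :
    p ∣ Module.finrank k (LinearMap.range E) := by
  have hp0 : (p : k) ≠ 0 := Nat.cast_ne_zero.mpr hp.ne'
  have h1 : Γ * ∑ i ∈ Finset.range p, Γ ^ i = ∑ i ∈ Finset.range p, Γ ^ i := by
    have := mul_geom_sum Γ p
    rwa [hΓ, sub_self, sub_mul, one_mul, sub_eq_zero] at this
  have h2 : ∀ j, Γ ^ j * ∑ i ∈ Finset.range p, Γ ^ i = ∑ i ∈ Finset.range p, Γ ^ i := by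
    intro j
    induction j with
    | zero => simp
    | succ j ih => rw [pow_succ, mul_assoc, h1, ih]
  have h3 : IsIdempotentElem ((p : k)⁻¹ • ∑ i ∈ Finset.range p, Γ ^ i) := by
    rw [IsIdempotentElem, smul_mul_smul_comm, Finset.sum_mul]
    simp only [h2, Finset.sum_const, Finset.card_range]
    rw [← Nat.cast_smul_eq_nsmul k, smul_smul, mul_assoc, inv_mul_cancel₀ hp0, mul_one]
  have hcomm : Commute ((p : k)⁻¹ • ∑ i ∈ Finset.range p, Γ ^ i) E :=
    (Commute.sum_left _ _ _ fun i _ => hΓE.pow_left i).smul_left _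
  have h4 := LinearMap.trace_eq_finrank_range (h3.mul_of_commute hcomm hE)
  rw [smul_mul_assoc, Finset.sum_mul, map_smul, map_sum,
    Finset.sum_eq_single_of_mem 0 (Finset.mem_range.mpr hp) (fun i hi hi0 =>
      htr i (Nat.pos_of_ne_zero hi0) (Finset.mem_range.mp hi)), pow_zero, one_mul,
    LinearMap.trace_eq_finrank_range hE, smul_eq_mul, inv_mul_eq_iff_eq_mul₀ hp0] at h4
  exact ⟨_, by exact_mod_cast h4⟩

end Trace

end TensorShift

namespace TensorShift

open HopfIntegral

variable {k V : Type*} [Field k] [CharZero k] [AddCommGroup V] [Module k V] [FiniteDimensional k V]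
  {Γ X : Module.End k V} {ζ : k}

/-- With p = n + 1 and Y an equivariant pseudoinverse of Q = X^n, the space W = im(YQ) freely
generates V over k[X]/(X^p), so dim V = p dim W. The twisted traces of YQ vanish, giving p ∣ dim W.
Generation is proved on V ⊗ V, where T turns X ⊗ 1 into the shift. -/
theorem sq_dvd_finrank {n : ℕ} (hn : 0 < n) (hΓ : Γ ^ (n + 1) = 1) (hζ : ζ ^ (n + 1) = 1)
    (hΓX : Γ * X = ζ • (X * Γ)) (hX : X ^ (n + 1) = 0) (hX0 : X ^ n ≠ 0)
    (htr : ∀ i, 0 < i → i < n + 1 → LinearMap.trace k V (Γ ^ i) = 0)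
    (T : (V ⊗[k] V) ≃ₗ[k] (V ⊗[k] V)) (hTX : T.conj (TensorProduct.map X 1) = shift Γ X)
    (hTΓ : T.conj (TensorProduct.map Γ 1) = TensorProduct.map Γ Γ) :
    (n + 1) * (n + 1) ∣ Module.finrank k V := by
  have hζ0 : ζ ≠ 0 := by rintro rfl; rw [zero_pow (by omega)] at hζ; exact zero_ne_one hζ
  obtain ⟨w, hw⟩ : ∃ w, (X ^ n) w ≠ 0 := by
    by_contra! h
    exact hX0 (LinearMap.ext h)
  have hN : (Module.finrank k V : k) ≠ 0 := by
    have : Nontrivial V := ⟨⟨(X ^ n) w, 0, hw⟩⟩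
    exact Nat.cast_ne_zero.mpr Module.finrank_pos.ne'
  set Q := X ^ n with hQ
  set ξ := ζ ^ n
  have hξ : ξ ^ (n + 1) = 1 := by rw [← pow_mul, mul_comm, pow_mul, hζ, one_pow]
  have hΓQ : Γ * Q = ξ • (Q * Γ) := pow_mul_of_skew_comm hΓX n
  obtain ⟨Y, hY, hYΓ⟩ := exists_equivariant_pseudoinverse (Nat.succ_pos n) hΓ hξ hΓQ
  -- the operators on the tensor square
  let C : Module.End k (V ⊗[k] V) ≃ₐ[k] Module.End k (V ⊗[k] V) := T.conjAlgEquiv k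
  have hCX : C (TensorProduct.map X 1) = shift Γ X := hTX
  have hCΓ : C (TensorProduct.map Γ 1) = TensorProduct.map Γ Γ := hTΓ
  have hpow1 : ∀ (f : Module.End k V) (m : ℕ), TensorProduct.map (f ^ m) (1 : Module.End k V) =
      TensorProduct.map f 1 ^ m := by
    intro f m
    induction m with
    | zero => rw [pow_zero, pow_zero, TensorProduct.map_one]
    | succ m ih => rw [pow_succ, pow_succ, ← ih, map_mul_map, mul_one]
  have hpow2 : ∀ m : ℕ, TensorProduct.map (Γ ^ m) (Γ ^ m) = TensorProduct.map Γ Γ ^ m := by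
    intro m
    induction m with
    | zero => rw [pow_zero, pow_zero, TensorProduct.map_one]
    | succ m ih => rw [pow_succ, pow_succ, ← ih, map_mul_map]
  set M := shift Γ X ^ n with hM
  have hCQ : C (TensorProduct.map Q 1) = M := by rw [hQ, hpow1, map_pow, hCX]
  set E : Module.End k (V ⊗[k] V) := TensorProduct.map (Y * Q) 1 with hE
  have hEE : E * E = E := by rw [hE, map_mul_map, mul_one, mul_assoc, ← mul_assoc Q, hY]
  have hinj : ∀ z, E z = z → M z = 0 → z = 0 := fun z h1 h2 => eq_zero_of_shift_pow hX h1 h2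
  -- the range of `M` is already attained on the range of `E`
  have hker : LinearMap.ker (M * E) = LinearMap.ker E := by
    ext z
    rw [LinearMap.mem_ker, LinearMap.mem_ker, Module.End.mul_apply]
    refine ⟨fun h => hinj _ ?_ h, fun h => by rw [h, map_zero]⟩
    rw [← Module.End.mul_apply, hEE]
  have hrank : LinearMap.range (M * E) = LinearMap.range M := by
    apply Submodule.eq_of_le_of_finrank_le
    · exact LinearMap.range_comp_le_range _ _
    · have e1 := LinearMap.finrank_range_add_finrank_ker (M * E)
      have e2 := LinearMap.finrank_range_add_finrank_ker E
      rw [hker] at e1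
      have e3 : Module.finrank k (LinearMap.range M) =
          Module.finrank k (LinearMap.range (TensorProduct.map Q (1 : Module.End k V))) := by
        rw [← hCQ]
        change Module.finrank k (LinearMap.range (T.toLinearMap ∘ₗ (TensorProduct.map Q 1 ∘ₗ
          T.symm.toLinearMap))) = _
        rw [LinearMap.range_comp, LinearEquiv.finrank_map_eq,
          LinearMap.range_comp_of_range_eq_top _ T.symm.range]
      have e4 : LinearMap.ker E = LinearMap.ker (TensorProduct.map Q (1 : Module.End k V)) := by
        ext z
        rw [LinearMap.mem_ker, LinearMap.mem_ker]
        constructor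
        · intro h
          rw [← hY, ← mul_one (1 : Module.End k V), mul_assoc Q, ← map_mul_map,
            Module.End.mul_apply, h, map_zero]
        · intro h
          rw [hE, ← mul_one (1 : Module.End k V), ← map_mul_map,
            Module.End.mul_apply, h, map_zero]
      have e5 := LinearMap.finrank_range_add_finrank_ker
        (TensorProduct.map Q (1 : Module.End k V))
      rw [← e4] at e5
      omega
  -- G sends z to a vector in the range of E having the same image under M.
  obtain ⟨G, hEG, hMG⟩ : ∃ G, E * G = G ∧ M * G = M := by
    obtain ⟨Z, hZ⟩ := exists_pseudoinverse (M * E)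
    refine ⟨E * (Z * M), by rw [← mul_assoc, hEE], LinearMap.ext fun z => ?_⟩
    obtain ⟨u, hu⟩ : M z ∈ LinearMap.range (M * E) := hrank ▸ ⟨z, rfl⟩
    have := LinearMap.congr_fun hZ u
    simp only [Module.End.mul_apply] at this hu ⊢
    rw [← hu, this]
  -- twisted traces vanish
  have hξ0 : ξ ≠ 0 := pow_ne_zero _ hζ0
  have hcomm : Commute Γ (Y * Q) := by
    have h1 : ξ • (Y * Q * Γ) = ξ • (Γ * (Y * Q)) := by
      rw [mul_assoc, ← mul_smul_comm, ← hΓQ, ← mul_assoc, hYΓ, smul_mul_assoc, mul_assoc]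
    exact (smul_right_injective _ hξ0 h1).symm
  have hγE : ∀ i : ℕ, TensorProduct.map Γ Γ ^ i * E = E * TensorProduct.map Γ Γ ^ i := by
    intro i
    rw [hE, ← hpow2, map_mul_map, map_mul_map, mul_one, one_mul, (hcomm.pow_left i).eq]
  have hγM : ∀ i : ℕ, TensorProduct.map Γ Γ ^ i * M = ξ ^ i • (M * TensorProduct.map Γ Γ ^ i) :=
    mul_pow_of_skew_comm (pow_mul_of_skew_comm (map_mul_shift hΓX) n)
  -- The trace of (Γ ⊗ Γ)^i M M' is computed twice. Conjugating back by T gives ξ^i tr(Γ^i YQ) dim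
  -- V. Factoring M through E and cycling gives ξ^i tr(Γ^i YQ) tr(Γ^i) = 0.
  have htrE : ∀ i, 0 < i → i < n + 1 → LinearMap.trace k V (Γ ^ i * (Y * Q)) = 0 := by
    intro i hi hin
    set M' := C (TensorProduct.map Y 1)
    have hMM : M * M' * M = M := by
      rw [← hCQ, ← map_mul, ← map_mul, map_mul_map, map_mul_map, mul_one, mul_one, hY]
    have hGE : G * M' * (M * E) = E := by
      rw [← sub_eq_zero]
      refine LinearMap.ext fun z => hinj _ ?_ ?_
      · rw [← Module.End.mul_apply, mul_sub, hEE, ← mul_assoc, ← mul_assoc E, hEG]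
      · rw [← Module.End.mul_apply, mul_sub, ← mul_assoc, ← mul_assoc M, hMG, ← mul_assoc, hMM,
          sub_self, LinearMap.zero_apply]
    have h1 : TensorProduct.map Γ Γ ^ i * (M * M') =
        C (TensorProduct.map (Γ ^ i * (Q * Y)) 1) := by
      rw [← hCΓ, ← hCQ, ← map_pow, ← map_mul, ← map_mul, ← hpow1, map_mul_map, map_mul_map,
        mul_one, mul_one]
    have h2 : LinearMap.trace k _ (TensorProduct.map Γ Γ ^ i * (M * M')) =
        ξ ^ i * LinearMap.trace k V (Γ ^ i * (Y * Q)) * Module.finrank k V := by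
      rw [h1]
      change LinearMap.trace k _ (T.conj _) = _
      rw [LinearMap.trace_conj', LinearMap.trace_tensorProduct', LinearMap.trace_one, ← mul_assoc,
        mul_pow_of_skew_comm hΓQ, smul_mul_assoc, map_smul, smul_eq_mul, mul_assoc Q,
        LinearMap.trace_mul_comm, mul_assoc (Γ ^ i), mul_assoc]
    have h3 : LinearMap.trace k _ (TensorProduct.map Γ Γ ^ i * (M * M')) = 0 := by
      have h4 : TensorProduct.map Γ Γ ^ i * (M * M') =
          ξ ^ i • ((M * E) * (TensorProduct.map Γ Γ ^ i * (G * M'))) := by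
        calc _ = TensorProduct.map Γ Γ ^ i * M * (E * G * M') := by
              rw [hEG, mul_assoc, ← mul_assoc M G, hMG]
          _ = _ := by
              rw [hγM, smul_mul_assoc]
              congr 1
              simp only [mul_assoc]
              rw [← mul_assoc _ E, hγE]
              simp only [mul_assoc]
      rw [h4, map_smul, LinearMap.trace_mul_comm, mul_assoc, hGE, hE, ← hpow2, map_mul_map, mul_one,
        LinearMap.trace_tensorProduct', htr i hi hin, mul_zero, smul_zero]
    rw [h3] at h2
    exact (mul_eq_zero.mp ((mul_eq_zero.mp h2.symm).resolve_right hN)).resolve_left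
      (pow_ne_zero _ hξ0)
  obtain ⟨s, hs⟩ := dvd_finrank_range (Nat.succ_pos n) hΓ (E := Y * Q)
    (by rw [IsIdempotentElem, mul_assoc, ← mul_assoc Q, hY]) hcomm htrE
  -- `V` is free over the truncated polynomial algebra generated by `X`
  set W := LinearMap.range (Y * Q) with hW
  let ψ : (Fin (n + 1) → W) →ₗ[k] V :=
    ∑ j : Fin (n + 1), (X ^ (j : ℕ)) ∘ₗ W.subtype ∘ₗ LinearMap.proj j
  have hψ : ∀ u, ψ u = ∑ j : Fin (n + 1), (X ^ (j : ℕ)) (u j : V) := by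
    intro u; simp [ψ]
  have hQW : ∀ v ∈ W, Q v = 0 → v = 0 := by
    rintro _ ⟨v, rfl⟩ h
    have h1 : (Y * Q) ((Y * Q) v) = (Y * Q) v := by
      rw [← Module.End.mul_apply, mul_assoc, ← mul_assoc Q, hY]
    rw [← h1, Module.End.mul_apply Y Q, h, map_zero]
  have hXz : ∀ m, n + 1 ≤ m → X ^ m = 0 := fun m hm => by
    rw [← Nat.sub_add_cancel hm, pow_add, hX, mul_zero]
  have hψi : Function.Injective ψ := by
    rw [injective_iff_map_eq_zero]
    intro u hu
    have key : ∀ (m : ℕ) (hm : m < n + 1), (u ⟨m, hm⟩ : V) = 0 := by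
      intro m
      induction m using Nat.strong_induction_on with
      | _ m ih =>
        intro hm
        refine hQW _ (u ⟨m, hm⟩).2 ?_
        have h1 := congrArg (X ^ (n - m)) hu
        rw [hψ, map_sum, map_zero, Finset.sum_eq_single ⟨m, hm⟩ (fun j _ hj => ?_) (by simp)] at h1
        · rwa [← Module.End.mul_apply, ← pow_add, show n - m + m = n by omega] at h1
        · rcases lt_trichotomy (j : ℕ) m with h | h | h
          · rw [ih j h j.2, map_zero, map_zero]
          · exact absurd (Fin.ext h) hj
          · rw [← Module.End.mul_apply, ← pow_add, hXz _ (by omega), LinearMap.zero_apply]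
    funext j
    exact Subtype.ext (key j j.2)
  have hψs : Function.Surjective ψ := by
    let F : Submodule k V := ⨆ j : ℕ, W.map (X ^ j)
    have hmem : ∀ (j : ℕ), ∀ v ∈ W, (X ^ j) v ∈ F := fun j v hv =>
      (le_iSup (fun j : ℕ => W.map (X ^ j)) j) (Submodule.mem_map_of_mem hv)
    have hstab : ∀ f : Module.End k V, (∀ j : ℕ, ∀ v ∈ W, f ((X ^ j) v) ∈ F) → ∀ v ∈ F, f v ∈ F := by
      intro f hf
      change F ≤ F.comap f
      refine iSup_le fun j => ?_
      rintro _ ⟨v, hv, rfl⟩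
      exact hf j v hv
    have hXF : ∀ v ∈ F, X v ∈ F := hstab X fun j v hv => by
      rw [← Module.End.mul_apply, ← pow_succ']
      exact hmem _ v hv
    have hΓW : ∀ v ∈ W, Γ v ∈ W := by
      rintro _ ⟨v, rfl⟩
      rw [← Module.End.mul_apply, hcomm.eq]
      exact ⟨Γ v, rfl⟩
    have hΓF : ∀ v ∈ F, Γ v ∈ F := hstab Γ fun j v hv => by
      rw [← Module.End.mul_apply, pow_mul_of_skew_comm hΓX]
      exact Submodule.smul_mem _ _ (hmem j _ (hΓW v hv))
    have hM : ∀ z, M z ∈ contractMem F := by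
      intro z
      have h1 : E (G z) ∈ contractMem F := by
        rw [mem_contractMem]
        intro g
        rw [hE, contract_map]
        simpa using hmem 0 _ (LinearMap.mem_range_self (Y * Q) _)
      have h2 : ∀ (m : ℕ), (shift Γ X ^ m) (E (G z)) ∈ contractMem F := by
        intro m
        induction m with
        | zero => exact h1
        | succ m ih =>
          rw [pow_succ', Module.End.mul_apply]
          exact shift_mem_contractMem hΓF hXF ih
      have h3 := h2 n
      rwa [← Module.End.mul_apply E, hEG, ← Module.End.mul_apply, hMG] at h3
    -- The image of M lies in F ⊗ V, so X v ∈ F implies Γ^n v ∈ F, and Γ · Γ^n = 1. Nilpotency of X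
    -- then gives F = V.
    have hstep : ∀ v, X v ∈ F → v ∈ F := by
      intro v hv
      have h1 := hΓF _ (mem_of_shift_pow hΓF hXF hΓX hζ0 hw hM hv)
      rwa [← Module.End.mul_apply, ← pow_succ', hΓ] at h1
    have htop : ∀ v, v ∈ F := by
      intro v
      have h1 : ∀ m ≤ n + 1, (X ^ (n + 1 - m)) v ∈ F := by
        intro m
        induction m with
        | zero => intro _; rw [Nat.sub_zero, hX]; exact zero_mem _
        | succ m ih =>
          intro hm
          apply hstep
          rw [← Module.End.mul_apply, ← pow_succ', show n + 1 - (m + 1) + 1 = n + 1 - m by omega]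
          exact ih (by omega)
      simpa using h1 (n + 1) le_rfl
    have hle : F ≤ LinearMap.range ψ := by
      refine iSup_le fun j => ?_
      rintro _ ⟨v, hv, rfl⟩
      rcases lt_or_ge j (n + 1) with hj | hj
      · refine ⟨Pi.single ⟨j, hj⟩ ⟨v, hv⟩, ?_⟩
        rw [hψ, Finset.sum_eq_single ⟨j, hj⟩ (fun i _ hi => by
          rw [Pi.single_eq_of_ne hi]; simp) (by simp), Pi.single_eq_same]
      · rw [hXz j hj]
        exact zero_mem _
    exact fun v => hle (htop v)
  have := (LinearEquiv.ofBijective ψ ⟨hψi, hψs⟩).finrank_eq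
  rw [Module.finrank_pi_fintype] at this
  simp only [Finset.sum_const, Finset.card_univ, Fintype.card_fin, smul_eq_mul, hs] at this
  exact ⟨s, by rw [← this, mul_assoc]⟩

end TensorShift

/-! ### Nontrivial skew-primitives force p² to divide the dimension -/

namespace Module.End

variable {k V : Type*} [Field k] [IsAlgClosed k] [AddCommGroup V] [Module k V]
  [FiniteDimensional k V] {f g : Module.End k V}

lemma exists_joint_eigenvector (hfg : Commute f g) {μ : k} {v : V} (hv : v ≠ 0)
    (hfv : f v = μ • v) : ∃ w, w ≠ 0 ∧ f w = μ • w ∧ ∃ ν : k, g w = ν • w := by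
  let U := f.eigenspace μ
  have hU : ∀ x ∈ U, g x ∈ U := fun x hx => by
    rw [mem_eigenspace_iff] at *
    rw [← Module.End.mul_apply, hfg.eq, Module.End.mul_apply, hx, map_smul]
  have : Nontrivial U := ⟨⟨⟨v, mem_eigenspace_iff.mpr hfv⟩, 0, fun h => hv (congrArg Subtype.val h)⟩⟩
  obtain ⟨ν, hν⟩ := exists_eigenvalue (g.restrict hU)
  obtain ⟨w, hw⟩ := hν.exists_hasEigenvector
  exact ⟨w, fun h => hw.2 (Subtype.ext h), mem_eigenspace_iff.mp w.2, ν,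
    congrArg Subtype.val hw.apply_eq_smul⟩

lemma isNilpotent_of_eigenvalue_eq_zero (h : ∀ (μ : k) (v : V), v ≠ 0 → f v = μ • v → μ = 0) :
    IsNilpotent f := by
  have h1 : f.maxGenEigenspace 0 = ⊤ := by
    rw [eq_top_iff, ← f.iSup_maxGenEigenspace_eq_top]
    refine iSup_le fun μ => ?_
    by_cases hμ : f.HasEigenvalue μ
    · obtain ⟨v, hv⟩ := hμ.exists_hasEigenvector
      rw [h μ v hv.2 hv.apply_eq_smul]
    · have : f.maxGenEigenspace μ = ⊥ := by
        by_contra hne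
        exact hμ (HasUnifEigenvalue.lt (k := ⊤) zero_lt_one hne)
      rw [this]
      exact bot_le
  refine ⟨Module.finrank k V, LinearMap.ext fun v => ?_⟩
  have h2 : v ∈ f.maxGenEigenspace 0 := h1 ▸ Submodule.mem_top
  rw [maxGenEigenspace_eq_genEigenspace_finrank, mem_genEigenspace_nat, zero_smul, sub_zero] at h2
  exact h2

end Module.End

lemma TensorProduct.tmul_ne_zero {k V : Type*} [Field k] [AddCommGroup V] [Module k V] {v w : V}
    (hv : v ≠ 0) (hw : w ≠ 0) : v ⊗ₜ[k] w ≠ 0 := by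
  obtain ⟨G, hG⟩ := Module.Projective.exists_dual_ne_zero k hw
  intro h
  have := congrArg (HopfIntegral.contract G) h
  rw [HopfIntegral.contract_tmul, map_zero] at this
  exact smul_ne_zero hG hv this

namespace SkewPrimitive

variable {k H : Type*} [Field k] [Ring H] [HopfAlgebra k H]

/-- The space of `(t, 1)`-primitive elements. -/
def space (k : Type*) {H : Type*} [Field k] [Ring H] [HopfAlgebra k H] (t : H) : Submodule k H where
  carrier := {y | comul (R := k) y = t ⊗ₜ[k] y + y ⊗ₜ[k] 1}
  add_mem' {x y} hx hy := by
    change comul (R := k) x = _ at hx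
    change comul (R := k) y = _ at hy
    change comul (R := k) (x + y) = _
    rw [map_add, hx, hy, TensorProduct.tmul_add, TensorProduct.add_tmul]
    abel
  zero_mem' := by change comul (R := k) (0 : H) = _; simp
  smul_mem' c x hx := by
    change comul (R := k) x = _ at hx
    change comul (R := k) (c • x) = _
    rw [map_smul, hx, smul_add, TensorProduct.tmul_smul, ← TensorProduct.smul_tmul']

lemma mem_space {t y : H} : y ∈ space k t ↔ comul (R := k) y = t ⊗ₜ[k] y + y ⊗ₜ[k] 1 := Iff.rfl

lemma sub_one_mem_space (t : GroupLike k H) : (t : H) - 1 ∈ space k (t : H) := by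
  rw [mem_space, map_sub, t.2.comul_eq_tmul_self, Bialgebra.comul_one, TensorProduct.tmul_sub,
    TensorProduct.sub_tmul]
  change _ - (1 : H) ⊗ₜ[k] (1 : H) = _
  abel

lemma skew_comm {t : GroupLike k H} {y : H} {ζ : k} (hty : (t : H) * y = ζ • (y * t)) :
    ((t : H) ⊗ₜ[k] y) * (y ⊗ₜ[k] (1 : H)) = ζ • ((y ⊗ₜ[k] (1 : H)) * ((t : H) ⊗ₜ[k] y)) := by
  rw [Algebra.TensorProduct.tmul_mul_tmul, Algebra.TensorProduct.tmul_mul_tmul, hty, mul_one,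
    one_mul, TensorProduct.smul_tmul']

lemma mul_groupLike_ne_zero (t : GroupLike k H) {y : H} (hy : y ≠ 0) : y * (t : H) ≠ 0 :=
  (t.2.isUnit.mul_left_eq_zero).not.mpr hy

/-- The nilpotency index of a nonzero nilpotent skew-primitive element is a zero of the quantum
integers. -/
theorem exists_geom_sum_eq_zero {t : GroupLike k H} {y : H} (hy : y ∈ space k (t : H)) {ζ : k}
    (hty : (t : H) * y = ζ • (y * t)) (hy0 : y ≠ 0) (hnil : IsNilpotent y) :
    ∃ m, y ^ (m + 1) ≠ 0 ∧ y ^ (m + 2) = 0 ∧ ∑ i ∈ Finset.range (m + 2), ζ ^ i = 0 := by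
  have : Nontrivial H := ⟨⟨y, 0, hy0⟩⟩
  have h0 := pow_nilpotencyClass hnil
  have h1 := pow_pred_nilpotencyClass hnil
  have h2 := pos_nilpotencyClass_iff.mpr hnil
  have h3 : nilpotencyClass y ≠ 1 := by
    intro h
    rw [h, pow_one] at h0
    exact hy0 h0
  obtain ⟨m, hm⟩ : ∃ m, nilpotencyClass y = m + 2 := ⟨_, (Nat.sub_add_cancel (by omega)).symm⟩
  rw [hm] at h0 h1
  refine ⟨m, h1, h0, ?_⟩
  have hb : ∀ j, (y ⊗ₜ[k] (1 : H)) ^ j = (y ^ j) ⊗ₜ[k] (1 : H) := fun j => by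
    rw [Algebra.TensorProduct.tmul_pow, one_pow]
  -- Multiplying Δ(y)^(m+2) = 0 by (y ⊗ 1)^m leaves a single term, the quantum integer of m + 2
  -- times the nonzero tensor y^(m+1) t^(m+1) ⊗ y^(m+1).
  have h4 := pow_mul_add_pow_of_skew_comm (skew_comm hty) (m := m)
    (by rw [hb, h0, TensorProduct.zero_tmul]) (m + 1)
  have ha : ∀ j, ((t : H) ⊗ₜ[k] y) ^ j = ((t : H) ^ j) ⊗ₜ[k] (y ^ j) := fun j =>
    Algebra.TensorProduct.tmul_pow _ _ _
  rw [← mem_space.mp hy, ← Bialgebra.comul_pow, h0, map_zero, mul_zero,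
    ha, h0, TensorProduct.tmul_zero, mul_zero, zero_add, ha, hb, Algebra.TensorProduct.tmul_mul_tmul, one_mul] at h4
  refine (smul_eq_zero.mp h4.symm).resolve_right (TensorProduct.tmul_ne_zero ?_ h1)
  exact mul_groupLike_ne_zero (t ^ (m + 1)) h1

/-- Joint eigenvalues of left multiplication by `t` and `y`. -/
def JointEigen (t y : H) (γ μ : k) : Prop :=
  ∃ v : H, v ≠ 0 ∧ t * v = γ • v ∧ y * v = μ • v

section Finite

variable [FiniteDimensional k H]

/-- The tensor identity as an equivalence. -/
noncomputable def twistEquiv (k H : Type*) [Field k] [Ring H] [HopfAlgebra k H]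
    [FiniteDimensional k H] : (H ⊗[k] H) ≃ₗ[k] (H ⊗[k] H) :=
  LinearEquiv.ofBijective (GroupLikeTrace.twist k H)
    ⟨LinearMap.injective_iff_surjective.mpr GroupLikeTrace.twist_surjective,
      GroupLikeTrace.twist_surjective⟩

lemma twistEquiv_mul (h : H) (z : H ⊗[k] H) :
    twistEquiv k H (TensorProduct.map (LinearMap.mulLeft k h) 1 z) =
      comul (R := k) h * twistEquiv k H z := by
  change GroupLikeTrace.twist k H _ = _ * GroupLikeTrace.twist k H z
  induction z with
  | zero => simp
  | add z w hz hw => simp only [map_add, hz, hw, mul_add]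
  | tmul u v =>
    rw [TensorProduct.map_tmul, LinearMap.mulLeft_apply, Module.End.one_apply,
      GroupLikeTrace.twist_tmul, GroupLikeTrace.twist_tmul, Bialgebra.comul_mul, mul_assoc]

omit [FiniteDimensional k H] in
lemma tmul_mul_eq_map (a b : H) (z : H ⊗[k] H) :
    (a ⊗ₜ[k] b) * z = TensorProduct.map (LinearMap.mulLeft k a) (LinearMap.mulLeft k b) z := by
  induction z with
  | zero => simp
  | add z w hz hw => simp only [map_add, hz, hw, mul_add]
  | tmul u v => simp

/-- The tensor of two joint eigenvectors is one for Δ(t) and Δ(y); the tensor identity brings it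
back to H. Joint eigenvalues thus compose like the affine maps s ↦ γ s + μ. -/
lemma JointEigen.mul {t : GroupLike k H} {y : H} (hy : y ∈ space k (t : H)) {γ μ γ' μ' : k}
    (h : JointEigen (t : H) y γ μ) (h' : JointEigen (t : H) y γ' μ') :
    JointEigen (t : H) y (γ * γ') (γ * μ' + μ) := by
  obtain ⟨v, hv, hv1, hv2⟩ := h
  obtain ⟨w, hw, hw1, hw2⟩ := h'
  obtain ⟨u, hu⟩ := (twistEquiv k H).surjective (v ⊗ₜ w)
  have hu0 : u ≠ 0 := by
    rintro rfl
    rw [map_zero] at hu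
    exact TensorProduct.tmul_ne_zero hv hw hu.symm
  have h1 : TensorProduct.map (LinearMap.mulLeft k (t : H)) (1 : Module.End k H) u =
      (γ * γ') • u := by
    apply (twistEquiv k H).injective
    rw [twistEquiv_mul, map_smul, hu, t.2.comul_eq_tmul_self,
      Algebra.TensorProduct.tmul_mul_tmul, hv1, hw1, TensorProduct.smul_tmul_smul]
  have h2 : TensorProduct.map (LinearMap.mulLeft k y) (1 : Module.End k H) u =
      (γ * μ' + μ) • u := by
    apply (twistEquiv k H).injective
    rw [twistEquiv_mul, map_smul, hu, mem_space.mp hy, add_mul,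
      Algebra.TensorProduct.tmul_mul_tmul, Algebra.TensorProduct.tmul_mul_tmul, hv1, hw2, hv2,
      one_mul, TensorProduct.smul_tmul_smul, ← TensorProduct.smul_tmul', add_smul]
  obtain ⟨G, hG⟩ := HopfIntegral.exists_contract_ne_zero hu0
  refine ⟨HopfIntegral.contract G u, hG, ?_, ?_⟩
  · rw [← map_smul, ← h1, HopfIntegral.contract_map]; rfl
  · rw [← map_smul, ← h2, HopfIntegral.contract_map]; rfl

variable [CharZero k]

/-- A translation (1, μ) with μ ≠ 0 would have infinitely many multiples as eigenvalues of y. -/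
lemma JointEigen.eq_zero_of_one {t : GroupLike k H} {y : H} (hy : y ∈ space k (t : H)) {μ : k}
    (h : JointEigen (t : H) y 1 μ) : μ = 0 := by
  by_contra hμ
  have h1 : ∀ n : ℕ, JointEigen (t : H) y 1 (((n + 1 : ℕ) : k) * μ) := by
    intro n
    induction n with
    | zero => simpa using h
    | succ n ih =>
      have := ih.mul hy h
      rw [one_mul, one_mul] at this
      convert this using 1
      push_cast; ring
  have h2 : Set.Infinite {ν | Module.End.HasEigenvalue (LinearMap.mulLeft k y) ν} := by
    refine Set.infinite_of_injective_forall_mem (f := fun n : ℕ => ((n + 1 : ℕ) : k) * μ) ?_ ?_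
    · intro m n hmn
      have := mul_right_cancel₀ hμ hmn
      have := Nat.cast_injective (R := k) this
      omega
    · intro n
      obtain ⟨v, hv, -, hv2⟩ := h1 n
      exact Module.End.hasEigenvalue_of_hasEigenvector ⟨Module.End.mem_eigenspace_iff.mpr hv2, hv⟩
  exact h2 (Module.End.finite_hasEigenvalue _)

variable [IsAlgClosed k]

/-- Skew-primitive elements commuting with their group-like element are trivial. -/
theorem mem_span_of_commute {p : ℕ} (hp : p.Prime) {t : GroupLike k H} (ht : t ^ p = 1) {y : H}
    (hy : y ∈ space k (t : H)) (hty : (t : H) * y = y * t) :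
    y ∈ Submodule.span k {(t : H) - 1} := by
  have htp : (t : H) ^ p = 1 := by rw [← GroupLike.val_pow, ht, GroupLike.val_one]
  have hγ : ∀ {γ μ : k} {y : H}, JointEigen (t : H) y γ μ → γ ^ p = 1 := by
    rintro γ μ y ⟨v, hv, hv1, -⟩
    have h1 : ∀ n : ℕ, (t : H) ^ n * v = γ ^ n • v := by
      intro n
      induction n with
      | zero => simp
      | succ n ih => rw [pow_succ, mul_assoc, hv1, mul_smul_comm, ih, smul_smul, ← pow_succ']
    have h2 := h1 p
    rw [htp, one_mul] at h2
    have h3 : (γ ^ p - 1) • v = 0 := by rw [sub_smul, one_smul, ← h2, sub_self]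
    exact sub_eq_zero.mp ((smul_eq_zero.mp h3).resolve_right hv)
  have hcomm : ∀ y : H, (t : H) * y = y * t →
      Commute (LinearMap.mulLeft k (t : H)) (LinearMap.mulLeft k y) := by
    intro y h
    rw [Commute, SemiconjBy, Module.End.mul_eq_comp, Module.End.mul_eq_comp,
      ← LinearMap.mulLeft_mul, ← LinearMap.mulLeft_mul, h]
  -- Subtracting a multiple of t - 1 moves the fixed point of one joint eigenvalue with ω ≠ 1 to 0.
  -- Its powers (ω^j, 0) then turn any (γ, μ) into (1, μ), so μ = 0 and the modified y is nilpotent.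
  obtain ⟨c, hc⟩ : ∃ c : k, ∀ γ μ : k, JointEigen (t : H) (y - c • ((t : H) - 1)) γ μ →
      JointEigen (t : H) (y - c • ((t : H) - 1)) 1 μ := by
    by_cases ht1 : t = 1
    · refine ⟨0, fun γ μ ⟨v, hv, hv1, hv2⟩ => ⟨v, hv, ?_, hv2⟩⟩
      rw [ht1, GroupLike.val_one, one_mul, one_smul]
    · obtain ⟨ω, hω1, μ, v, hv, hv1, hv2⟩ : ∃ ω : k, ω ≠ 1 ∧ ∃ μ, JointEigen (t : H) y ω μ := by
        have hne : (t : H) - 1 ≠ 0 := fun h => ht1 (GroupLike.val_injective (sub_eq_zero.mp h))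
        let U : Submodule k H := LinearMap.range (LinearMap.mulLeft k ((t : H) - 1))
        have hU : ∀ x ∈ U, LinearMap.mulLeft k (t : H) x ∈ U := by
          rintro _ ⟨h, rfl⟩
          refine ⟨(t : H) * h, ?_⟩
          simp only [LinearMap.mulLeft_apply, ← mul_assoc, sub_mul, mul_sub, one_mul]
        have : Nontrivial U := ⟨⟨⟨_, 1, rfl⟩, 0, fun h => hne (by simpa using congrArg Subtype.val h)⟩⟩
        obtain ⟨ω, hω⟩ := Module.End.exists_eigenvalue ((LinearMap.mulLeft k (t : H)).restrict hU)
        obtain ⟨⟨_, h, rfl⟩, hu⟩ := hω.exists_hasEigenvector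
        set u := LinearMap.mulLeft k ((t : H) - 1) h with hudef
        have hu0 : u ≠ 0 := fun h => hu.2 (Subtype.ext h)
        have hu1 : (t : H) * u = ω • u := congrArg Subtype.val hu.apply_eq_smul
        refine ⟨ω, ?_, ?_⟩
        · rintro rfl
          rw [one_smul] at hu1
          have h1 : (t : H) * h = h + u := by
            rw [hudef, LinearMap.mulLeft_apply, sub_mul, one_mul, add_sub_cancel]
          have h2 : ∀ n : ℕ, (t : H) ^ n * h = h + (n : k) • u := by
            intro n
            induction n with
            | zero => simp
            | succ n ih =>
              rw [pow_succ', mul_assoc, ih, mul_add, h1, mul_smul_comm, hu1, Nat.cast_succ, add_smul,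
                one_smul]
              abel
          have h3 := h2 p
          rw [htp, one_mul, left_eq_add] at h3
          exact hu0 ((smul_eq_zero.mp h3).resolve_left (Nat.cast_ne_zero.mpr hp.ne_zero))
        · obtain ⟨w, hw, hw1, ν, hν⟩ := Module.End.exists_joint_eigenvector (hcomm y hty) hu0 hu1
          exact ⟨ν, w, hw, hw1, hν⟩
      refine ⟨μ / (ω - 1), fun γ ν h => ?_⟩
      set y' := y - (μ / (ω - 1)) • ((t : H) - 1) with hy'
      have hyt : y' ∈ space k (t : H) :=
        sub_mem hy (Submodule.smul_mem _ _ (sub_one_mem_space t))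
      have h0 : JointEigen (t : H) y' ω 0 := by
        refine ⟨v, hv, hv1, ?_⟩
        rw [hy', sub_mul, smul_mul_assoc, sub_mul, hv1, hv2, one_mul, smul_sub, smul_smul,
          ← sub_smul, ← sub_smul]
        congr 1
        field_simp [sub_ne_zero.mpr hω1]
        ring
      have hpow : ∀ j : ℕ, JointEigen (t : H) y' (ω ^ (j + 1)) 0 := by
        intro j
        induction j with
        | zero => simpa using h0
        | succ j ih =>
          have := ih.mul hyt h0
          rwa [mul_zero, add_zero, ← pow_succ] at this
      have hωp := hγ h0
      have hprim : IsPrimitiveRoot ω p := by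
        have := Fact.mk hp
        exact IsPrimitiveRoot.iff_orderOf.mpr (orderOf_eq_prime hωp hω1)
      have : NeZero p := ⟨hp.ne_zero⟩
      obtain ⟨i, -, hi⟩ := hprim.eq_pow_of_pow_eq_one (ξ := γ⁻¹) (by rw [inv_pow, hγ h, inv_one])
      have h1 := hpow (i + (p - 1))
      rw [show i + (p - 1) + 1 = i + p by have := hp.pos; omega, pow_add, hωp, mul_one, hi] at h1
      have hγ0 : γ ≠ 0 := by
        rintro rfl
        have := hγ h
        rw [zero_pow hp.ne_zero] at this
        exact zero_ne_one this
      have h2 := h.mul hyt h1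
      rwa [mul_inv_cancel₀ hγ0, mul_zero, zero_add] at h2
  set y' := y - c • ((t : H) - 1) with hy'
  have hyt : y' ∈ space k (t : H) := sub_mem hy (Submodule.smul_mem _ _ (sub_one_mem_space t))
  have hty' : (t : H) * y' = y' * t := by
    rw [hy', mul_sub, sub_mul, hty, mul_smul_comm, smul_mul_assoc, mul_sub, sub_mul, one_mul, mul_one]
  have hnil : IsNilpotent y' := by
    have h1 : IsNilpotent (LinearMap.mulLeft k y') := by
      apply Module.End.isNilpotent_of_eigenvalue_eq_zero
      intro μ v hv hμ
      obtain ⟨w, hw, hw1, ν, hν⟩ := Module.End.exists_joint_eigenvector (hcomm y' hty').symm hv hμ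
      exact (hc ν μ ⟨w, hw, hν, hw1⟩).eq_zero_of_one hyt
    obtain ⟨n, hn⟩ := h1
    refine ⟨n, ?_⟩
    rw [LinearMap.pow_mulLeft] at hn
    simpa using LinearMap.congr_fun hn 1
  have h0 : y' = 0 := by
    by_contra hne
    -- For ζ = 1 the quantum integer is m + 2, nonzero in characteristic 0.
    obtain ⟨m, -, -, hm⟩ := exists_geom_sum_eq_zero hyt (ζ := (1 : k)) (by rw [hty', one_smul]) hne hnil
    simp only [one_pow, Finset.sum_const, Finset.card_range, nsmul_eq_mul, mul_one] at hm
    exact (Nat.cast_ne_zero.mpr (by omega)) hm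
  rw [sub_eq_zero] at h0
  exact Submodule.mem_span_singleton.mpr ⟨c, h0.symm⟩

end Finite

end SkewPrimitive

namespace SkewPrimitive

variable {k H : Type*} [Field k] [Ring H] [HopfAlgebra k H]

/-- Conjugation by a group-like element. -/
noncomputable def conj (k : Type*) {H : Type*} [Field k] [Ring H] [HopfAlgebra k H]
    (t : GroupLike k H) : Module.End k H :=
  LinearMap.mulLeft k (t : H) * LinearMap.mulRight k ((t⁻¹ : GroupLike k H) : H)

lemma conj_apply (t : GroupLike k H) (h : H) :
    conj k t h = t * (h * ((t⁻¹ : GroupLike k H) : H)) := rfl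

lemma val_mul_val_inv (t : GroupLike k H) : (t : H) * ((t⁻¹ : GroupLike k H) : H) = 1 := by
  rw [← GroupLike.val_mul, mul_inv_cancel, GroupLike.val_one]

lemma val_inv_mul_val (t : GroupLike k H) : ((t⁻¹ : GroupLike k H) : H) * (t : H) = 1 := by
  rw [← GroupLike.val_mul, inv_mul_cancel, GroupLike.val_one]

lemma conj_mem_space {t : GroupLike k H} {y : H} (hy : y ∈ space k (t : H)) :
    conj k t y ∈ space k (t : H) := by
  rw [mem_space] at *
  rw [conj_apply, Bialgebra.comul_mul, Bialgebra.comul_mul, hy, t.2.comul_eq_tmul_self,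
    (t⁻¹).2.comul_eq_tmul_self]
  simp only [add_mul, mul_add, Algebra.TensorProduct.tmul_mul_tmul, val_mul_val_inv, one_mul,
    mul_one]

lemma conj_pow_apply (t : GroupLike k H) (n : ℕ) (h : H) :
    (conj k t ^ n) h = ((t ^ n : GroupLike k H) : H) * (h * (((t ^ n)⁻¹ : GroupLike k H) : H)) := by
  induction n with
  | zero => simp
  | succ n ih =>
    rw [pow_succ', Module.End.mul_apply, ih, conj_apply]
    simp only [pow_succ' t, mul_inv_rev, GroupLike.val_mul, mul_assoc]

/-- A nontrivial skew-primitive element can be chosen to be an eigenvector. -/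
lemma exists_eigenvector [IsAlgClosed k] [CharZero k] {p : ℕ} (hp : p.Prime) {t : GroupLike k H}
    (ht : t ^ p = 1) {y : H} (hy : y ∈ space k (t : H))
    (hyt : y ∉ Submodule.span k {(t : H) - 1}) :
    ∃ z ∈ space k (t : H), z ∉ Submodule.span k {(t : H) - 1} ∧
      ∃ ζ : k, ζ ^ p = 1 ∧ (t : H) * z = ζ • (z * t) := by
  have hp0 : (p : k) ≠ 0 := Nat.cast_ne_zero.mpr hp.ne_zero
  have : NeZero (p : k) := ⟨hp0⟩
  obtain ⟨ω, hω⟩ := HasEnoughRootsOfUnity.exists_primitiveRoot k p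
  have hC : conj k t ^ p = 1 := by
    ext h
    rw [conj_pow_apply, ht, inv_one, GroupLike.val_one, one_mul, mul_one, Module.End.one_apply]
  -- Up to the factor p these are the components of y in the eigenspaces of conjugation by t; they
  -- sum to p y, so one of them is nontrivial.
  let z : ℕ → H := fun s => (∑ i ∈ Finset.range p, (ω ^ s • conj k t) ^ i) y
  have hzs : ∀ s, z s ∈ space k (t : H) := by
    intro s
    have h1 : ∀ n : ℕ, ((ω ^ s • conj k t) ^ n) y ∈ space k (t : H) := by
      intro n
      induction n with
      | zero => exact hy
      | succ n ih =>
        rw [pow_succ', Module.End.mul_apply]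
        exact Submodule.smul_mem _ _ (conj_mem_space ih)
    simp only [z, LinearMap.sum_apply]
    exact Submodule.sum_mem _ fun i _ => h1 i
  have hω0 : ω ≠ 0 := hω.ne_zero hp.ne_zero
  have hzc : ∀ s, (t : H) * z s = (ω ^ s)⁻¹ • (z s * t) := by
    intro s
    have h1 := mul_geom_sum (ω ^ s • conj k t) p
    rw [smul_pow, hC, ← pow_mul, mul_comm s, pow_mul, hω.pow_eq_one, one_pow, one_smul, sub_self,
      sub_mul, one_mul, sub_eq_zero] at h1
    have h2 : ω ^ s • conj k t (z s) = z s := LinearMap.congr_fun h1 y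
    rw [eq_inv_smul_iff₀ (pow_ne_zero s hω0)]
    conv_rhs => rw [← h2]
    rw [conj_apply, smul_mul_assoc, mul_assoc, mul_assoc, val_inv_mul_val, mul_one]
  by_contra! hcon
  have hmem : ∀ s, z s ∈ Submodule.span k {(t : H) - 1} := by
    intro s
    by_contra h
    refine hcon (z s) (hzs s) h ((ω ^ s)⁻¹) ?_ (hzc s)
    rw [inv_pow, ← pow_mul, mul_comm, pow_mul, hω.pow_eq_one, one_pow, inv_one]
  have hsum : ∑ s ∈ Finset.range p, z s = (p : k) • y := by
    simp only [z, LinearMap.sum_apply, smul_pow, LinearMap.smul_apply]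
    rw [Finset.sum_comm]
    simp only [← Finset.sum_smul]
    rw [Finset.sum_eq_single_of_mem 0 (Finset.mem_range.mpr hp.pos) fun i hi hi0 => ?_]
    · simp
    · have h1 : (ω ^ i) ^ p = 1 := by rw [← pow_mul, mul_comm, pow_mul, hω.pow_eq_one, one_pow]
      have h2 : ω ^ i ≠ 1 := hω.pow_ne_one_of_pos_of_lt hi0 (Finset.mem_range.mp hi)
      have h3 := mul_geom_sum (ω ^ i) p
      rw [h1, sub_self] at h3
      have h4 := (mul_eq_zero.mp h3).resolve_left (sub_ne_zero.mpr h2)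
      simp only [← pow_mul, mul_comm _ i] at h4 ⊢
      rw [h4, zero_smul]
  apply hyt
  rw [← Submodule.smul_mem_iff _ hp0, ← hsum]
  exact Submodule.sum_mem _ fun s _ => hmem s

variable [FiniteDimensional k H]

lemma conj_twistEquiv (h : H) (f : Module.End k (H ⊗[k] H))
    (hf : ∀ z, comul (R := k) h * z = f z) :
    (twistEquiv k H).conj (TensorProduct.map (LinearMap.mulLeft k h) 1) = f := by
  apply LinearMap.ext
  intro z
  obtain ⟨z, rfl⟩ := (twistEquiv k H).surjective z
  rw [LinearEquiv.conj_apply]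
  simp only [LinearMap.comp_apply, LinearEquiv.coe_coe, LinearEquiv.symm_apply_apply]
  rw [twistEquiv_mul, hf]

/-- A finite-dimensional Hopf algebra with a nontrivial skew-primitive element whose group-like
elements have order dividing `p` has dimension divisible by the square of `p`. -/
theorem sq_dvd_finrank [IsAlgClosed k] [CharZero k] {p : ℕ} (hp : p.Prime)
    (hG : ∀ g : GroupLike k H, g ^ p = 1) {x : H} (hx : IsNontrivialSkewPrimitive k x) :
    p * p ∣ Module.finrank k H := by
  have := Fact.mk hp
  obtain ⟨g, h, hg, hh, hxc, hxs⟩ := hx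
  obtain ⟨t, y₀, hy₀, hyt₀⟩ : ∃ t : GroupLike k H, ∃ y ∈ space k (t : H),
      y ∉ Submodule.span k {(t : H) - 1} := by
    let g' : GroupLike k H := ⟨g, hg⟩
    let h' : GroupLike k H := ⟨h, hh⟩
    have h1 : h * ((h'⁻¹ : GroupLike k H) : H) = 1 := val_mul_val_inv h'
    have h2 : ((h'⁻¹ : GroupLike k H) : H) * h = 1 := val_inv_mul_val h'
    refine ⟨g' * h'⁻¹, x * ((h'⁻¹ : GroupLike k H) : H), ?_, fun hmem => hxs ?_⟩
    · rw [mem_space, Bialgebra.comul_mul, hxc, (h'⁻¹).2.comul_eq_tmul_self, add_mul,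
        Algebra.TensorProduct.tmul_mul_tmul, Algebra.TensorProduct.tmul_mul_tmul, h1]
      rfl
    · obtain ⟨c, hc⟩ := Submodule.mem_span_singleton.mp hmem
      refine Submodule.mem_span_singleton.mpr ⟨c, ?_⟩
      have h3 := congrArg (· * h) hc
      simp only [smul_mul_assoc, sub_mul, one_mul, GroupLike.val_mul, mul_assoc, h2, mul_one] at h3
      exact h3
  obtain ⟨y, hy, hyt, ζ, hζ, hty⟩ := exists_eigenvector hp (hG t) hy₀ hyt₀
  have hy0 : y ≠ 0 := by rintro rfl; exact hyt (zero_mem _)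
  have hζ1 : ζ ≠ 1 := by
    rintro rfl
    rw [one_smul] at hty
    exact hyt (mem_span_of_commute hp (hG t) hy hty)
  have ht1 : t ≠ 1 := by
    rintro rfl
    rw [GroupLike.val_one, one_mul, mul_one] at hty
    have h1 : (1 - ζ) • y = 0 := by rw [sub_smul, one_smul, ← hty, sub_self]
    exact hζ1 (sub_eq_zero.mp ((smul_eq_zero.mp h1).resolve_right hy0)).symm
  have htp : (t : H) ^ p = 1 := by rw [← GroupLike.val_pow, hG t, GroupLike.val_one]
  -- By the quantum binomial theorem y^p is primitive, and primitive elements are 0 by the commuting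
  -- case with t = 1.
  have hyp : y ^ p = 0 := by
    have h1 : y ^ p ∈ space k ((1 : GroupLike k H) : H) := by
      rw [mem_space, Bialgebra.comul_pow, mem_space.mp hy,
        add_pow_prime_of_skew_comm (skew_comm hty) hp hζ hζ1, Algebra.TensorProduct.tmul_pow,
        Algebra.TensorProduct.tmul_pow, htp, one_pow, GroupLike.val_one]
    have h2 := mem_span_of_commute hp (one_pow p) h1 (by
      rw [GroupLike.val_one, one_mul, mul_one])
    rw [GroupLike.val_one, sub_self, Submodule.span_zero_singleton, Submodule.mem_bot] at h2
    exact h2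
  obtain ⟨m, hm1, -, hm⟩ := exists_geom_sum_eq_zero hy hty hy0 ⟨p, hyp⟩
  have hpm : p ∣ m + 2 := by
    have h1 := mul_geom_sum ζ (m + 2)
    rw [hm, mul_zero] at h1
    rw [← orderOf_eq_prime hζ hζ1]
    exact orderOf_dvd_of_pow_eq_one (sub_eq_zero.mp h1.symm)
  obtain ⟨n, rfl⟩ := Nat.exists_eq_succ_of_ne_zero hp.ne_zero
  have hyn : y ^ n ≠ 0 := by
    intro h0
    apply hm1
    have := Nat.le_of_dvd (by omega) hpm
    rw [show m + 1 = n + (m + 1 - n) by omega, pow_add, h0, zero_mul]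
  have hn : 0 < n := by have := hp.one_lt; omega
  refine TensorShift.sq_dvd_finrank (V := H) (Γ := LinearMap.mulLeft k (t : H))
    (X := LinearMap.mulLeft k y) hn ?_ hζ ?_ ?_ ?_ ?_ (twistEquiv k H) ?_ ?_
  · rw [LinearMap.pow_mulLeft, htp, LinearMap.mulLeft_one]; rfl
  · ext h
    simp only [Module.End.mul_apply, LinearMap.mulLeft_apply, LinearMap.smul_apply, ← mul_assoc, hty,
      smul_mul_assoc]
  · rw [LinearMap.pow_mulLeft, hyp]
    ext h
    simp
  · intro h0
    apply hyn
    rw [LinearMap.pow_mulLeft] at h0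
    simpa using LinearMap.congr_fun h0 1
  · intro i hi hin
    rw [LinearMap.pow_mulLeft]
    refine GroupLikeTrace.trace_mulLeft_eq_zero (p := n + 1) (t ^ i) (hG _) fun h1 => ?_
    have := Nat.le_of_dvd hi (orderOf_eq_prime (hG t) ht1 ▸ orderOf_dvd_of_pow_eq_one h1)
    omega
  · refine conj_twistEquiv _ _ fun z => ?_
    rw [mem_space.mp hy, add_mul, tmul_mul_eq_map, tmul_mul_eq_map, LinearMap.mulLeft_one]
    rfl
  · refine conj_twistEquiv _ _ fun z => ?_
    rw [t.2.comul_eq_tmul_self, tmul_mul_eq_map]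

end SkewPrimitive

/-! ### Assembling the Cartan system and the theorem -/

namespace SplitPresentation

open ConvDual

variable {k H : Type*} [Field k] [CharZero k] [IsAlgClosed k] [Ring H] [HopfAlgebra k H]
  [FiniteDimensional k H]

/-- The Cartan system of the dual of a non-cosemisimple Hopf algebra of prime group order without
nontrivial skew-primitive elements. -/
theorem exists_cartanSystem (hH : ¬ IsCosemisimple k H)
    (hNSP : ∀ x : H, ¬ IsNontrivialSkewPrimitive k x) [Fintype (GroupLike k H)]
    (hp : (Fintype.card (GroupLike k H)).Prime) (P : SplitPresentation k (ConvDual k H)) :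
    letI := P.mulAction
    ∃ X : CartanSystem (GroupLike k H) (Fin P.n), X.d = P.d ∧ X.c = P.c := by
  let := P.mulAction
  obtain ⟨-, φ, hφ⟩ := HopfIntegral.antipode_bijective_and_exists_frobenius k H
  obtain ⟨ν, hd, hc, h2⟩ := P.exists_nakayama_perm hφ
  obtain ⟨ε, hε, hqε⟩ := P.exists_linear_idempotent
  have hNE : ∀ z ∈ P.J, ε * z * ε ∈ P.J * P.J := fun z hz => P.linear_mul_linear_mem hNSP hqε hz
  have hNS := P.exists_mul_e_ne_zero hH
  refine ⟨{
    d := P.d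
    c := P.c
    o := P.o
    ν := ν
    d_pos := fun i => Nat.pos_of_ne_zero (NeZero.ne _)
    d_smul := P.d_act
    c_smul := P.c_act
    d_o := P.d_o
    exists_smul := fun i hi => P.exists_groupLike hi
    d_ν := hd
    c_ν := hc
    one_le := P.one_le_c_self
    two_le := h2
    nonlinear := exists_nonlinear hqε hε hNE P.d_o hNS
    le_two := fun T hT hcT hrest => sum_linear_le_two hqε hε hNE P.d_o hNS hφ hT hcT hrest
    dvd := fun g i hg hi => P.dvd_of_act_eq hp pow_card_eq_one hg hi
    tensor := fun S hS hfree h3 => P.exists_tensor_multiplicities hε hqε hNE hS hfree h3 }, rfl, rfl⟩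

end SplitPresentation

/-- A non-cosemisimple Hopf algebra without nontrivial skew-primitive elements cannot have dimension
`N * p` with `p` group-like elements for small `N`. -/
theorem card_groupLike_ne {k H : Type*} [Field k] [CharZero k] [IsAlgClosed k] [Ring H]
    [HopfAlgebra k H] [FiniteDimensional k H] (hH : ¬ IsCosemisimple k H)
    (hNSP : ∀ x : H, ¬ IsNontrivialSkewPrimitive k x) {p N : ℕ} (hp : p.Prime)
    (hdim : Module.finrank k H = N * p)
    (hN : 3 ≤ p ∧ (N = 12 ∨ N = 15 ∨ N = 16) ∨ 5 ≤ p ∧ (N = 20 ∨ N = 21)) :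
    Nat.card (GroupLike k H) ≠ p := by
  rintro rfl
  have : Finite (GroupLike k H) := Nat.finite_of_card_ne_zero hp.ne_zero
  let := Fintype.ofFinite (GroupLike k H)
  rw [Nat.card_eq_fintype_card] at hp hdim hN
  obtain ⟨P⟩ := SplitPresentation.nonempty k (ConvDual k H)
  let := P.mulAction
  obtain ⟨X, hXd, hXc⟩ := P.exists_cartanSystem hH hNSP hp
  refine X.false_of_dim hp ?_ hN
  rw [← hdim, ← ConvDual.finrank_eq, P.finrank_eq]
  simp only [CartanSystem.r, hXd, hXc]
  rfl

/-- Without the assumption on skew-primitive elements, when `p` does not divide `N`. -/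
theorem card_groupLike_ne_of_not_dvd {k H : Type*} [Field k] [CharZero k] [IsAlgClosed k] [Ring H]
    [HopfAlgebra k H] [FiniteDimensional k H] (hH : ¬ IsCosemisimple k H) {p N : ℕ} (hp : p.Prime)
    (hpN : ¬ p ∣ N) (hdim : Module.finrank k H = N * p)
    (hN : 3 ≤ p ∧ (N = 12 ∨ N = 15 ∨ N = 16) ∨ 5 ≤ p ∧ (N = 20 ∨ N = 21)) :
    Nat.card (GroupLike k H) ≠ p := by
  intro hcard
  refine card_groupLike_ne hH (fun x hx => hpN ?_) hp hdim hN hcard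
  have hG : ∀ g : GroupLike k H, g ^ p = 1 := fun g => by rw [← hcard, pow_card_eq_one']
  have h1 := SkewPrimitive.sq_dvd_finrank hp hG hx
  rw [hdim] at h1
  exact Nat.dvd_of_mul_dvd_mul_right hp.pos h1

end

theorem theorem2 {k : Type*} [Field k] [IsAlgClosed k] [CharZero k]
    {H : Type*} [Ring H] [HopfAlgebra k H] [FiniteDimensional k H]
    (hH : ¬ Coalgebra.IsCosemisimple k H) :
    (∀ p : ℕ, p.Prime →
      (Module.finrank k H = 12 * p → 3 < p → Nat.card (GroupLike k H) ≠ p) ∧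
      (Module.finrank k H = 15 * p → 5 < p → Nat.card (GroupLike k H) ≠ p) ∧
      (Module.finrank k H = 16 * p → 3 ≤ p → Nat.card (GroupLike k H) ≠ p) ∧
      (Module.finrank k H = 20 * p → 5 < p → Nat.card (GroupLike k H) ≠ p) ∧
      (Module.finrank k H = 21 * p → p = 5 ∨ 7 < p → Nat.card (GroupLike k H) ≠ p)) ∧
    ((∀ x : H, ¬ Coalgebra.IsNontrivialSkewPrimitive k x) →
      (Module.finrank k H = 36 ∨ Module.finrank k H = 45 → Nat.card (GroupLike k H) ≠ 3) ∧
      (Module.finrank k H = 75 ∨ Module.finrank k H = 100 →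
        Nat.card (GroupLike k H) ≠ 5)) := by
  refine ⟨fun p hp => ?_, fun hNSP => ⟨?_, ?_⟩⟩
  · refine ⟨fun hd h => ?_, fun hd h => ?_, fun hd h => ?_, fun hd h => ?_, fun hd h => ?_⟩
    · refine card_groupLike_ne_of_not_dvd hH hp (fun hdvd => ?_) hd (by omega)
      have h1 : p ∣ 2 * 2 * 3 := hdvd
      rw [hp.dvd_mul, hp.dvd_mul] at h1
      rcases h1 with (h1 | h1) | h1 <;> have := Nat.le_of_dvd (by norm_num) h1 <;> omega
    · refine card_groupLike_ne_of_not_dvd hH hp (fun hdvd => ?_) hd (by omega)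
      have h1 : p ∣ 3 * 5 := hdvd
      rw [hp.dvd_mul] at h1
      rcases h1 with h1 | h1 <;> have := Nat.le_of_dvd (by norm_num) h1 <;> omega
    · refine card_groupLike_ne_of_not_dvd hH hp (fun hdvd => ?_) hd (by omega)
      have h1 : p ∣ 2 ^ 4 := hdvd
      have := Nat.le_of_dvd (by norm_num) (hp.dvd_of_dvd_pow h1)
      omega
    · refine card_groupLike_ne_of_not_dvd hH hp (fun hdvd => ?_) hd (by omega)
      have h1 : p ∣ 2 * 2 * 5 := hdvd
      rw [hp.dvd_mul, hp.dvd_mul] at h1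
      rcases h1 with (h1 | h1) | h1 <;> have := Nat.le_of_dvd (by norm_num) h1 <;> omega
    · refine card_groupLike_ne_of_not_dvd hH hp (fun hdvd => ?_) hd (by omega)
      have h1 : p ∣ 3 * 7 := hdvd
      rw [hp.dvd_mul] at h1
      rcases h with rfl | h
      · omega
      · rcases h1 with h1 | h1 <;> have := Nat.le_of_dvd (by norm_num) h1 <;> omega
  -- The dimensions 12·3, 15·3, 15·5 and 20·5 are cases where p divides N, so divisibility by p²
  -- does not exclude skew-primitives.
  · rintro (h | h)
    · exact card_groupLike_ne hH hNSP (N := 12) Nat.prime_three h (by omega)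
    · exact card_groupLike_ne hH hNSP (N := 15) Nat.prime_three h (by omega)
  · rintro (h | h)
    · exact card_groupLike_ne hH hNSP (N := 15) Nat.prime_five h (by omega)
    · exact card_groupLike_ne hH hNSP (N := 20) Nat.prime_five h (by omega)
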